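/- **Channels.** Let $n$ be even and $\delta>0$. In $n$ rounds of a *binary interactive insertion-deletion channel* two intermediaries $C_A$ and $C_B$ exchange bits in a message-driven way: $C_A$ starts, and an intermediary that receives a bit replies with a bit; each of them can send at most $n/2$ bits, and the communication ends when an intermediary that has used up its bits has to send again. A *non-oblivious adversary* sees everything communicated so far and may perform up to $n\delta$ *edit corruptions*, each of which deletes the bit in transit and inserts a bit of the adversary's choice, aimed either at its addressee or at its sender. **Simulation.** $C_A$ talks to Alice and $C_B$ talks to Bob. Alice first gives a bit to $C_A$. An intermediary that receives a bit (from its user or from the channel) either reveals a bit to its user, who then answers with a new bit (except Alice, after the $\frac{n'}2$-th bit revealed to her), or sends a bit over the channel; after the last bit revealed to Alice, $C_A$ goes on without an answer. The intermediaries may use private random coins. Alice and Bob are arbitrary: their bits are arbitrary functions of the bits revealed to them. Let $X_i,\tilde X_i$ be the $i$-th bits given by Alice and revealed to Bob, and $Y_i,\tilde Y_i$ the $i$-th bits given by Bob and revealed to Alice. The transmitted symbols of the simulated channel are, in this order, $X_1,Y_1,X_2,Y_2,\dots,X_{n'/2},Y_{n'/2}$, and $X_i$ (resp. $Y_i$)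 is corrupted if $\tilde X_i\ne X_i$ (resp. $\tilde Y_i\neq Y_i$). The intermediaries *simulate $n'$ rounds of a binary interactive $(\delta',r)$-block corruption channel with probability $1-\eta$* if, for all Alice, Bob and every adversary, exactly $n'/2$ bits are always revealed to each of Alice and Bob, and, with probability at least $1-\eta$ over the coins, at most $n'\delta'$ symbols are corrupted and these are covered by at most $n'\delta'/r$ blocks of $r$ consecutively transmitted symbols. **Theorem.** (1) There are constants $C,C',c>0$ and $\delta_0\in(0,1)$ such that for all $0<\delta\le\delta_0$ and all even $n$ one can simulate $$n'=2\Big\lfloor \tfrac12\, n\big(1-C\sqrt{\delta\log(1/\delta)}\big)\Big\rfloor$$ rounds of a binary interactive $\Big(C'\sqrt{\delta\log(1/\delta)},\ \sqrt{\log(1/\delta)/\delta}\Big)$-block corruption channel over $n$ rounds of a binary interactive insertion-deletion channel with at most $n\delta$ edit corruptions by a non-oblivious adversary, with probability at least $1-\exp\big(-c\,n\delta\log(1/\delta)\big)$. (A negative floor in $n'$ is read as $0$.) (2) The simulation is efficient if the synchronization string is efficient. That is, call $S\in\Sigma^m$ an *$\varepsilon$-synchronization string* if $\mathrm{ED}(S[i,j),S[j,k))>(1-\varepsilon)(k-i)$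 for all $1\le i<j<k\le m+1$, where $\mathrm{ED}$ is the minimum number of insertions and deletions that turn one string into the other. For every $\varepsilon\in(0,1)$ and every finite alphabet $\Sigma$ there are constants $C,C',c,\delta_0$ as in (1), two programs (for a unit-cost random access machine with addition and truncated subtraction) and a polynomial $p$ such that for all $0<\delta\le\delta_0$, all even $n$ and every $\varepsilon$-synchronization string $S\in\Sigma^n$ there is a simulation as in (1) that uses at most $p(n)$ coins, and in which the programs, given the numbers $n,\lfloor n\delta\rfloor,n',\lfloor\sqrt{\log(1/\delta)/\delta}\rfloor$ and access to $S$, to the coins and to the list of the $k$ bits and notices that the intermediary has received so far, compute every action of $C_A$ and of $C_B$, respectively, in at most $p(n+k)$ steps. -/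

import Mathlib

namespace IndelSim

/-! ### The two ends of the channel -/

/-- The two ends. The intermediary at the end `alice` is `C_A`, the one at `bob` is `C_B`. -/
inductive Party
  | alice
  | bob
  deriving DecidableEq

/-- The opposite end. -/
def Party.other : Party → Party
  | .alice => .bob
  | .bob => .alice

/-- What an intermediary may receive: a symbol from its own user (Alice or Bob), the notice that
its user has received its last symbol and stays silent from now on, or a symbol that arrives over
the insertion-deletion channel. -/
inductive Event
  | user (x : Bool)
  | userDone
  | channel (x : Bool)

/-- The reaction of an intermediary to an event: reveal a symbol to its user, or send a symbol
over the insertion-deletion channel. -/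
inductive Action
  | reveal (x : Bool)
  | send (x : Bool)

/-- A randomized intermediary with `L` private coins: its next action depends on its coins and on
the chronological list of everything it has received. -/
abbrev Intermediary (L : ℕ) := (Fin L → Bool) → List Event → Action

/-- The two users, i.e. an arbitrary alternating protocol: the next symbol that a user gives to its
intermediary depends on the list of the symbols revealed to that user so far. -/
abbrev Users := Party → List Bool → Bool

/-- A non-oblivious adversary. Whenever a symbol is in transit, it sees all symbols sent over the
channel so far together with their senders (the last entry is the symbol in transit) and everything
that the two intermediaries have received so far. It answers `none` (deliver the symbol) or
`some (p, y)`: an edit corruption, which deletes the symbol in transit and inserts the symbol `y`,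
aimed at the end `p`. If `p` is the addressee this is a substitution, if `p` is the sender it is a
spurious reply. -/
abbrev Adversary :=
  List (Party × Bool) → (Party → List Event) → Option (Party × Bool)

/-! ### Executions -/

/-- The global state of the simulation. -/
structure Config where
  /-- the communication is over -/
  halted : Bool
  /-- the end whose intermediary has just received something and acts next -/
  awake : Party
  /-- everything received by the intermediary, in chronological order -/
  view : Party → List Event
  /-- symbols given by the user to its intermediary -/
  given : Party → List Bool
  /-- symbols revealed to the user by its intermediary -/
  revealed : Party → List Bool
  /-- all symbols sent over the insertion-deletion channel, with their senders -/
  log : List (Party × Bool)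
  /-- number of edit corruptions so far -/
  edits : ℕ

/-- The number of symbols that `p` has sent over the channel. -/
def Config.numSent (c : Config) (p : Party) : ℕ :=
  (c.log.filter (fun m => decide (m.1 = p))).length

/-- The symbol `y` arrives over the channel at the end `p`, which wakes up. -/
def Config.deliver (c : Config) (p : Party) (y : Bool) : Config :=
  { c with
    awake := p
    view := Function.update c.view p (c.view p ++ [Event.channel y]) }

/-- The communication starts when Alice gives her first symbol to `C_A`. -/
def initConfig (users : Users) : Config where
  halted := false
  awake := .alice
  view := Function.update (fun _ => []) .alice [Event.user (users .alice [])]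
  given := Function.update (fun _ => []) .alice [users .alice []]
  revealed := fun _ => []
  log := []
  edits := 0

/-- One action of the intermediary that is awake, together with its consequences, in a simulation
of `N` rounds over `n` rounds of a binary interactive insertion-deletion channel on which at most
`e` edit corruptions are possible.

* After a `reveal`, the user answers with its next symbol, except that Alice is silent after her
  symbol number `N / 2`.
* Either intermediary can send at most `n / 2` symbols. The communication ends when the
  intermediary that is awake has to send a symbol after that. -/
def step (n e N : ℕ) (users : Users) (interm : Party → List Event → Action) (adv : Adversary)
    (c : Config) : Config :=
  if c.halted then c
  else
    match interm c.awake (c.view c.awake) with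
    | .reveal x =>
      let got : List Bool := c.revealed c.awake ++ [x]
      if c.awake = .alice ∧ N / 2 ≤ got.length then
        { c with
          revealed := Function.update c.revealed c.awake got
          view := Function.update c.view c.awake (c.view c.awake ++ [Event.userDone]) }
      else
        { c with
          revealed := Function.update c.revealed c.awake got
          given := Function.update c.given c.awake (c.given c.awake ++ [users c.awake got])
          view := Function.update c.view c.awake
            (c.view c.awake ++ [Event.user (users c.awake got)]) }
    | .send x =>
      if n / 2 ≤ c.numSent c.awake then { c with halted := true }
      else
        let c' : Config := { c with log := c.log ++ [(c.awake, x)] }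
        match adv c'.log c'.view with
        | none => c'.deliver c.awake.other x
        | some (p, y) =>
          if c.edits < e then { c'.deliver p y with edits := c.edits + 1 }
          else c'.deliver c.awake.other x

/-- The final state. Intermediaries that together reveal `N` symbols take at most `n + N + 1`
actions: at most `n` symbols are sent, and one more action ends the communication. -/
def run (n e N : ℕ) (users : Users) (interm : Party → List Event → Action) (adv : Adversary) :
    Config :=
  (step n e N users interm adv)^[n + N + 1] (initConfig users)

/-- The communication is over and exactly `N / 2` symbols have been revealed to each user. -/
def Config.Completes (N : ℕ) (c : Config) : Prop :=
  c.halted = true ∧ ∀ p, (c.revealed p).length = N / 2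

/-! ### Block corruption channels -/

/-- The symbols of the simulated channel in the order of their transmission are
`X₀, Y₀, X₁, Y₁, …`, with `X` given by Alice and `Y` given by Bob. Position `2 i` is corrupted if
the symbol number `i` revealed to Bob is not `X i`, position `2 i + 1` is corrupted if the symbol
number `i` revealed to Alice is not `Y i`. -/
def Config.corrupted (N : ℕ) (c : Config) : Finset ℕ :=
  (Finset.range N).filter fun p =>
    if p % 2 = 0 then (c.given .alice)[p / 2]? ≠ (c.revealed .bob)[p / 2]?
    else (c.given .bob)[p / 2]? ≠ (c.revealed .alice)[p / 2]?

/-- The corruption patterns of an `N`-round `(δ', r)`-block corruption channel: at most `N δ'`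
corrupted positions, which are covered by at most `N δ' / r` blocks of `r` consecutively
transmitted symbols. -/
def IsBlockCorruption (N : ℕ) (δ' r : ℝ) (E : Finset ℕ) : Prop :=
  E ⊆ Finset.range N ∧ (E.card : ℝ) ≤ N * δ' ∧
    ∃ T : Finset ℕ, (T.card : ℝ) ≤ N * δ' / r ∧
      ∀ p ∈ E, ∃ t ∈ T, t ≤ p ∧ (p : ℝ) < t + r

/-! ### Simulations -/

/-- The two intermediaries, with their coins fixed. -/
def pair {L : ℕ} (A B : Intermediary L) (ω : (Fin L → Bool) × (Fin L → Bool)) :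
    Party → List Event → Action
  | .alice => A ω.1
  | .bob => B ω.2

/-- `A` and `B` simulate `N` rounds of a `(δ', r)`-block corruption channel over `n` rounds of a
binary interactive insertion-deletion channel with at most `e` edit corruptions by a non-oblivious
adversary, with failure probability at most `η`: for all users and every adversary, exactly `N / 2`
symbols are always revealed to each user, and the corrupted positions form a pattern of the block
corruption channel with probability at least `1 - η` over the independent uniform coins. -/
def Simulates (n e N : ℕ) (δ' r η : ℝ) {L : ℕ} (A B : Intermediary L) : Prop :=
  ∀ (users : Users) (adv : Adversary),
    (∀ ω, (run n e N users (pair A B ω) adv).Completes N) ∧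
    1 - η ≤
      (({ω : (Fin L → Bool) × (Fin L → Bool) |
        IsBlockCorruption N δ' r ((run n e N users (pair A B ω) adv).corrupted N)}.ncard : ℕ) : ℝ) /
      ((2 : ℝ) ^ L * (2 : ℝ) ^ L)

/-! ### Parameters -/

/-- `√(δ log (1/δ))` -/
noncomputable def loss (δ : ℝ) : ℝ := √(δ * Real.log (1 / δ))

/-- `√(log (1/δ) / δ)` -/
noncomputable def blockLength (δ : ℝ) : ℝ := √(Real.log (1 / δ) / δ)

/-- `n (1 - C √(δ log (1/δ)))`, rounded down to an even number. -/
noncomputable def simRounds (C δ : ℝ) (n : ℕ) : ℕ := 2 * ⌊(n : ℝ) * (1 - C * loss δ) / 2⌋₊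

/-! ### Synchronization strings -/

/-- The edit distance: the least number of deletions and insertions that turn `u` into `v`. What
the deletions leave over is a common subsequence of `u` and `v`. -/
noncomputable def editDist {α : Type*} (u v : List α) : ℕ :=
  sInf {d | ∃ l : List α, l.Sublist u ∧ l.Sublist v ∧
    d = (u.length - l.length) + (v.length - l.length)}

/-- The substring `S[i], …, S[j-1]`. -/
def substring {α : Type*} (S : List α) (i j : ℕ) : List α := (S.drop i).take (j - i)

/-- `ε`-synchronization strings. -/
def IsSyncString {α : Type*} (ε : ℝ) (S : List α) : Prop :=
  ∀ i j k : ℕ, i < j → j < k → k ≤ S.length →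
    (1 - ε) * ((k : ℝ) - i) < (editDist (substring S i j) (substring S j k) : ℝ)

/-! ### Programs with a step count

A random access machine with addition and truncated subtraction as its only arithmetic operations.
The memory consists of arrays of natural numbers; a program names arrays by literals and computes
the indices. -/

/-- The memory: array, index, content. -/
abbrev Mem := ℕ → ℕ → ℕ

/-- Expressions. -/
inductive Expr
  | lit (k : ℕ)
  | load (a : ℕ) (i : Expr)
  | add (x y : Expr)
  | sub (x y : Expr)

/-- The value of an expression. -/
def Expr.eval (m : Mem) : Expr → ℕ
  | .lit k => k
  | .load a i => m a (i.eval m)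
  | .add x y => x.eval m + y.eval m
  | .sub x y => x.eval m - y.eval m

/-- The number of operations in an expression. -/
def Expr.cost : Expr → ℕ
  | .lit _ => 1
  | .load _ i => i.cost + 1
  | .add x y => x.cost + y.cost + 1
  | .sub x y => x.cost + y.cost + 1

/-- Programs: assignment to the cell `i` of array `a`, sequence, branching and loops. -/
inductive Prog
  | store (a : ℕ) (i x : Expr)
  | seq (P Q : Prog)
  | cond (x : Expr) (P Q : Prog)
  | loop (x : Expr) (P : Prog)

/-- `Exec P m t m'`: started in the memory `m`, the program `P` halts after `t` steps with the
memory `m'`. -/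
inductive Exec : Prog → Mem → ℕ → Mem → Prop
  | store (a : ℕ) (i x : Expr) (m : Mem) :
      Exec (.store a i x) m (i.cost + x.cost + 1)
        (Function.update m a (Function.update (m a) (i.eval m) (x.eval m)))
  | seq {P Q : Prog} {m m' m'' : Mem} {t t' : ℕ} :
      Exec P m t m' → Exec Q m' t' m'' → Exec (.seq P Q) m (t + t') m''
  | condTrue {x : Expr} {P Q : Prog} {m m' : Mem} {t : ℕ} :
      x.eval m ≠ 0 → Exec P m t m' → Exec (.cond x P Q) m (x.cost + 1 + t) m'
  | condFalse {x : Expr} {P Q : Prog} {m m' : Mem} {t : ℕ} :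
      x.eval m = 0 → Exec Q m t m' → Exec (.cond x P Q) m (x.cost + 1 + t) m'
  | loopEnd {x : Expr} {P : Prog} {m : Mem} :
      x.eval m = 0 → Exec (.loop x P) m (x.cost + 1) m
  | loopStep {x : Expr} {P : Prog} {m m' m'' : Mem} {t t' : ℕ} :
      x.eval m ≠ 0 → Exec P m t m' → Exec (.loop x P) m' t' m'' →
        Exec (.loop x P) m (x.cost + 1 + t + t') m''

/-- Events as numbers. -/
def Event.code : Event → ℕ
  | .user x => x.toNat
  | .userDone => 2
  | .channel x => 3 + x.toNat

/-- Actions as numbers. -/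
def Action.code : Action → ℕ
  | .reveal x => x.toNat
  | .send x => 2 + x.toNat

/-- The initial memory. Array 0: the numerical parameters, then the number of events received.
Array 1: the synchronization string. Array 2: the coins. Array 3: the events received. -/
def inputMem {q L : ℕ} (params : List ℕ) (S : List (Fin q)) (ω : Fin L → Bool)
    (h : List Event) : Mem
  | 0, i => (params ++ [h.length]).getD i 0
  | 1, i => (S.map Fin.val).getD i 0
  | 2, i => if hi : i < L then (ω ⟨i, hi⟩).toNat else 0
  | 3, i => (h.map Event.code).getD i 0
  | _, _ => 0

/-- Given the parameters and the synchronization string `S`, the program `P` computes every action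
of the intermediary `A` (into the first cell of array 4) from the coins and the events received so
far, in at most `T k` steps if `k` events have been received. -/
def ComputedBy {q L : ℕ} (params : List ℕ) (S : List (Fin q)) (T : ℕ → ℕ) (P : Prog)
    (A : Intermediary L) : Prop :=
  ∀ (ω : Fin L → Bool) (h : List Event), ∃ (t : ℕ) (m : Mem),
    Exec P (inputMem params S ω h) t m ∧ t ≤ T h.length ∧ m 4 0 = (A ω h).code

end IndelSim

namespace IndelSim

/-! ### Reactive intermediaries -/

/-! Whatever the adversary does, `C_A` receives exactly one symbol per round, where a round lasts
from one transmission of `C_A` to the next (`round_spec`). So `C_A` has a reliable clock, and what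
it sends and reveals at position `p` is laid down by `p`. Only `C_B` can lose its place.

The positions are cut into blocks of `R` positions, `R` being about `√(log (1/δ) / δ)`. Block number
`k` consists of a marker `1 0 … 0` of length `h = O(log (1/δ))`, of `h` random bits, of the symbol
number `k` of a synchronization string in unary, and of data; everything after the random bits is
masked by the bit sent `h` positions earlier. `C_B` unmasks by the same rule, accepts markers that
are at least `R` apart, reads the symbols behind them, and takes the prefix of the synchronization
string that is nearest in edit distance to the symbols read. The length of this prefix is its guess
of the number of blocks, and this gives the index of every data symbol. Skipped symbols are revealed
as `false`. The headers take the fraction `O(√(δ log (1/δ)))` of the positions.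

False markers. Before the first false marker of a block without edits, what `C_B` decodes and
answers does not depend on the mask (`Par.InBlock.dec_congr`), hence neither do the symbols under
the mask. The pattern at the false marker can then be unmasked backwards down to the random bits:
the place of the first false marker determines the mask (`Par.mask_unique`). So a block is unlucky
with probability at most `R / 2 ^ h`, given the coins of the other blocks' past. An exponential
moment (`Par.sum_pow_unluckyCount_le`) shows that there are fewer than `⌊n δ⌋` unlucky blocks, with
the required probability.

Guesses. Call a missed block and the wrongly accepted markers in it defects. If the guess is wrong,
an optimal alignment leaves the true one, and from there on its matches form, up to the number of
defects, a matching of the synchronization string with itself off the diagonal. Such matchings have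
density at most `ε` (`selfMatching_length`). So a wrong guess needs a stretch of blocks, ending at
the current one, in which defects have positive density (`Par.guess_bound`). A covering argument
(`Par.card_dense_le`) bounds the number of such bad blocks by a constant times the number of edits
and unlucky blocks, and nothing is corrupted outside of them (`Par.corrupted_bad`).

Synchronization strings over an alphabet of constant size exist by a counting argument
(`syncWords_growth`). If `n δ < 1`, there are no edits and the symbols are simply relayed. For
efficiency both intermediaries are written in a language of for-loops, whose programs run in
polynomial time by construction (`FProg.bound_le`, `FProg.exec_compile`). -/

/-- The reaction of the user at the end `p` after the symbols `v` have been revealed to it. -/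
def answer (N : ℕ) (users : Users) (p : Party) (v : List Bool) : Event :=
  if p = .alice ∧ N / 2 ≤ v.length then .userDone else .user (users p v)

/-- What the user contributes before anything is revealed to it. -/
def initEvents (users : Users) : Party → List Event
  | .alice => [.user (users .alice [])]
  | .bob => []

/-- The answers to the revealed symbols number `a, …, b - 1` of `v`. -/
def answers (N : ℕ) (users : Users) (p : Party) (v : List Bool) (a b : ℕ) : List Event :=
  (List.range' a (b - a)).map fun i => answer N users p (v.take (i + 1))

/-- The view of the intermediary at `p` after it has received the symbols `l.reverse`, if the
symbols `rev w` have been revealed once the reaction to the received symbols `w` is complete. -/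
def viewR (N : ℕ) (users : Users) (p : Party) (rev : List Bool → List Bool) :
    List Bool → List Event
  | [] => initEvents users p
  | b :: l => viewR N users p rev l ++ Event.channel b ::
      answers N users p (rev (b :: l).reverse) (rev l.reverse).length (rev (b :: l).reverse).length

/-- See `viewR`. -/
def viewOf (N : ℕ) (users : Users) (p : Party) (rev : List Bool → List Bool) (w : List Bool) :
    List Event := viewR N users p rev w.reverse

lemma viewOf_nil (N : ℕ) (users : Users) (p : Party) (rev : List Bool → List Bool) :
    viewOf N users p rev [] = initEvents users p := rfl

lemma viewOf_append (N : ℕ) (users : Users) (p : Party) (rev : List Bool → List Bool)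
    (w : List Bool) (b : Bool) :
    viewOf N users p rev (w ++ [b]) = viewOf N users p rev w ++ Event.channel b ::
      answers N users p (rev (w ++ [b])) (rev w).length (rev (w ++ [b])).length := by
  simp [viewOf, viewR]

/-- The symbols given by a user to which `v` has been revealed. -/
def givenOf (N : ℕ) (users : Users) (p : Party) (v : List Bool) : List Bool :=
  (match p with | .alice => [users .alice []] | .bob => []) ++
    (List.range v.length).flatMap fun i =>
      if p = .alice ∧ N / 2 ≤ i + 1 then [] else [users p (v.take (i + 1))]

/-- The intermediary `f` at the end `p` reveals `rev w` in reaction to the received symbols `w`, and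
then sends `out w`. -/
structure Reacts (N : ℕ) (users : Users) (p : Party) (f : List Event → Action)
    (rev : List Bool → List Bool) (out : List Bool → Bool) : Prop where
  rev_nil : rev [] = []
  rev_prefix : ∀ w b, rev w <+: rev (w ++ [b])
  rev_le : ∀ w, (rev w).length ≤ N / 2
  reveal : ∀ w b j, (rev w).length ≤ j → ∀ hj : j < (rev (w ++ [b])).length,
    f (viewOf N users p rev w ++ Event.channel b ::
      answers N users p (rev (w ++ [b])) (rev w).length j) = .reveal (rev (w ++ [b]))[j]
  send : ∀ w, (w ≠ [] ∨ p = .alice) → f (viewOf N users p rev w) = .send (out w)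

/-! ### The communication over the insertion-deletion channel -/

/-- The state of the communication between two reactive intermediaries when one of them is about to
send. -/
structure Talk where
  awake : Party
  received : Party → List Bool
  log : List (Party × Bool)
  edits : ℕ

def Talk.start : Talk := ⟨.alice, fun _ => [], [], 0⟩

/-- The symbol `y` sent with sender `p` (see `log`) arrives. -/
def Talk.deliver (s : Talk) (log : List (Party × Bool)) (p : Party) (y : Bool) (k : ℕ) : Talk :=
  ⟨p, Function.update s.received p (s.received p ++ [y]), log, s.edits + k⟩

/-- One transmission. -/
def Talk.next (e : ℕ) (adv : Adversary) (view : Party → List Bool → List Event)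
    (out : Party → List Bool → Bool) (s : Talk) : Talk :=
  let x := out s.awake (s.received s.awake)
  let log := s.log ++ [(s.awake, x)]
  match adv log (fun p => view p (s.received p)) with
  | none => s.deliver log s.awake.other x 0
  | some (p, y) => if s.edits < e then s.deliver log p y 1 else s.deliver log s.awake.other x 0

/-- The configuration that belongs to a state of the communication. -/
def Talk.config (N : ℕ) (users : Users) (rev : Party → List Bool → List Bool) (s : Talk) :
    Config where
  halted := false
  awake := s.awake
  view p := viewOf N users p (rev p) (s.received p)
  given p := givenOf N users p (rev p (s.received p))
  revealed p := rev p (s.received p)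
  log := s.log
  edits := s.edits

lemma start_config {N : ℕ} {users : Users} {rev : Party → List Bool → List Bool}
    (h : ∀ p, rev p [] = []) : Talk.start.config N users rev = initConfig users := by
  unfold Talk.start Talk.config initConfig
  congr 1
  · funext p; cases p <;> simp [viewOf_nil, initEvents, Function.update]
  · funext p; cases p <;> simp [h, givenOf, Function.update]
  · funext p; simp [h]

/-- The configuration after `received` has been extended by `b` at `p` and the symbols up to number
`j` have been revealed. -/
def Talk.pending (N : ℕ) (users : Users) (rev : Party → List Bool → List Bool) (s : Talk)
    (p : Party) (b : Bool) (log : List (Party × Bool)) (edits j : ℕ) : Config where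
  halted := false
  awake := p
  view := Function.update (fun p => viewOf N users p (rev p) (s.received p)) p
    (viewOf N users p (rev p) (s.received p) ++ Event.channel b ::
      answers N users p (rev p (s.received p ++ [b])) (rev p (s.received p)).length j)
  given := Function.update (fun p => givenOf N users p (rev p (s.received p))) p
    (givenOf N users p ((rev p (s.received p ++ [b])).take j))
  revealed := Function.update (fun p => rev p (s.received p)) p
    ((rev p (s.received p ++ [b])).take j)
  log := log
  edits := edits

section link

variable {n e N : ℕ} {users : Users} {f : Party → List Event → Action} {adv : Adversary}
  {rev : Party → List Bool → List Bool} {out : Party → List Bool → Bool}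

/-- The pending configurations interpolate, one reveal at a time, between the delivery of a symbol
and the next transmission. At the lower end nothing new has been revealed. -/
lemma pending_start (hf : ∀ p, Reacts N users p (f p) (rev p) (out p)) (s : Talk) (p : Party)
    (b : Bool) (log : List (Party × Bool)) (edits : ℕ) :
    s.pending N users rev p b log edits (rev p (s.received p)).length =
      ({ s.config N users rev with log := log, edits := edits } : Config).deliver p b := by
  obtain ⟨t, ht⟩ := (hf p).rev_prefix (s.received p) b
  unfold Talk.pending Talk.config Config.deliver
  congr 1
  · simp [answers]
  · rw [Function.update_eq_self_iff, ← ht]; simp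
  · rw [Function.update_eq_self_iff, ← ht]; simp

lemma givenOf_take_succ (v : List Bool) (p : Party) {j : ℕ} (hj : j < v.length) :
    givenOf N users p (v.take (j + 1)) = givenOf N users p (v.take j) ++
      (if p = .alice ∧ N / 2 ≤ j + 1 then [] else [users p (v.take (j + 1))]) := by
  unfold givenOf
  have h1 : (v.take (j + 1)).length = j + 1 := by simp; omega
  have h2 : (v.take j).length = j := by simp; omega
  rw [h1, h2, List.range_succ, List.flatMap_append, ← List.append_assoc]
  congr 1
  · congr 1
    rw [List.flatMap_def, List.flatMap_def]
    congr 1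
    apply List.map_congr_left
    intro i hi
    rw [List.mem_range] at hi
    rw [List.take_take, List.take_take, min_eq_left (by omega), min_eq_left (by omega)]
  · simp [List.take_take]

lemma step_reveal {c : Config} {x : Bool} (hh : c.halted = false)
    (hx : f c.awake (c.view c.awake) = .reveal x) :
    step n e N users f adv c = { c with
      revealed := Function.update c.revealed c.awake (c.revealed c.awake ++ [x])
      given := Function.update c.given c.awake (c.given c.awake ++
        if c.awake = .alice ∧ N / 2 ≤ (c.revealed c.awake ++ [x]).length then []
        else [users c.awake (c.revealed c.awake ++ [x])])
      view := Function.update c.view c.awake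
        (c.view c.awake ++ [answer N users c.awake (c.revealed c.awake ++ [x])]) } := by
  unfold step answer
  rw [hh, hx]
  simp only [Bool.false_eq_true, if_false]
  split_ifs with h
  · simp
  · rfl

lemma step_send {c : Config} {x : Bool} (hh : c.halted = false)
    (hx : f c.awake (c.view c.awake) = .send x) (hc : ¬ n / 2 ≤ c.numSent c.awake) :
    step n e N users f adv c =
      match adv (c.log ++ [(c.awake, x)]) c.view with
      | none => ({ c with log := c.log ++ [(c.awake, x)] } : Config).deliver c.awake.other x
      | some (p, y) =>
        if c.edits < e then
          ({ c with log := c.log ++ [(c.awake, x)], edits := c.edits + 1 } : Config).deliver p y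
        else ({ c with log := c.log ++ [(c.awake, x)] } : Config).deliver c.awake.other x := by
  unfold step
  rw [hh, hx]
  simp only [Bool.false_eq_true, if_false, if_neg hc]
  rfl

lemma step_pending (hf : ∀ p, Reacts N users p (f p) (rev p) (out p)) (s : Talk) (p : Party)
    (b : Bool) (log : List (Party × Bool)) (edits j : ℕ) (h1 : (rev p (s.received p)).length ≤ j)
    (h2 : j < (rev p (s.received p ++ [b])).length) :
    step n e N users f adv (s.pending N users rev p b log edits j) =
      s.pending N users rev p b log edits (j + 1) := by
  have hr := (hf p).reveal (s.received p) b j h1 h2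
  have hx : f (s.pending N users rev p b log edits j).awake
      ((s.pending N users rev p b log edits j).view (s.pending N users rev p b log edits j).awake) =
      .reveal (rev p (s.received p ++ [b]))[j] := by
    simpa [Talk.pending] using hr
  rw [step_reveal rfl hx]
  clear hx hr
  simp only [Talk.pending, Function.update_self, Function.update_idem]
  generalize rev p (s.received p ++ [b]) = v at *
  have hl : (v.take j ++ [v[j]]) = v.take (j + 1) := by simp
  have hlen : (v.take (j + 1)).length = j + 1 := by simp; omega
  have hans : answers N users p v (rev p (s.received p)).length (j + 1) =
      answers N users p v (rev p (s.received p)).length j ++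
        [answer N users p (v.take (j + 1))] := by
    unfold answers
    have h3 : j + 1 - (rev p (s.received p)).length = (j - (rev p (s.received p)).length) + 1 := by
      omega
    rw [h3, List.range'_1_concat, List.map_append, List.map_singleton]
    rw [Nat.add_sub_cancel' h1]
  rw [hl, hlen, hans, givenOf_take_succ v p h2]
  simp

lemma pending_end (s : Talk) (p : Party) (b : Bool) (log : List (Party × Bool)) (k : ℕ) :
    s.pending N users rev p b log (s.edits + k) (rev p (s.received p ++ [b])).length =
      (s.deliver log p b k).config N users rev := by
  unfold Talk.pending Talk.config Talk.deliver
  congr 1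
  · funext p'
    by_cases h : p' = p
    · subst h; simp [viewOf_append]
    · simp [h]
  · funext p'
    by_cases h : p' = p
    · subst h; simp
    · simp [h]
  · funext p'
    by_cases h : p' = p
    · subst h; simp
    · simp [h]

lemma iterate_pending (hf : ∀ p, Reacts N users p (f p) (rev p) (out p)) (s : Talk) (p : Party)
    (b : Bool) (log : List (Party × Bool)) (edits i : ℕ)
    (h : (rev p (s.received p)).length + i ≤ (rev p (s.received p ++ [b])).length) :
    (step n e N users f adv)^[i]
      (s.pending N users rev p b log edits (rev p (s.received p)).length) =
      s.pending N users rev p b log edits ((rev p (s.received p)).length + i) := by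
  induction i with
  | zero => rfl
  | succ i ih =>
    rw [Function.iterate_succ_apply', ih (by omega), step_pending hf _ _ _ _ _ _ (by omega)
      (by omega)]
    rfl

/-- The number of symbols revealed to the two users. -/
def Talk.shown (rev : Party → List Bool → List Bool) (s : Talk) : ℕ :=
  (rev .alice (s.received .alice)).length + (rev .bob (s.received .bob)).length

/-- The number of steps is expressed as the growth of `shown`, so that in the end the total can be
compared with the number of iterations in `run`. -/
lemma iterate_deliver (hf : ∀ p, Reacts N users p (f p) (rev p) (out p)) (s : Talk) (p : Party)
    (b : Bool) (log : List (Party × Bool)) (k : ℕ) :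
    ∃ i, i + s.shown rev = (s.deliver log p b k).shown rev ∧
      (step n e N users f adv)^[i]
        (({ s.config N users rev with log := log, edits := s.edits + k } : Config).deliver p b) =
      (s.deliver log p b k).config N users rev := by
  have hle := ((hf p).rev_prefix (s.received p) b).length_le
  refine ⟨(rev p (s.received p ++ [b])).length - (rev p (s.received p)).length, ?_, ?_⟩
  · cases p <;> simp [Talk.shown, Talk.deliver] <;> omega
  · rw [← pending_start hf, iterate_pending hf _ _ _ _ _ _ (by omega), Nat.add_sub_cancel' hle,
      pending_end]

/-- The intermediary that is awake may still send. -/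
def Talk.canSend (n : ℕ) (s : Talk) : Prop :=
  (s.log.filter (fun m => decide (m.1 = s.awake))).length < n / 2

/-- It has received something, or it is at Alice's end. -/
def Talk.Ready (s : Talk) : Prop := s.received s.awake ≠ [] ∨ s.awake = .alice

lemma next_ready (view : Party → List Bool → List Event) (s : Talk) :
    (s.next e adv view out).Ready := by
  unfold Talk.next Talk.Ready
  dsimp only
  split
  · left; simp [Talk.deliver]
  · split_ifs <;> (left; simp [Talk.deliver])

/-- A transmission takes one step for the `send` and one for each symbol revealed in reaction to it.
-/
lemma iterate_next (hf : ∀ p, Reacts N users p (f p) (rev p) (out p)) (s : Talk) (hs : s.Ready)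
    (hc : s.canSend n) :
    ∃ i, i + s.shown rev =
        (s.next e adv (fun p => viewOf N users p (rev p)) out).shown rev + 1 ∧
      (step n e N users f adv)^[i] (s.config N users rev) =
        (s.next e adv (fun p => viewOf N users p (rev p)) out).config N users rev := by
  have hsend := (hf s.awake).send (s.received s.awake) hs
  have hstep := step_send (n := n) (e := e) (N := N) (users := users) (f := f) (adv := adv)
    (c := s.config N users rev) rfl hsend (not_le.mpr hc)
  have key : ∀ p b k, step n e N users f adv (s.config N users rev) =
      (({ s.config N users rev with
        log := s.log ++ [(s.awake, out s.awake (s.received s.awake))],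
        edits := s.edits + k } : Config).deliver p b) →
      ∃ i, i + s.shown rev = (s.deliver
        (s.log ++ [(s.awake, out s.awake (s.received s.awake))]) p b k).shown rev + 1 ∧
      (step n e N users f adv)^[i] (s.config N users rev) =
      (s.deliver (s.log ++ [(s.awake, out s.awake (s.received s.awake))]) p b k).config N
        users rev := by
    intro p b k h
    obtain ⟨i, hi, hi'⟩ := iterate_deliver (n := n) (e := e) (adv := adv) hf s p b
      (s.log ++ [(s.awake, out s.awake (s.received s.awake))]) k
    exact ⟨i + 1, by omega, by rw [Function.iterate_succ_apply, h, hi']⟩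
  unfold Talk.next
  dsimp only
  cases hadv : adv (s.log ++ [(s.awake, out s.awake (s.received s.awake))])
      (fun p => viewOf N users p (rev p) (s.received p)) with
  | none => exact key _ _ 0 (by rw [hstep]; change (match adv (s.log ++ [(s.awake,
    out s.awake (s.received s.awake))]) (fun p => viewOf N users p (rev p)
      (s.received p)) with | none => _ | some (p, y) => _) = _; rw [hadv]; rfl)
  | some py =>
    obtain ⟨p, y⟩ := py
    change step n e N users f adv (s.config N users rev) =
      (match adv (s.log ++ [(s.awake, out s.awake (s.received s.awake))])
        (fun p => viewOf N users p (rev p) (s.received p)) with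
      | none => _
      | some (p, y) => if s.edits < e then _ else _) at hstep
    rw [hadv] at hstep
    dsimp only at hstep ⊢
    split_ifs at hstep ⊢ with he
    · exact key _ _ 1 hstep
    · exact key _ _ 0 hstep

/-- The sequence of the states of the communication. -/
def talk (e : ℕ) (adv : Adversary) (view : Party → List Bool → List Event)
    (out : Party → List Bool → Bool) (l : ℕ) : Talk :=
  (Talk.next e adv view out)^[l] Talk.start

lemma talk_succ (view : Party → List Bool → List Event) (l : ℕ) :
    talk e adv view out (l + 1) = (talk e adv view out l).next e adv view out := by
  unfold talk; rw [Function.iterate_succ_apply']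

lemma talk_ready (view : Party → List Bool → List Event) (l : ℕ) :
    (talk e adv view out l).Ready := by
  cases l with
  | zero => right; rfl
  | succ l => rw [talk_succ]; exact next_ready _ _

lemma iterate_talk (hf : ∀ p, Reacts N users p (f p) (rev p) (out p)) (l : ℕ)
    (hl : ∀ l' < l, (talk e adv (fun p => viewOf N users p (rev p)) out l').canSend n) :
    (step n e N users f adv)^[l + (talk e adv (fun p => viewOf N users p (rev p)) out l).shown rev]
      (initConfig users) =
      (talk e adv (fun p => viewOf N users p (rev p)) out l).config N users rev := by
  induction l with
  | zero =>
    have : (talk e adv (fun p => viewOf N users p (rev p)) out 0).shown rev = 0 := by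
      simp [talk, Talk.start, Talk.shown, (hf _).rev_nil]
    rw [this]
    exact (start_config (fun p => (hf p).rev_nil)).symm
  | succ l ih =>
    obtain ⟨i, hi, hi'⟩ := iterate_next hf (e := e) (adv := adv) _
      (talk_ready _ l) (hl l (Nat.lt_succ_self l))
    rw [← talk_succ] at hi hi'
    rw [← hi', ← ih (fun l' h => hl l' (by omega)), ← Function.iterate_add_apply]
    congr 1
    omega

/-- The final configuration of a simulation with reactive intermediaries. -/
lemma run_eq (hf : ∀ p, Reacts N users p (f p) (rev p) (out p)) (l : ℕ) (hln : l ≤ n)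
    (hl : ∀ l' < l, (talk e adv (fun p => viewOf N users p (rev p)) out l').canSend n)
    (hl' : ¬ (talk e adv (fun p => viewOf N users p (rev p)) out l).canSend n) :
    run n e N users f adv =
      { (talk e adv (fun p => viewOf N users p (rev p)) out l).config N users rev with
        halted := true } := by
  set s := talk e adv (fun p => viewOf N users p (rev p)) out l with hs
  have h1 := iterate_talk hf l hl
  rw [← hs] at h1
  have hsh : s.shown rev ≤ N := by
    have := (hf .alice).rev_le (s.received .alice)
    have := (hf .bob).rev_le (s.received .bob)
    unfold Talk.shown; omega
  have hstep : step n e N users f adv (s.config N users rev) =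
      { s.config N users rev with halted := true } := by
    unfold step
    have h1 : (s.config N users rev).halted = false := rfl
    have h2 : f (s.config N users rev).awake
      ((s.config N users rev).view (s.config N users rev).awake) = .send (out s.awake
        (s.received s.awake)) := (hf s.awake).send (s.received s.awake) (talk_ready _ l)
    have h3 : n / 2 ≤ (s.config N users rev).numSent (s.config N users rev).awake := by
      unfold Config.numSent; unfold Talk.canSend at hl'
      exact not_lt.mp hl'
    rw [h1, h2]
    simp only [Bool.false_eq_true, if_false, if_pos h3]
  have hhalt : ∀ i (c : Config), c.halted = true → (step n e N users f adv)^[i] c = c := by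
    intro i c hc
    apply Function.iterate_fixed
    unfold step; rw [if_pos hc]
  unfold run
  -- There are `l ≤ n` transmissions, at most `N` reveals and one step that halts; the remaining `i`
  -- steps are idle.
  obtain ⟨i, hi⟩ : ∃ i, n + N + 1 = i + (1 + (l + s.shown rev)) :=
    ⟨n + N + 1 - (1 + (l + s.shown rev)), by omega⟩
  rw [hi, Function.iterate_add_apply, Function.iterate_add_apply, h1, Function.iterate_one, hstep,
    hhalt _ _ rfl]

end link
end IndelSim

namespace IndelSim

/-! ### Rounds: the communication between consecutive transmissions of `C_A`. -/

section rounds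

variable {e : ℕ} {adv : Adversary} {view : Party → List Bool → List Event}
  {out : Party → List Bool → Bool}

/-- The communication continues until Alice's intermediary is about to send, but for at most `k`
transmissions. -/
def untilAlice (e : ℕ) (adv : Adversary) (view : Party → List Bool → List Event)
    (out : Party → List Bool → Bool) : ℕ → Talk → Talk
  | 0, s => s
  | k + 1, s => if s.awake = .alice then s else untilAlice e adv view out k (s.next e adv view out)

/-- The state of the communication when Alice's intermediary is about to send its symbol number
`p`. -/
def round (e : ℕ) (adv : Adversary) (view : Party → List Bool → List Event)
    (out : Party → List Bool → Bool) : ℕ → Talk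
  | 0 => Talk.start
  | p + 1 => untilAlice e adv view out (e + 1) ((round e adv view out p).next e adv view out)

lemma untilAlice_of_alice {s : Talk} (h : s.awake = .alice) (k : ℕ) :
    untilAlice e adv view out k s = s := by
  cases k with
  | zero => rfl
  | succ k => rw [untilAlice, if_pos h]

/-- A transmission either is faithful, or it is an edit corruption. -/
lemma next_cases (s : Talk) :
    s.next e adv view out = s.deliver (s.log ++ [(s.awake, out s.awake (s.received s.awake))])
        s.awake.other (out s.awake (s.received s.awake)) 0 ∨
      s.edits < e ∧ ∃ p y, s.next e adv view out =
        s.deliver (s.log ++ [(s.awake, out s.awake (s.received s.awake))]) p y 1 := by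
  unfold Talk.next
  dsimp only
  split
  · exact Or.inl rfl
  · split_ifs with h
    · exact Or.inr ⟨h, _, _, rfl⟩
    · exact Or.inl rfl

/-- Only an edit can prevent a transmission of `C_B` from waking up `C_A`. So the fuel never needs
to exceed the number of edits that are left, plus one. -/
lemma untilAlice_fuel (k : ℕ) : ∀ {s : Talk}, e - s.edits < k →
    untilAlice e adv view out k s = untilAlice e adv view out (e - s.edits + 1) s := by
  induction k with
  | zero => intro s h; omega
  | succ k ih =>
    intro s h
    by_cases ha : s.awake = .alice
    · rw [untilAlice_of_alice ha, untilAlice_of_alice ha]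
    · rw [untilAlice, if_neg ha, untilAlice, if_neg ha]
      have hb : s.awake = .bob := by cases hs : s.awake <;> simp_all
      rcases next_cases (e := e) (adv := adv) (view := view) (out := out) s with h1 | ⟨he, p, y, h1⟩
      · have : (s.next e adv view out).awake = .alice := by rw [h1, hb]; rfl
        rw [untilAlice_of_alice this, untilAlice_of_alice this]
      · have : (s.next e adv view out).edits = s.edits + 1 := by rw [h1]; rfl
        rw [ih (by omega), this]
        congr 1
        omega

/-- What happens from a transmission of Bob's intermediary until Alice's intermediary sends again. -/
structure BobPhase (out : Party → List Bool → Bool) (e : ℕ) (s s' : Talk) : Prop where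
  awake : s'.awake = .alice
  alice : ∃ y, s'.received .alice = s.received .alice ++ [y] ∧
    (s'.edits = s.edits → y = out .bob (s.received .bob))
  bob : s.received .bob <+: s'.received .bob
  length : (s'.received .bob).length + s.edits ≤ (s.received .bob).length + s'.edits
  edits_le : s.edits ≤ s'.edits
  le : s'.edits ≤ e

/-- `C_B` sends repeatedly only if it gets spurious replies. Each of them costs an edit and adds one
symbol at Bob's end, which is the balance kept by `length`. -/
lemma untilAlice_spec (k : ℕ) : ∀ {s : Talk}, e - s.edits < k → s.edits ≤ e → s.awake = .bob →
    BobPhase out e s (untilAlice e adv view out k s) := by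
  induction k with
  | zero => intro s h; omega
  | succ k ih =>
    intro s h hle hb
    rw [untilAlice, if_neg (by rw [hb]; decide)]
    rcases next_cases (e := e) (adv := adv) (view := view) (out := out) s with h1 | ⟨he, p, y, h1⟩
    · have ha : (s.next e adv view out).awake = .alice := by rw [h1, hb]; rfl
      rw [untilAlice_of_alice ha, h1, hb]
      exact ⟨rfl, ⟨_, by simp [Talk.deliver, Party.other], fun _ => rfl⟩,
        by simp [Talk.deliver, Party.other], by simp [Talk.deliver, Party.other],
        by simp [Talk.deliver], by simpa [Talk.deliver]⟩
    · cases p with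
      | alice =>
        have ha : (s.next e adv view out).awake = .alice := by rw [h1]; rfl
        rw [untilAlice_of_alice ha, h1]
        exact ⟨rfl, ⟨y, by simp [Talk.deliver], fun h => by simp [Talk.deliver] at h⟩,
          by simp [Talk.deliver], by simp [Talk.deliver], by simp [Talk.deliver],
          by simp [Talk.deliver]; omega⟩
      | bob =>
        have hed : (s.next e adv view out).edits = s.edits + 1 := by rw [h1]; rfl
        have h2 := ih (s := s.next e adv view out) (by omega) (by omega) (by rw [h1]; rfl)
        have hbob : (s.next e adv view out).received .bob = s.received .bob ++ [y] := by
          rw [h1]; simp [Talk.deliver]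
        have halice : (s.next e adv view out).received .alice = s.received .alice := by
          rw [h1]; simp [Talk.deliver]
        obtain ⟨g1, ⟨z, g2, -⟩, g3, g4, g5, g6⟩ := h2
        rw [hbob] at g3
        rw [hbob, hed] at g4
        rw [hed] at g5
        rw [halice] at g2
        refine ⟨g1, ⟨z, g2, fun h => by omega⟩, (List.prefix_append _ _).trans g3, ?_, by omega, g6⟩
        simp only [List.length_append, List.length_singleton] at g4
        omega

/-- One round. -/
structure RoundStep (out : Party → List Bool → Bool) (e : ℕ) (s s' : Talk) : Prop where
  awake : s'.awake = .alice
  alice : ∃ y, s'.received .alice = s.received .alice ++ [y] ∧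
    (s'.edits = s.edits → y = out .bob (s'.received .bob))
  bob : s.received .bob <+: s'.received .bob
  bob_clean : s'.edits = s.edits →
    s'.received .bob = s.received .bob ++ [out .alice (s.received .alice)]
  length : (s'.received .bob).length + s.edits ≤ (s.received .bob).length + 1 + s'.edits
  edits_le : s.edits ≤ s'.edits
  le : s'.edits ≤ e

/-- The source of the asymmetry of the scheme: a round brings exactly one symbol to `C_A` even under
attack, while surplus symbols at Bob's end have to be paid for by edits. -/
lemma round_spec (p : ℕ) :
    (round e adv view out p).awake = .alice ∧
      ((round e adv view out p).received .alice).length = p ∧ (round e adv view out p).edits ≤ e ∧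
      RoundStep out e (round e adv view out p) (round e adv view out (p + 1)) := by
  have step : ∀ s : Talk, s.awake = .alice → s.edits ≤ e →
      RoundStep out e s (untilAlice e adv view out (e + 1) (s.next e adv view out)) := by
    intro s ha hle
    rcases next_cases (e := e) (adv := adv) (view := view) (out := out) s with h1 | ⟨he, p, y, h1⟩
    · have hb : (s.next e adv view out).awake = .bob := by rw [h1, ha]; rfl
      have hed : (s.next e adv view out).edits = s.edits := by rw [h1]; rfl
      have hbob : (s.next e adv view out).received .bob =
          s.received .bob ++ [out .alice (s.received .alice)] := by
        rw [h1, ha]; simp [Talk.deliver, Party.other]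
      have halice : (s.next e adv view out).received .alice = s.received .alice := by
        rw [h1, ha]; simp [Talk.deliver, Party.other]
      obtain ⟨g1, ⟨z, g2, g2'⟩, g3, g4, g5, g6⟩ :=
        untilAlice_spec (e := e) (adv := adv) (view := view) (out := out) (e + 1)
          (s := s.next e adv view out) (by omega) (by omega) hb
      rw [halice] at g2
      rw [hed] at g2' g5
      -- Without a further edit the bound on the length leaves no room for a further symbol at Bob's
      -- end.
      have key : (untilAlice e adv view out (e + 1) (s.next e adv view out)).edits = s.edits →
          (untilAlice e adv view out (e + 1) (s.next e adv view out)).received .bob =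
            (s.next e adv view out).received .bob := by
        intro h
        exact (g3.eq_of_length_le (by omega)).symm
      refine ⟨g1, ⟨z, g2, fun h => ?_⟩, ?_, fun h => ?_, ?_, g5, g6⟩
      · rw [key h]; exact g2' h
      · rw [hbob] at g3; exact (List.prefix_append _ _).trans g3
      · rw [key h, hbob]
      · rw [hbob, hed] at g4; simp at g4; omega
    · cases p with
      | alice =>
        have ha' : (s.next e adv view out).awake = .alice := by rw [h1]; rfl
        rw [untilAlice_of_alice ha', h1]
        exact ⟨rfl, ⟨y, by simp [Talk.deliver], fun h => by simp [Talk.deliver] at h⟩,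
          by simp [Talk.deliver], fun h => by simp [Talk.deliver] at h,
          by simp [Talk.deliver]; omega, by simp [Talk.deliver], by simp [Talk.deliver]; omega⟩
      | bob =>
        have hb : (s.next e adv view out).awake = .bob := by rw [h1]; rfl
        have hed : (s.next e adv view out).edits = s.edits + 1 := by rw [h1]; rfl
        have hbob : (s.next e adv view out).received .bob = s.received .bob ++ [y] := by
          rw [h1]; simp [Talk.deliver]
        have halice : (s.next e adv view out).received .alice = s.received .alice := by
          rw [h1]; simp [Talk.deliver]
        obtain ⟨g1, ⟨z, g2, g2'⟩, g3, g4, g5, g6⟩ :=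
          untilAlice_spec (e := e) (adv := adv) (view := view) (out := out) (e + 1)
            (s := s.next e adv view out) (by omega) (by omega) hb
        rw [halice] at g2
        rw [hed] at g5
        rw [hbob, hed] at g4
        rw [hbob] at g3
        simp only [List.length_append, List.length_singleton] at g4
        exact ⟨g1, ⟨z, g2, fun h => by omega⟩, (List.prefix_append _ _).trans g3,
          fun h => by omega, by omega, by omega, g6⟩
  have base : ∀ p, (round e adv view out p).awake = .alice ∧
      ((round e adv view out p).received .alice).length = p ∧
      (round e adv view out p).edits ≤ e := by
    intro p
    induction p with
    | zero => exact ⟨rfl, rfl, Nat.zero_le _⟩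
    | succ p ih =>
      have h := step _ ih.1 ih.2.2
      obtain ⟨y, hy, -⟩ := h.alice
      refine ⟨h.awake, ?_, h.le⟩
      change ((untilAlice e adv view out (e + 1) _).received .alice).length = _
      rw [hy]; simp [ih.2.1]
  exact ⟨(base p).1, (base p).2.1, (base p).2.2, step _ (base p).1 (base p).2.2⟩

/-- Every state of the communication lies in a round. -/
lemma talk_round (l : ℕ) : let s := talk e adv view out l
    s.edits ≤ e ∧ s.received .alice =
      (round e adv view out (s.received .alice).length).received .alice ∧
    (round e adv view out (s.received .alice).length).received .bob <+: s.received .bob ∧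
    (s.awake = .alice → s = round e adv view out (s.received .alice).length) ∧
    (s.awake = .bob → untilAlice e adv view out (e - s.edits + 1) s =
      round e adv view out ((s.received .alice).length + 1)) := by
  induction l with
  | zero =>
    refine ⟨Nat.zero_le _, rfl, List.prefix_rfl, fun _ => rfl, fun h => ?_⟩
    cases h
  | succ l ih =>
    intro s
    set t := talk e adv view out l with ht
    have hs : s = t.next e adv view out := talk_succ _ _
    obtain ⟨h1, h2, h3, h4, h5⟩ := ih
    -- the round in which the next state is reached, if that state is at Alice's end
    have hnext : untilAlice e adv view out (e - s.edits + 1) s =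
        round e adv view out ((t.received .alice).length + 1) := by
      have hfe : e - s.edits < e + 1 := by omega
      cases hw : t.awake with
      | alice =>
        rw [round, ← h4 hw, ← hs, ← untilAlice_fuel _ hfe]
      | bob =>
        have hu : untilAlice e adv view out (e - t.edits + 1) t =
            untilAlice e adv view out (e - t.edits) s := by
          rw [untilAlice, if_neg (by rw [hw]; decide), ← hs]
        rw [← h5 hw, hu]
        rcases next_cases (e := e) (adv := adv) (view := view) (out := out) t with
          g1 | ⟨he, p, y, g1⟩
        · have : s.awake = .alice := by rw [hs, g1, hw]; rfl
          rw [untilAlice_of_alice this, untilAlice_of_alice this]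
        · have : s.edits = t.edits + 1 := by rw [hs, g1]; rfl
          rw [← untilAlice_fuel (e - t.edits)]
          omega
    have hse : s.edits ≤ e := by
      rcases next_cases (e := e) (adv := adv) (view := view) (out := out) t with
          g1 | ⟨he, p, y, g1⟩
      · rw [hs, g1]; exact h1
      · rw [hs, g1]; exact he
    have hca : ∀ y, s.received .alice = t.received .alice ++ [y] → s.awake = .alice →
        s = round e adv view out (s.received .alice).length := by
      intro y hy ha
      rw [untilAlice_of_alice ha] at hnext
      rw [hy, List.length_append, List.length_singleton]
      exact hnext
    have hcb : ∀ y, s.received .alice = t.received .alice → s.received .bob =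
        t.received .bob ++ [y] → s.awake = .bob → s.received .alice =
          (round e adv view out (s.received .alice).length).received .alice ∧
        (round e adv view out (s.received .alice).length).received .bob <+: s.received .bob ∧
        (s.awake = .alice → s = round e adv view out (s.received .alice).length) ∧
        (s.awake = .bob → untilAlice e adv view out (e - s.edits + 1) s =
          round e adv view out ((s.received .alice).length + 1)) := by
      intro y ha hb hw
      rw [ha]
      refine ⟨h2, ?_, fun h => ?_, fun _ => hnext⟩
      · rw [hb]; exact h3.trans (List.prefix_append _ _)
      · rw [hw] at h; cases h
    have fin : ∀ y, s.received .alice = t.received .alice ++ [y] → s.awake = .alice →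
        s.received .alice =
          (round e adv view out (s.received .alice).length).received .alice ∧
        (round e adv view out (s.received .alice).length).received .bob <+: s.received .bob ∧
        (s.awake = .alice → s = round e adv view out (s.received .alice).length) ∧
        (s.awake = .bob → untilAlice e adv view out (e - s.edits + 1) s =
          round e adv view out ((s.received .alice).length + 1)) := by
      intro y hy hw
      have := hca y hy hw
      refine ⟨congrArg (fun s => s.received .alice) this,
        (congrArg (fun s => s.received .bob) this) ▸ List.prefix_rfl, fun _ => this, fun h => ?_⟩
      rw [hw] at h; cases h
    refine ⟨hse, ?_⟩
    rcases next_cases (e := e) (adv := adv) (view := view) (out := out) t with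
      g1 | ⟨he, p, y, g1⟩
    · cases hw : t.awake with
      | alice =>
        rw [hw] at g1
        exact hcb (out .alice (t.received .alice)) (by rw [hs, g1]; simp [Talk.deliver,
          Party.other])
          (by rw [hs, g1]; simp [Talk.deliver, Party.other]) (by rw [hs, g1]; rfl)
      | bob =>
        rw [hw] at g1
        exact fin (out .bob (t.received .bob)) (by rw [hs, g1]; simp [Talk.deliver, Party.other])
          (by rw [hs, g1]; rfl)
    · cases p with
      | alice => exact fin y (by rw [hs, g1]; simp [Talk.deliver]) (by rw [hs, g1]; rfl)
      | bob => exact hcb y (by rw [hs, g1]; simp [Talk.deliver])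
                (by rw [hs, g1]; simp [Talk.deliver]) (by rw [hs, g1]; rfl)

/-- The numbers of symbols that the two intermediaries have sent and received. -/
lemma talk_count (l : ℕ) : let s := talk e adv view out l
    let w := if s.awake = .bob then 1 else 0
    (s.log.filter (fun m => decide (m.1 = Party.alice))).length = (s.received .alice).length + w ∧
    (s.log.filter (fun m => decide (m.1 = Party.bob))).length + w = (s.received .bob).length ∧
    s.log.length = l ∧
    (s.received .alice).length + w ≤ (s.received .bob).length + s.edits ∧
    (s.received .bob).length ≤ (s.received .alice).length + w + s.edits := by
  induction l with
  | zero => simp [talk, Talk.start]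
  | succ l ih =>
    rw [talk_succ]
    set t := talk e adv view out l with ht
    obtain ⟨h1, h2, h3, h4, h5⟩ := ih
    rcases next_cases (e := e) (adv := adv) (view := view) (out := out) t with
      g1 | ⟨he, p, y, g1⟩
    · rw [g1]
      cases hw : t.awake <;> simp [hw] at h1 h2 h4 h5 <;>
        simp [Talk.deliver, Party.other, h3] <;> omega
    · rw [g1]
      cases hw : t.awake <;> simp [hw] at h1 h2 h4 h5 <;> cases p <;>
        simp [Talk.deliver, h3] <;> omega

lemma round_received_prefix (p : Party) {a b : ℕ} (hab : a ≤ b) :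
    (round e adv view out a).received p <+: (round e adv view out b).received p := by
  induction b, hab using Nat.le_induction with
  | base => exact List.prefix_rfl
  | succ b _ ih =>
    have h := (round_spec (e := e) (adv := adv) (view := view) (out := out) b).2.2.2
    refine ih.trans ?_
    cases p with
    | alice => obtain ⟨y, hy, -⟩ := h.alice; rw [hy]; exact List.prefix_append _ _
    | bob => exact h.bob

/-- The rounds before the round number `p` depend only on the first `p` symbols sent by Alice's
intermediary. -/
lemma round_congr {out' : Party → List Bool → Bool} (hb : out .bob = out' .bob) (p : ℕ)
    (h : ∀ w : List Bool, w.length < p → out .alice w = out' .alice w) :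
    round e adv view out p = round e adv view out' p := by
  induction p with
  | zero => rfl
  | succ p ih =>
    have ih' := ih (fun w hw => h w (by omega))
    have hbob : ∀ s : Talk, s.awake = .bob → s.next e adv view out = s.next e adv view out' := by
      intro s hs; unfold Talk.next; rw [hs, hb]
    have hun : ∀ k (s : Talk), untilAlice e adv view out k s = untilAlice e adv view out' k s := by
      intro k
      induction k with
      | zero => intro s; rfl
      | succ k ihk =>
        intro s
        rw [untilAlice, untilAlice]
        split_ifs with hs
        · rfl
        · rw [hbob s (by cases hs' : s.awake <;> simp_all), ihk]
    rw [round, round, hun, ← ih']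
    congr 1
    obtain ⟨h1, h2, -⟩ := round_spec (e := e) (adv := adv) (view := view) (out := out) p
    unfold Talk.next
    rw [h1, h _ (by omega)]

end rounds

/-- The result of a simulation with reactive intermediaries. -/
lemma run_spec {n e N : ℕ} {users : Users} {f : Party → List Event → Action} {adv : Adversary}
    {rev : Party → List Bool → List Bool} {out : Party → List Bool → Bool}
    (hf : ∀ p, Reacts N users p (f p) (rev p) (out p)) (hn : Even n)
    (hrev : ∀ p (w : List Bool), n / 2 ≤ w.length + e → (rev p w).length = N / 2) :
    (run n e N users f adv).Completes N ∧ ∃ w : Party → List Bool,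
      (∀ p, (run n e N users f adv).revealed p = rev p (w p)) ∧
      (∀ p, (run n e N users f adv).given p = givenOf N users p (rev p (w p))) ∧
      ∀ q p, q + e ≤ n / 2 →
        (round e adv (fun p => viewOf N users p (rev p)) out q).received p <+: w p := by
  set view := fun p => viewOf N users p (rev p) with hview
  have hsent : ∀ l, (∀ l' < l, (talk e adv view out l').canSend n) → ∀ p,
      ((talk e adv view out l).log.filter (fun m => decide (m.1 = p))).length ≤ n / 2 := by
    intro l
    induction l with
    | zero => intro _ p; simp [talk, Talk.start]
    | succ l ih =>
      intro h p
      have h1 := ih (fun l' hl' => h l' (by omega)) p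
      have h2 := h l (Nat.lt_succ_self l)
      unfold Talk.canSend at h2
      have hlog : (talk e adv view out (l + 1)).log = (talk e adv view out l).log ++
          [((talk e adv view out l).awake, out (talk e adv view out l).awake
            ((talk e adv view out l).received (talk e adv view out l).awake))] := by
        rw [talk_succ]
        rcases next_cases (e := e) (adv := adv) (view := view) (out := out)
          (talk e adv view out l) with g1 | ⟨he, p, y, g1⟩ <;> rw [g1] <;> rfl
      rw [hlog, List.filter_append, List.length_append]
      by_cases hp : (talk e adv view out l).awake = p
      · rw [hp] at h2; simp [hp]; omega
      · simp [hp]; exact h1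
  have hex : ∃ l, l ≤ n ∧ (∀ l' < l, (talk e adv view out l').canSend n) ∧
      ¬ (talk e adv view out l).canSend n := by
    by_contra hcon
    push Not at hcon
    have hall : ∀ l, l ≤ n → ∀ l' < l, (talk e adv view out l').canSend n := by
      intro l
      induction l with
      | zero => intro _ l' h; omega
      | succ l ih =>
        intro hl l' hl'
        rcases Nat.lt_succ_iff_lt_or_eq.mp hl' with h | h
        · exact ih (by omega) l' h
        · subst h; exact hcon _ (by omega) (ih (by omega))
    have hc := hcon n le_rfl (hall n le_rfl)
    have ha := hsent n (hall n le_rfl) .alice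
    have hb := hsent n (hall n le_rfl) .bob
    obtain ⟨c1, c2, c3, -⟩ := talk_count (e := e) (adv := adv) (view := view) (out := out) n
    have hsum : ∀ L : List (Party × Bool),
        (L.filter (fun m => decide (m.1 = Party.alice))).length +
        (L.filter (fun m => decide (m.1 = Party.bob))).length = L.length := by
      intro L
      induction L with
      | nil => rfl
      | cons m L ih =>
        obtain ⟨p, x⟩ := m
        cases p <;> simp at ih ⊢ <;> omega
    have hs := hsum (talk e adv view out n).log
    rw [c3] at hs
    -- After `n` transmissions, of which at most `n / 2` come from either end, both budgets are used
    -- up because `n` is even.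
    obtain ⟨k, hk⟩ := hn
    unfold Talk.canSend at hc
    cases hw : (talk e adv view out n).awake <;> rw [hw] at hc <;> omega
  obtain ⟨l, hln, hl, hl'⟩ := hex
  have hrun := run_eq (adv := adv) hf l hln hl hl'
  rw [← hview] at hrun
  set s := talk e adv view out l with hs
  obtain ⟨c1, c2, c3, c4, c5⟩ := talk_count (e := e) (adv := adv) (view := view) (out := out) l
  obtain ⟨r1, r2, r3, -⟩ := talk_round (e := e) (adv := adv) (view := view) (out := out) l
  rw [← hs] at c1 c2 c3 c4 c5 r1 r2 r3
  -- At the end one of the intermediaries has sent `n / 2` symbols, and by `talk_count` the numbers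
  -- of symbols received at the two ends can fall short of this only by the number of edits.
  have hge : ∀ p, n / 2 ≤ (s.received p).length + e := by
    unfold Talk.canSend at hl'
    intro p
    cases hw : s.awake <;> cases p <;> simp [hw] at hl' c1 c2 c4 c5 <;> omega
  refine ⟨⟨by rw [hrun], fun p => by rw [hrun]; exact hrev p _ (hge p)⟩, s.received,
    fun p => by rw [hrun]; rfl, fun p => by rw [hrun]; rfl, fun q p hq => ?_⟩
  have hle : q ≤ (s.received .alice).length := by have := hge .alice; omega
  refine (round_received_prefix p hle).trans ?_
  cases p with
  | alice => rw [← r2]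
  | bob => exact r3

end IndelSim

namespace IndelSim

/-! ### Reading a view -/

/-- The symbols received over the channel. -/
def channelBits (ev : List Event) : List Bool :=
  ev.flatMap fun | .channel x => [x] | _ => []

/-- The symbols received from the user. -/
def userBits (ev : List Event) : List Bool :=
  ev.flatMap fun | .user x => [x] | _ => []

lemma channelBits_answers (N : ℕ) (users : Users) (p : Party) (v : List Bool) (a b : ℕ) :
    channelBits (answers N users p v a b) = [] := by
  unfold channelBits answers
  rw [List.flatMap_eq_nil_iff]
  intro x hx
  obtain ⟨i, -, rfl⟩ := List.mem_map.mp hx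
  unfold answer
  split_ifs <;> rfl

lemma channelBits_append (a b : List Event) :
    channelBits (a ++ b) = channelBits a ++ channelBits b := by simp [channelBits]

lemma userBits_append (a b : List Event) :
    userBits (a ++ b) = userBits a ++ userBits b := by simp [userBits]

lemma channelBits_channel (b : Bool) (l : List Event) :
    channelBits (.channel b :: l) = b :: channelBits l := by simp [channelBits]

lemma userBits_channel (b : Bool) (l : List Event) :
    userBits (.channel b :: l) = userBits l := by simp [userBits]

lemma channelBits_viewOf (N : ℕ) (users : Users) (p : Party) (rev : List Bool → List Bool)
    (w : List Bool) : channelBits (viewOf N users p rev w) = w := by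
  induction w using List.reverseRecOn with
  | nil => cases p <;> rfl
  | append_singleton w b ih =>
    rw [viewOf_append, channelBits_append, channelBits_channel, channelBits_answers, ih]

lemma userBits_answers (N : ℕ) (users : Users) (p : Party) (v : List Bool) {a b : ℕ} (hab : a ≤ b)
    (hb : b ≤ v.length) : givenOf N users p (v.take a) ++ userBits (answers N users p v a b) =
      givenOf N users p (v.take b) := by
  induction b, hab using Nat.le_induction with
  | base => simp [answers, userBits]
  | succ b hab ih =>
    have h3 : b + 1 - a = (b - a) + 1 := by omega
    have h4 : answers N users p v a (b + 1) =
        answers N users p v a b ++ [answer N users p (v.take (b + 1))] := by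
      unfold answers
      rw [h3, List.range'_1_concat, List.map_append, List.map_singleton, Nat.add_sub_cancel' hab]
    rw [h4, userBits_append, ← List.append_assoc, ih (by omega), givenOf_take_succ v p (by omega)]
    congr 1
    have h5 : (v.take (b + 1)).length = b + 1 := by simp; omega
    unfold answer
    rw [h5]
    split_ifs <;> simp [userBits]

lemma userBits_viewOf {N : ℕ} {users : Users} {p : Party} {rev : List Bool → List Bool}
    (h0 : rev [] = []) (hpre : ∀ w b, rev w <+: rev (w ++ [b])) (w : List Bool) :
    userBits (viewOf N users p rev w) = givenOf N users p (rev w) := by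
  induction w using List.reverseRecOn with
  | nil => rw [h0]; cases p <;> simp [viewOf_nil, initEvents, userBits, givenOf]
  | append_singleton w b ih =>
    obtain ⟨t, ht⟩ := hpre w b
    have hle := (hpre w b).length_le
    rw [viewOf_append, userBits_append, userBits_channel, ih]
    have := userBits_answers N users p (rev (w ++ [b])) hle le_rfl
    rw [List.take_length] at this
    rw [← this]
    congr 2
    rw [← ht]; simp

lemma givenOf_bob_length (N : ℕ) (users : Users) (v : List Bool) :
    (givenOf N users .bob v).length = v.length := by
  simp [givenOf, List.length_flatMap]

lemma givenOf_bob_getElem? (N : ℕ) (users : Users) (v : List Bool) {i : ℕ} (hi : i < v.length) :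
    (givenOf N users .bob v)[i]? = some (users .bob (v.take (i + 1))) := by
  have : givenOf N users .bob v = (List.range v.length).map fun i => users .bob (v.take
    (i + 1)) := by
    simp [givenOf, List.map_eq_flatMap]
  rw [this]; simp [hi]

/-- Alice speaks first, so her symbol number `i` is a function of `i` revealed symbols, against `i +
1` for Bob. The bound `i < N / 2` stays clear of the point where she falls silent. -/
lemma givenOf_alice_getElem? (N : ℕ) (users : Users) (v : List Bool) {i : ℕ} (hi : i ≤ v.length)
    (hN : i < N / 2) :
    (givenOf N users .alice v)[i]? = some (users .alice (v.take i)) := by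
  have key : ∀ j, j ≤ v.length → i ≤ j →
      (givenOf N users .alice (v.take j)).take (i + 1) =
        (List.range (i + 1)).map fun i => users .alice (v.take i) := by
    intro j
    induction j generalizing i with
    | zero =>
      intro _ hij
      obtain rfl : i = 0 := by omega
      simp [givenOf]
    | succ j ih =>
      intro hj hij
      rw [givenOf_take_succ v .alice (by omega)]
      rcases Nat.lt_or_ge j i with h | h
      · obtain rfl : i = j + 1 := by omega
        have h2 := ih (i := j) (by omega) (by omega) (by omega) le_rfl
        have h3 : (givenOf N users .alice (v.take j)).length ≤ j + 1 := by
          unfold givenOf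
          rw [List.length_append, List.length_flatMap]
          have : ((List.range (v.take j).length).map fun i => (if Party.alice = Party.alice ∧
              N / 2 ≤ i + 1 then ([] : List Bool)
              else [users .alice ((v.take j).take (i + 1))]).length).sum ≤
              ((List.range (v.take j).length).map fun i => 1).sum := by
            apply List.sum_le_sum
            intro i _
            split_ifs <;> simp
          have h4 : (v.take j).length = j := by simp; omega
          rw [h4] at this ⊢
          simp only [List.map_const', List.sum_replicate, List.length_range, smul_eq_mul,
            mul_one] at this
          simp only [List.length_singleton]
          omega
        rw [List.take_of_length_le h3] at h2
        rw [h2, if_neg (by omega), List.range_succ (n := j + 1), List.map_append,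
          List.take_of_length_le
          (by simp)]
        rfl
      · have h2 := ih (i := i) hi hN (by omega) h
        have h3 : i + 1 ≤ (givenOf N users .alice (v.take j)).length := by
          have := congrArg List.length h2
          simp at this
          omega
        rw [List.take_append_of_le_length h3, h2]
  have h := key v.length le_rfl hi
  rw [List.take_length] at h
  have h2 := congrArg (fun l : List Bool => l[i]?) h
  simpa [List.getElem?_take] using h2

/-! ### The scheme -/

/-- The parameters: rounds, edits, simulated rounds, block length, marker length, number of bits of
a symbol of the synchronization string, and this string. -/
structure Par where
  n : ℕ
  e : ℕ
  N : ℕ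
  R : ℕ
  h : ℕ
  q : ℕ
  S : ℕ → ℕ

namespace Par

variable (P : Par)

/-- The number of symbols given by each user. -/
def D : ℕ := P.N / 2
/-- Marker, mask and symbol of the synchronization string. -/
def H : ℕ := P.h + P.h + P.q
/-- The number of data symbols in a block. -/
def dl : ℕ := P.R - P.H
/-- The number of the data symbol at position `p`, if there is one. -/
def idx (p : ℕ) : ℕ := p / P.R * P.dl + (p % P.R - P.H)
/-- A data symbol is sent at position `p`. -/
abbrev IsData (p : ℕ) : Prop := P.H ≤ p % P.R ∧ P.idx p < P.D

/-- The symbol that is sent at position `p` under the mask. -/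
def plain (X : ℕ → Bool) (p : ℕ) : Bool :=
  if p % P.R < P.H then decide (p % P.R - (P.h + P.h) < P.S (p / P.R))
  else if P.idx p < P.D then X (P.idx p) else false

/-- The symbol sent at position `p`. A block consists of the marker `1 0 … 0`, random bits, and
masked symbols: the mask is the symbol sent `h` positions earlier. -/
def bit (ω : ℕ → Bool) (X : ℕ → Bool) (p : ℕ) : Bool :=
  if p % P.R < P.h then decide (p % P.R = 0)
  -- The alternative `P.h = 0` only serves the termination of the recursion; `Valid` excludes it.
  else if p % P.R < P.h + P.h ∨ P.h = 0 then ω p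
  else xor (P.plain X p) (bit ω X (p - P.h))
termination_by p
decreasing_by
  have := Nat.mod_le p P.R
  omega

/-- What Alice's intermediary reveals after it has received `w`. -/
def revA (w : List Bool) : List Bool :=
  ((List.range w.length).filter fun p => P.IsData p).map fun p => w.getD p false

/-- What Alice's intermediary sends after it has received `w`. -/
def outA (ω : ℕ → Bool) (users : Users) (w : List Bool) : Bool :=
  P.bit ω (fun i => users .alice ((P.revA w).take i)) w.length

/-- Alice's intermediary. -/
def actA (ω : ℕ → Bool) (ev : List Event) : Action :=
  let c := (channelBits ev).length
  let b := P.bit ω (fun i => (userBits ev).getD i false) c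
  match ev.getLast? with
  | some (.channel y) => if P.IsData (c - 1) then .reveal y else .send b
  | _ => .send b

/-- What Bob's intermediary knows from scanning the received bits: the number of zeros after the
last one (counting the one), the end of the last marker, the earliest end of a marker that it is
going to accept, the number and the symbols of the accepted markers. -/
structure Scan where
  zc : ℕ
  tau : ℕ
  na : ℕ
  cnt : ℕ
  y : ℕ → ℕ

/-- The symbol of the synchronization string in a block with a marker that ends at `a`. -/
def sym (β : ℕ → Bool) (a : ℕ) : ℕ :=
  ∑ c ∈ Finset.range P.q, (xor (β (a + P.h + c)) (β (a + c))).toNat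

/-- Every marker moves `tau`, but only a marker that ends at least `R` after the last accepted one
is counted. The symbol recorded with it is read from bits after time `t`; if they have not been
received yet, default values enter and are corrected when the longer word is scanned again. -/
def scanStep (β : ℕ → Bool) (t : ℕ) (s : Scan) : Scan :=
  let z := if β t then 1 else if s.zc = 0 then 0 else s.zc + 1
  if z = P.h then
    if s.na ≤ t + 1 then
      ⟨z, t + 1, t + 1 + P.R, s.cnt + 1, Function.update s.y s.cnt (P.sym β (t + 1))⟩
    else { s with zc := z, tau := t + 1 }
  else { s with zc := z }

def scan (β : ℕ → Bool) : ℕ → Scan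
  | 0 => ⟨0, 0, 0, 0, fun _ => 0⟩
  | t + 1 => P.scanStep β t (scan β t)

/-- The number of insertions and deletions between `S[0..k)` and `y[0..w)`. -/
def cost (S y : ℕ → ℕ) : ℕ → ℕ → ℕ
  | 0, k => k
  | w + 1, 0 => w + 1
  | w + 1, k + 1 =>
    if S k = y w then min (min (cost S y w (k + 1) + 1) (cost S y (w + 1) k + 1)) (cost S y w k)
    else min (cost S y w (k + 1) + 1) (cost S y (w + 1) k + 1)

/-- The least minimizer of `f` on `{0, …, k}`. -/
def argmin (f : ℕ → ℕ) : ℕ → ℕ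
  | 0 => 0
  | k + 1 => if f (k + 1) < f (argmin f k) then k + 1 else argmin f k

/-- The number of blocks that Alice's intermediary has begun, as guessed by Bob's. -/
def guess (s : Scan) : ℕ := argmin (cost P.S s.y s.cnt) P.n

/-- The data symbol which Bob's intermediary finds at the end of the received bits `w`. -/
def dec (w : List Bool) : Option (ℕ × Bool) :=
  let s := P.scan (fun i => w.getD i false) w.length
  let u := w.length - s.tau
  let i := (P.guess s - 1) * P.dl + (u - (P.h + P.q + 1))
  -- The equation says that the last marker found is also the last one accepted. The two bounds on
  -- `u` say that the last received bit lies behind the header and still within the block of this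
  -- marker.
  if s.na = s.tau + P.R ∧ 0 < P.guess s ∧ P.h + P.q + 1 ≤ u ∧ u + P.h ≤ P.R ∧ i < P.D then
    some (i, xor (w.getD (w.length - 1) false) (w.getD (w.length - 1 - P.h) false))
  else none

/-- The number of symbols that have to be revealed to Bob after `w` has been received. -/
def goal (w : List Bool) : ℕ :=
  -- Bob's end receives at least `n / 2 - e` symbols in every execution. So this case is always
  -- reached, and it makes the number of revealed symbols right.
  if P.n / 2 ≤ w.length + P.e then P.D
  else match P.dec w with
    | some (i, _) => i + 1
    | none => 0

/-- The recursion runs over the reversed word because reactions are appended. Comparison with `some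
(_, true)` gives the decoded symbol its value and all skipped symbols the value `false`. -/
def revBR : List Bool → List Bool
  | [] => []
  | b :: l => revBR l ++ (List.range (P.goal (b :: l).reverse - (revBR l).length)).map fun j =>
      decide (P.dec (b :: l).reverse = some ((revBR l).length + j, true))

/-- What Bob's intermediary reveals after it has received `w`. -/
def revB (w : List Bool) : List Bool := P.revBR w.reverse

/-- What Bob's intermediary sends after it has received `w`. -/
def outB (users : Users) (w : List Bool) : Bool :=
  match P.dec w with
  | some (i, _) =>
    -- The reaction to the last received bit has revealed the decoded symbol as its last one, so the
    -- user's latest symbol answers this symbol.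
    if (P.revB w.dropLast).length ≤ i ∧ (P.revB w).length = i + 1 then users .bob (P.revB w)
    else false
  | none => false

/-- Bob's intermediary. -/
def actB (ev : List Event) : Action :=
  let w := channelBits ev
  let j := (userBits ev).length
  if j < P.goal w then .reveal (decide (P.dec w = some (j, true)))
  else .send (match ev.getLast? with
    | some (.user y) =>
      match P.dec w with
      | some (i, _) => if j = i + 1 then y else false
      | none => false
    | _ => false)

lemma revB_append (w : List Bool) (b : Bool) :
    P.revB (w ++ [b]) = P.revB w ++
      (List.range (P.goal (w ++ [b]) - (P.revB w).length)).map fun j =>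
        decide (P.dec (w ++ [b]) = some ((P.revB w).length + j, true)) := by
  simp [revB, revBR]
  intros; congr

lemma goal_le (w : List Bool) : P.goal w ≤ P.D := by
  unfold goal
  split_ifs with h
  · exact le_rfl
  · unfold dec
    dsimp only
    split_ifs with h'
    · exact h'.2.2.2.2
    · exact Nat.zero_le _

lemma revB_length_append (w : List Bool) (b : Bool) :
    (P.revB (w ++ [b])).length = max (P.revB w).length (P.goal (w ++ [b])) := by
  rw [revB_append]; simp; omega

lemma revB_length_le (w : List Bool) : (P.revB w).length ≤ P.D := by
  induction w using List.reverseRecOn with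
  | nil => exact Nat.zero_le _
  | append_singleton w b ih =>
    rw [revB_length_append]; exact max_le ih (P.goal_le _)

lemma revB_getElem (w : List Bool) (b : Bool) (j : ℕ) (h1 : (P.revB w).length ≤ j)
    (h2 : j < (P.revB (w ++ [b])).length) :
    (P.revB (w ++ [b]))[j] = decide (P.dec (w ++ [b]) = some (j, true)) := by
  have h3 := P.revB_append w b
  simp only [h3]
  rw [List.getElem_append_right h1]
  simp [Nat.add_sub_cancel' h1]

lemma getLast?_answers (N : ℕ) (users : Users) (p : Party) (v : List Bool) {a b : ℕ} (hab : a < b) :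
    (answers N users p v a b).getLast? = some (answer N users p (v.take b)) := by
  have h3 : b - a = (b - 1 - a) + 1 := by omega
  unfold answers
  rw [h3, List.range'_1_concat, List.map_append, List.map_singleton, List.getLast?_concat]
  congr 3
  omega

lemma reacts_bob (users : Users) :
    Reacts P.N users .bob P.actB P.revB (P.outB users) where
  rev_nil := rfl
  rev_prefix w b := by rw [revB_append]; exact List.prefix_append _ _
  rev_le := P.revB_length_le
  reveal w b j h1 h2 := by
    have hj : (userBits (viewOf P.N users .bob P.revB w ++ Event.channel b ::
        answers P.N users .bob (P.revB (w ++ [b])) (P.revB w).length j)).length = j := by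
      have hpre : P.revB w <+: P.revB (w ++ [b]) := by
        rw [revB_append]; exact List.prefix_append _ _
      obtain ⟨t, ht⟩ := hpre
      have htake : (P.revB (w ++ [b])).take (P.revB w).length = P.revB w := by
        rw [← ht]; simp
      rw [userBits_append, userBits_channel, userBits_viewOf rfl
        (fun w b => by rw [revB_append]; exact List.prefix_append _ _)]
      have := userBits_answers P.N users .bob (P.revB (w ++ [b])) h1 h2.le
      rw [htake] at this
      rw [this, givenOf_bob_length]
      simp; omega
    unfold actB
    simp only [hj, channelBits_append, channelBits_channel, channelBits_viewOf,
      channelBits_answers]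
    rw [revB_length_append] at h2
    rw [if_pos (by omega), revB_getElem _ _ _ _ h1]
  send w hw := by
    have hw' : w ≠ [] := by rcases hw with h | h; exacts [h, by cases h]
    obtain ⟨w, b, rfl⟩ : ∃ w' b, w = w' ++ [b] :=
      ⟨_, _, (List.dropLast_append_getLast hw').symm⟩
    have hj : (userBits (viewOf P.N users .bob P.revB (w ++ [b]))).length =
        (P.revB (w ++ [b])).length := by
      rw [userBits_viewOf rfl (fun w b => by rw [revB_append]; exact List.prefix_append _ _),
        givenOf_bob_length]
    have hlen := P.revB_length_append w b
    have hlast : (viewOf P.N users .bob P.revB (w ++ [b])).getLast? =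
        if (P.revB w).length < (P.revB (w ++ [b])).length then
          some (.user (users .bob (P.revB (w ++ [b])))) else some (.channel b) := by
      rw [viewOf_append]
      split_ifs with h
      · have h4 := getLast?_answers P.N users .bob (P.revB (w ++ [b])) h
        rw [List.getLast?_append, List.getLast?_cons, h4]
        simp [answer]
      · have : answers P.N users .bob (P.revB (w ++ [b])) (P.revB w).length
            (P.revB (w ++ [b])).length = [] := by
          simp [answers]; omega
        rw [this]; simp
    unfold actB outB
    simp only [hj, channelBits_viewOf, hlast, List.dropLast_concat]
    rw [if_neg (by omega)]
    congr 1
    cases hd : P.dec (w ++ [b]) with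
    | none => split_ifs <;> rfl
    | some z =>
      obtain ⟨i, x⟩ := z
      by_cases h1 : (P.revB w).length < (P.revB (w ++ [b])).length
      · rw [if_pos h1]
        dsimp only
        by_cases h2 : (P.revB (w ++ [b])).length = i + 1
        · rw [if_pos h2, if_pos ⟨by omega, h2⟩]
        · rw [if_neg h2, if_neg (fun h => h2 h.2)]
      · rw [if_neg h1]
        dsimp only
        rw [if_neg (by omega)]

lemma revB_length_end (w : List Bool) (hw : P.n / 2 ≤ w.length + P.e) (hD : P.e < P.n / 2) :
    (P.revB w).length = P.D := by
  have hw' : w ≠ [] := by rintro rfl; simp at hw; omega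
  obtain ⟨w, b, rfl⟩ : ∃ w' b, w = w' ++ [b] :=
    ⟨_, _, (List.dropLast_append_getLast hw').symm⟩
  rw [revB_length_append]
  have h1 := P.revB_length_le w
  have h2 : P.goal (w ++ [b]) = P.D := by unfold goal; rw [if_pos hw]
  omega

/-- The first `p` positions carry `min D (idx p)` data symbols. -/
lemma count_data (hR : P.H < P.R) (p : ℕ) :
    ((List.range p).filter fun p => P.IsData p).length = min P.D (P.idx p) := by
  induction p with
  | zero => simp [idx]
  | succ p ih =>
    have hidx : P.idx (p + 1) = P.idx p + if P.H ≤ p % P.R then 1 else 0 := by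
      unfold idx dl
      have h0 : p % P.R < P.R := Nat.mod_lt _ (by omega)
      rcases Nat.lt_or_ge (p % P.R + 1) P.R with h | h
      · have h1 : (p + 1) / P.R = p / P.R := by
          rw [Nat.succ_div, if_neg]; rfl
          intro hd
          have := Nat.mod_eq_zero_of_dvd hd
          rw [Nat.add_mod, Nat.mod_eq_of_lt (a := 1) (by omega), Nat.mod_eq_of_lt h] at this
          omega
        have h2 : (p + 1) % P.R = p % P.R + 1 := by
          rw [Nat.add_mod, Nat.mod_eq_of_lt (a := 1) (by omega), Nat.mod_eq_of_lt h]
        rw [h1, h2]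
        split_ifs <;> omega
      · have h3 : p + 1 = (p / P.R + 1) * P.R := by
          have := Nat.div_add_mod p P.R
          rw [Nat.add_mul, Nat.mul_comm (p / P.R)]; omega
        have h1 : (p + 1) / P.R = p / P.R + 1 := by
          rw [h3, Nat.mul_div_cancel _ (by omega)]
        have h2 : (p + 1) % P.R = 0 := by rw [h3, Nat.mul_mod_left]
        rw [h1, h2, Nat.add_mul]
        split_ifs <;> omega
    rw [List.range_succ, List.filter_append, List.length_append, ih]
    by_cases h1 : P.H ≤ p % P.R
    · by_cases h2 : P.idx p < P.D
      · have h3 : P.IsData p := ⟨h1, h2⟩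
        simp [h3]; rw [hidx, if_pos h1]; omega
      · have h3 : ¬ P.IsData p := fun h => h2 h.2
        simp [h3]; rw [hidx, if_pos h1]; omega
    · have h3 : ¬ P.IsData p := fun h => h1 h.1
      simp [h3]; rw [hidx, if_neg h1]; omega

lemma revA_append (w : List Bool) (b : Bool) :
    P.revA (w ++ [b]) = P.revA w ++ if P.IsData w.length then [b] else [] := by
  unfold revA
  rw [List.length_append, List.length_singleton, List.range_succ, List.filter_append,
    List.map_append]
  congr 1
  · apply List.map_congr_left
    intro i hi
    have : i < w.length := List.mem_range.mp (List.mem_of_mem_filter hi)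
    simp [List.getD_eq_getElem?_getD, List.getElem?_append_left this]
  · split_ifs with h
    · simp [h]
    · simp [h]

lemma revA_length (hR : P.H < P.R) (w : List Bool) :
    (P.revA w).length = min P.D (P.idx w.length) := by
  rw [← P.count_data hR, revA, List.length_map]

/-- Causality of the encoding: a sent symbol depends on coins and data up to its own position only.
-/
lemma bit_congr {ω ω' X X' : ℕ → Bool} (p : ℕ) (hω : ∀ i ≤ p, ω i = ω' i)
    (hX : ∀ i ≤ p, P.IsData i → X (P.idx i) = X' (P.idx i)) : P.bit ω X p = P.bit ω' X' p := by
  induction p using Nat.strong_induction_on with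
  | _ p ih =>
    rw [bit, bit.eq_def P ω' X' p]
    split_ifs with h1 h2
    · rfl
    · exact hω p le_rfl
    · have hp : p % P.R ≤ p := Nat.mod_le _ _
      rw [ih (p - P.h) (by omega) (fun i hi => hω i (by omega)) (fun i hi => hX i (by omega))]
      congr 1
      unfold plain
      split_ifs with h3 h4
      · rfl
      · exact hX p le_rfl ⟨by omega, h4⟩
      · rfl

lemma reacts_alice (hR : P.H < P.R) (ω : ℕ → Bool) (users : Users) :
    Reacts P.N users .alice (P.actA ω) P.revA (P.outA ω users) where
  rev_nil := rfl
  rev_prefix w b := by rw [revA_append]; exact List.prefix_append _ _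
  rev_le w := by rw [revA_length P hR]; exact min_le_left _ _
  reveal w b j h1 h2 := by
    rw [revA_append] at h2
    have hd : P.IsData w.length := by
      by_contra h; rw [if_neg h, List.append_nil] at h2; omega
    rw [if_pos hd, List.length_append, List.length_singleton] at h2
    obtain rfl : j = (P.revA w).length := by omega
    have hans : answers P.N users .alice (P.revA (w ++ [b])) (P.revA w).length (P.revA w).length =
        [] := by simp [answers]
    rw [hans]
    unfold actA
    have hc : (channelBits (viewOf P.N users .alice P.revA w ++ [Event.channel b])).length =
        w.length + 1 := by
      rw [channelBits_append, channelBits_viewOf]; simp [channelBits]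
    simp only [List.getLast?_concat, hc, Nat.add_sub_cancel, if_pos hd]
    congr 1
    simp only [revA_append, if_pos hd]
    simp
  send w _ := by
    have hpre : ∀ w b, P.revA w <+: P.revA (w ++ [b]) := fun w b => by
      rw [revA_append]; exact List.prefix_append _ _
    have hbit : P.bit ω (fun i => (userBits (viewOf P.N users .alice P.revA w)).getD i false)
        (channelBits (viewOf P.N users .alice P.revA w)).length = P.outA ω users w := by
      rw [channelBits_viewOf, outA]
      apply P.bit_congr
      · intros; rfl
      · intro i hi hd
        rw [userBits_viewOf rfl hpre, List.getD_eq_getElem?_getD, givenOf_alice_getElem?]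
        · rfl
        · rw [P.revA_length hR]
          have h3 := hd.2
          have h4 := P.count_data hR i
          have h5 := P.count_data hR w.length
          have h6 : ((List.range i).filter fun p => P.IsData p).length ≤
              ((List.range w.length).filter fun p => P.IsData p).length := by
            apply List.Sublist.length_le
            apply List.Sublist.filter
            exact List.range_sublist.mpr hi
          omega
        · exact hd.2
    -- A symbol received at a data position is revealed and answered before the next transmission,
    -- so then the last event comes from the user and not from the channel.
    have hlast : ∀ y, (viewOf P.N users .alice P.revA w).getLast? = some (.channel y) →
        ¬ P.IsData ((channelBits (viewOf P.N users .alice P.revA w)).length - 1) := by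
      intro y hy
      rw [channelBits_viewOf]
      rcases List.eq_nil_or_concat w with rfl | ⟨w, b, rfl⟩
      · simp [viewOf_nil, initEvents] at hy
      · rw [List.concat_eq_append] at *
        intro hd
        simp at hd
        have hd : P.IsData w.length := hd
        have hlen : (P.revA w).length < (P.revA (w ++ [b])).length := by
          rw [revA_append, if_pos hd]; simp
        have h4 := getLast?_answers P.N users .alice (P.revA (w ++ [b])) hlen
        rw [viewOf_append, List.getLast?_append, List.getLast?_cons, h4] at hy
        simp [answer] at hy
        split_ifs at hy
    unfold actA
    dsimp only
    rw [hbit]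
    split
    · next y hy => rw [if_neg (hlast y hy)]
    · rfl

lemma revA_length_end (hR : P.H < P.R) {K : ℕ} (hK : P.D ≤ K * P.dl) (w : List Bool)
    (hw : K * P.R ≤ w.length) : (P.revA w).length = P.D := by
  rw [P.revA_length hR, min_eq_left]
  refine hK.trans ?_
  unfold idx
  have : K ≤ w.length / P.R := (Nat.le_div_iff_mul_le (by omega)).mpr hw
  have := Nat.mul_le_mul_right P.dl this
  omega

end Par
end IndelSim

namespace IndelSim

/-! ### Synchronization strings have few self-matches -/

/-- `M` matches positions in `[lo, hi)` of `S`, in order, to different positions with the same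
symbol. -/
structure SelfMatching (S : ℕ → ℕ) (lo hi : ℕ) (M : List (ℕ × ℕ)) : Prop where
  increasing : M.Pairwise fun x y => x.1 < y.1 ∧ x.2 < y.2
  mem : ∀ x ∈ M, lo ≤ x.1 ∧ lo ≤ x.2 ∧ x.1 < hi ∧ x.2 < hi
  ne : ∀ x ∈ M, x.1 ≠ x.2
  eq : ∀ x ∈ M, S x.1 = S x.2

lemma sublist_substring {q : ℕ} (S : List (Fin q)) {i j : ℕ} (hj : j ≤ S.length) (l : List ℕ)
    (hl : l.Pairwise (· < ·)) (h : ∀ x ∈ l, i ≤ x ∧ x < j) :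
    (l.map fun x => (S.map Fin.val).getD x 0).Sublist ((substring S i j).map Fin.val) := by
  have h1 : l.Sublist (List.range' i (j - i)) := by
    apply List.sublist_of_subperm_of_pairwise (r := (· < ·)) _ hl List.pairwise_lt_range'
    · refine List.subperm_of_subset (hl.imp (fun h => ne_of_lt h)) ?_
      intro x hx
      have := h x hx
      rw [List.mem_range'_1]; omega
  have h2 : (substring S i j).map Fin.val =
      (List.range' i (j - i)).map fun x => (S.map Fin.val).getD x 0 := by
    unfold substring
    apply List.ext_getElem
    · simp; omega
    · intro k h1 h2
      simp at h1 h2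
      have : i + k < S.length := by omega
      simp [List.getElem?_eq_getElem this]
  rw [h2]
  exact h1.map _

lemma SelfMatching.swap {S : ℕ → ℕ} {lo hi : ℕ} {M : List (ℕ × ℕ)} (h : SelfMatching S lo hi M) :
    SelfMatching S lo hi (M.map Prod.swap) := by
  refine ⟨?_, ?_, ?_, ?_⟩
  · rw [List.pairwise_map]; exact h.increasing.imp (fun h => ⟨h.2, h.1⟩)
  all_goals
    intro x hx
    obtain ⟨y, hy, rfl⟩ := List.mem_map.mp hx
  · have := h.mem y hy; simp; tauto
  · exact (h.ne y hy).symm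
  · exact (h.eq y hy).symm

lemma SelfMatching.sublist {S : ℕ → ℕ} {lo hi : ℕ} {M M' : List (ℕ × ℕ)}
    (h : SelfMatching S lo hi M)
    (h' : M'.Sublist M) : SelfMatching S lo hi M' :=
  ⟨h.increasing.sublist h', fun x hx => h.mem x (h'.subset hx), fun x hx => h.ne x (h'.subset hx),
    fun x hx => h.eq x (h'.subset hx)⟩

lemma editDist_le {α : Type*} {u v l : List α} (h1 : l.Sublist u) (h2 : l.Sublist v) :
    (editDist u v : ℝ) ≤ u.length + v.length - 2 * l.length := by
  have h : editDist u v ≤ (u.length - l.length) + (v.length - l.length) :=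
    Nat.sInf_le ⟨l, h1, h2, rfl⟩
  have h3 := h1.length_le
  have h4 := h2.length_le
  have h5 : editDist u v + 2 * l.length ≤ u.length + v.length := by omega
  have h6 : ((editDist u v + 2 * l.length : ℕ) : ℝ) ≤ ((u.length + v.length : ℕ) : ℝ) := by
    exact_mod_cast h5
  push_cast at h6
  linarith

/-- The part of a self-matching that lies below the partner of its first position. -/
lemma selfMatching_segment {q : ℕ} {S : List (Fin q)} {ε : ℝ} (hS : IsSyncString ε S) {lo hi : ℕ}
    (hhi : hi ≤ S.length) {M : List (ℕ × ℕ)}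
    (h : SelfMatching (fun i => (S.map Fin.val).getD i 0) lo hi M) {a b c : ℕ} (hab : a < b)
    (hbc : b < c) (hc : c ≤ hi) (hM : ∀ x ∈ M, a ≤ x.1 ∧ x.1 < b ∧ b ≤ x.2 ∧ x.2 < c) :
    2 * (M.length : ℝ) < ε * (c - a) := by
  set f := fun x => (S.map Fin.val).getD x 0 with hf
  have h1 : (M.map fun x => f x.1).Sublist ((substring S a b).map Fin.val) := by
    have := sublist_substring S (i := a) (j := b) (by omega) (M.map Prod.fst)
      (by rw [List.pairwise_map]; exact h.increasing.imp And.left)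
      (by intro x hx; obtain ⟨y, hy, rfl⟩ := List.mem_map.mp hx; exact ⟨(hM y hy).1, (hM y hy).2.1⟩)
    rwa [List.map_map] at this
  have h2 : (M.map fun x => f x.1).Sublist ((substring S b c).map Fin.val) := by
    have := sublist_substring S (i := b) (j := c) (by omega) (M.map Prod.snd)
      (by rw [List.pairwise_map]; exact h.increasing.imp And.right)
      (by intro x hx; obtain ⟨y, hy, rfl⟩ := List.mem_map.mp hx; exact (hM y hy).2.2)
    rw [List.map_map] at this
    have he : M.map (fun x => f x.1) = M.map (f ∘ Prod.snd) :=
      List.map_congr_left (fun x hx => h.eq x hx)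
    rw [he]; exact this
  obtain ⟨l, hl, hl1⟩ := List.sublist_map_iff.mp h1
  obtain ⟨l', hl', hl2⟩ := List.sublist_map_iff.mp h2
  obtain rfl : l = l' := List.map_injective_iff.mpr Fin.val_injective (hl1.symm.trans hl2)
  have h3 := hS a b c hab hbc (by omega)
  have h4 := editDist_le hl hl'
  have h5 : l.length = M.length := by
    have := congrArg List.length hl1; simpa using this.symm
  have h6 : (substring S a b).length = b - a := by unfold substring; simp; omega
  have h7 : (substring S b c).length = c - b := by unfold substring; simp; omega
  rw [h5, h6, h7, Nat.cast_sub hab.le, Nat.cast_sub hbc.le] at h4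
  linarith

/-- Let the first pair `x` have `x.1 < x.2`. The pairs whose first entry lies below `x.2` form a
common subsequence of two adjacent substrings, from `x.1` to `x.2` and from `x.2` to some `c`, and
the synchronization property bounds their number by `ε (c - x.1) / 2`. The remaining pairs start at
or beyond `(x.2, c)`, so the potential `(hi - x.1) + (hi - x.2)` has dropped by at least `c - x.1`.
The case `x.2 < x.1` follows by symmetry. -/
lemma selfMatching_bound {q : ℕ} {S : List (Fin q)} {ε : ℝ} (hε : 0 < ε) (hS : IsSyncString ε S)
    {lo hi : ℕ} (hhi : hi ≤ S.length) (k : ℕ) : ∀ (M : List (ℕ × ℕ)) (x : ℕ × ℕ), M.length < k →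
    SelfMatching (fun i => (S.map Fin.val).getD i 0) lo hi (x :: M) →
    2 * (((x :: M).length : ℕ) : ℝ) ≤ ε * (((hi : ℝ) - x.1) + (hi - x.2)) := by
  induction k with
  | zero => intro M x h; omega
  | succ k ih =>
    have key : ∀ (M : List (ℕ × ℕ)) (x : ℕ × ℕ), M.length < k + 1 → x.1 < x.2 →
        SelfMatching (fun i => (S.map Fin.val).getD i 0) lo hi (x :: M) →
        2 * (((x :: M).length : ℕ) : ℝ) ≤ ε * (((hi : ℝ) - x.1) + (hi - x.2)) := by
      intro M x hMk hx hM
      set T := M.takeWhile (fun z => decide (z.1 < x.2)) with hT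
      set U := M.dropWhile (fun z => decide (z.1 < x.2)) with hU
      have hTU : T ++ U = M := List.takeWhile_append_dropWhile
      have hinc := hM.increasing
      rw [List.pairwise_cons] at hinc
      -- the end of the segment
      obtain ⟨c, hc1, hc2, hc3, hc4⟩ : ∃ c, x.2 < c ∧ c ≤ hi ∧ (∀ z ∈ T, z.2 < c) ∧
          ∀ z ∈ U, c ≤ z.2 := by
        rcases List.eq_nil_or_concat T with h | ⟨T', z, h⟩
        · refine ⟨x.2 + 1, by omega, ?_, by simp [h], ?_⟩
          · have := (hM.mem x (by simp)).2.2.2; omega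
          · intro z hz
            exact (hinc.1 z (by rw [← hTU]; simp [hz])).2
        · rw [List.concat_eq_append] at h
          have hzM : z ∈ M := by rw [← hTU, h]; simp
          refine ⟨z.2 + 1, ?_, ?_, ?_, ?_⟩
          · have := (hinc.1 z hzM).2; omega
          · have := (hM.mem z (by simp [hzM])).2.2.2; omega
          · intro z' hz'
            rw [h] at hz'
            rcases List.mem_append.mp hz' with h' | h'
            · have h2 := hinc.2
              rw [← hTU, h, List.append_assoc, List.pairwise_append] at h2
              have := (h2.2.2 z' h' z (by simp)).2; omega
            · simp at h'; rw [h']; omega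
          · intro z' hz'
            have h2 := hinc.2
            rw [← hTU, List.pairwise_append] at h2
            have := (h2.2.2 z (by rw [h]; simp) z' hz').2; omega
      have hseg := selfMatching_segment hS hhi (M := x :: T)
        (hM.sublist (by rw [List.cons_sublist_cons, ← hTU]; exact List.sublist_append_left _ _))
        hx hc1 hc2 (by
          intro z hz
          rcases List.mem_cons.mp hz with rfl | hz
          · exact ⟨le_rfl, hx, le_rfl, hc1⟩
          · have h2 := hinc.1 z (by rw [← hTU]; simp [hz])
            refine ⟨h2.1.le, ?_, h2.2.le, hc3 z hz⟩
            have := List.mem_takeWhile_imp hz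
            simpa using this)
      have hlen : (((x :: M).length : ℕ) : ℝ) = ((x :: T).length : ℕ) + (U.length : ℕ) := by
        rw [← hTU]; push_cast [List.length_cons, List.length_append]; ring
      have hx2 : (x.2 : ℝ) ≤ hi := by exact_mod_cast (hM.mem x (by simp)).2.2.2.le
      have hchi : (c : ℝ) ≤ hi := by exact_mod_cast hc2
      rw [hlen]
      cases hU' : U with
      | nil =>
        simp only [List.length_nil, Nat.cast_zero, add_zero]
        refine hseg.le.trans (mul_le_mul_of_nonneg_left ?_ hε.le)
        linarith
      | cons z U' =>
        have hz : ¬ z.1 < x.2 := by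
          have h3 := List.head?_dropWhile_not (fun z : ℕ × ℕ => decide (z.1 < x.2)) M
          rw [← hU, hU'] at h3
          simpa using h3
        have h4 := ih U' z (by
            have := congrArg List.length hTU
            rw [hU'] at this; simp at this; omega)
          (hM.sublist (by
            rw [← hU', ← hTU]
            exact (List.sublist_append_right _ _).trans (List.sublist_cons_self _ _)))
        have h5 : (x.2 : ℝ) ≤ z.1 := by exact_mod_cast not_lt.mp hz
        have h6 : (c : ℝ) ≤ z.2 := by exact_mod_cast hc4 z (by rw [hU']; simp)
        have h7 : ε * ((c : ℝ) - x.1) + ε * (((hi : ℝ) - z.1) + (hi - z.2)) ≤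
            ε * (((hi : ℝ) - x.1) + (hi - x.2)) := by
          rw [← mul_add]; exact mul_le_mul_of_nonneg_left (by linarith) hε.le
        linarith
    intro M x hMk hM
    rcases lt_or_gt_of_ne (hM.ne x (by simp)) with h | h
    · exact key M x hMk h hM
    · have := key (M.map Prod.swap) x.swap (by rw [List.length_map]; exact hMk) h
        (by simpa using hM.swap)
      simp only [List.length_cons, List.length_map, Prod.fst_swap, Prod.snd_swap] at this ⊢
      linarith

lemma selfMatching_length {q : ℕ} {S : List (Fin q)} {ε : ℝ} (hε : 0 < ε) (hS : IsSyncString ε S)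
    {lo hi : ℕ} (hhi : hi ≤ S.length) (hlo : lo ≤ hi) (M : List (ℕ × ℕ))
    (hM : SelfMatching (fun i => (S.map Fin.val).getD i 0) lo hi M) :
    (M.length : ℝ) ≤ ε * ((hi : ℝ) - lo) := by
  have hlo' : (lo : ℝ) ≤ hi := by exact_mod_cast hlo
  cases M with
  | nil => simp; exact mul_nonneg hε.le (by linarith)
  | cons x M =>
    have h1 := selfMatching_bound hε hS hhi _ M x (Nat.lt_succ_self _) hM
    have h2 : (lo : ℝ) ≤ x.1 := by exact_mod_cast (hM.mem x (by simp)).1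
    have h3 : (lo : ℝ) ≤ x.2 := by exact_mod_cast (hM.mem x (by simp)).2.1
    have h4 : ε * (((hi : ℝ) - x.1) + (hi - x.2)) ≤ ε * (2 * ((hi : ℝ) - lo)) :=
      mul_le_mul_of_nonneg_left (by linarith) hε.le
    linarith

/-! ### Decoding -/

namespace Par

section cost

variable (S y : ℕ → ℕ)

lemma cost_zero_right (w : ℕ) : cost S y w 0 = w := by cases w <;> simp [cost]

lemma cost_zero_left (k : ℕ) : cost S y 0 k = k := by cases k <;> simp [cost]

lemma cost_succ_right_le (w k : ℕ) : cost S y w (k + 1) ≤ cost S y w k + 1 := by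
  cases w with
  | zero => simp [cost]
  | succ w =>
    rw [cost]
    split_ifs
    · exact (min_le_left _ _).trans (min_le_right _ _)
    · exact min_le_right _ _

lemma cost_succ_left_le (w k : ℕ) : cost S y (w + 1) k ≤ cost S y w k + 1 := by
  cases k with
  | zero => simp [cost_zero_right]
  | succ k =>
    rw [cost]
    split_ifs
    · exact (min_le_left _ _).trans (min_le_left _ _)
    · exact min_le_left _ _

lemma cost_diag_le {w k : ℕ} (h : S k = y w) : cost S y (w + 1) (k + 1) ≤ cost S y w k := by
  rw [cost, if_pos h]; exact min_le_right _ _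

/-- An optimal path to `(w, k)` after its last common point with the path through the points
`(W κ, κ)`. -/
lemma cost_path {W : ℕ → ℕ} (h0 : W 0 = 0) (K w k : ℕ) :
    ∃ κ ≤ K, W κ ≤ w ∧ κ ≤ k ∧ ∃ M : List (ℕ × ℕ),
      M.Pairwise (fun a b => a.1 < b.1 ∧ a.2 < b.2) ∧
      (∀ a ∈ M, W κ ≤ a.1 ∧ a.1 < w ∧ κ ≤ a.2 ∧ a.2 < k ∧ S a.2 = y a.1 ∧
        ¬ (a.2 + 1 ≤ K ∧ W (a.2 + 1) = a.1 + 1)) ∧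
      cost S y (W κ) κ + (w - W κ) + (k - κ) ≤ cost S y w k + 2 * M.length := by
  induction w generalizing k with
  | zero =>
    refine ⟨0, Nat.zero_le _, by omega, Nat.zero_le _, [], by simp, by simp, ?_⟩
    simp [h0, cost_zero_left]
  | succ w ihw =>
    have left : ∀ k, cost S y (w + 1) k = cost S y w k + 1 → ∃ κ ≤ K, W κ ≤ w + 1 ∧ κ ≤ k ∧
        ∃ M : List (ℕ × ℕ), M.Pairwise (fun a b => a.1 < b.1 ∧ a.2 < b.2) ∧
        (∀ a ∈ M, W κ ≤ a.1 ∧ a.1 < w + 1 ∧ κ ≤ a.2 ∧ a.2 < k ∧ S a.2 = y a.1 ∧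
          ¬ (a.2 + 1 ≤ K ∧ W (a.2 + 1) = a.1 + 1)) ∧
        cost S y (W κ) κ + (w + 1 - W κ) + (k - κ) ≤ cost S y (w + 1) k + 2 * M.length := by
      intro k hk
      obtain ⟨κ, h1, h2, h3, M, h4, h5, h6⟩ := ihw k
      refine ⟨κ, h1, by omega, h3, M, h4, fun a ha => ?_, by omega⟩
      obtain ⟨g1, g2, g3⟩ := h5 a ha
      exact ⟨g1, by omega, g3⟩
    induction k with
    | zero => exact left 0 (by simp [cost_zero_right])
    | succ k ihk =>
      -- The point lies on the true path: it is the last common point, and no matches follow.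
      by_cases ht : k + 1 ≤ K ∧ W (k + 1) = w + 1
      · exact ⟨k + 1, ht.1, ht.2.le, le_rfl, [], by simp, by simp, by simp [ht.2]⟩
      have hc : cost S y (w + 1) (k + 1) = cost S y w (k + 1) + 1 ∨
          cost S y (w + 1) (k + 1) = cost S y (w + 1) k + 1 ∨
          S k = y w ∧ cost S y (w + 1) (k + 1) = cost S y w k := by
        rw [cost]; split_ifs with h <;> simp only [h, true_and, false_and, or_false] <;> omega
      rcases hc with h | h | ⟨hS, h⟩
      · exact left _ h
      · obtain ⟨κ, h1, h2, h3, M, h4, h5, h6⟩ := ihk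
        refine ⟨κ, h1, h2, by omega, M, h4, fun a ha => ?_, by omega⟩
        obtain ⟨g1, g2, g3, g4, g5⟩ := h5 a ha
        exact ⟨g1, g2, g3, by omega, g5⟩
      · obtain ⟨κ, h1, h2, h3, M, h4, h5, h6⟩ := ihw k
        refine ⟨κ, h1, by omega, by omega, M ++ [(w, k)], ?_, ?_, ?_⟩
        · rw [List.pairwise_append]
          refine ⟨h4, by simp, fun a ha b hb => ?_⟩
          simp at hb; subst hb
          exact ⟨(h5 a ha).2.1, (h5 a ha).2.2.2.1⟩
        · intro a ha
          rcases List.mem_append.mp ha with ha | ha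
          · obtain ⟨g1, g2, g3, g4, g5⟩ := h5 a ha
            exact ⟨g1, by omega, g3, by omega, g5⟩
          · simp at ha; subst ha
            exact ⟨h2, by simp, h3, by simp, hS, ht⟩
        · simp; omega

/-- The blocks whose symbols are received correctly. -/
structure Truth (W : ℕ → ℕ) (Acc : ℕ → Prop) (K : ℕ) : Prop where
  zero : W 0 = 0
  mono : Monotone W
  acc : ∀ k < K, Acc k → W (k + 1) = W k + 1 ∧ S k = y (W k)

open Classical in
/-- The number of edits that separate the received symbols from the sent symbol. -/
noncomputable def defect (W : ℕ → ℕ) (Acc : ℕ → Prop) (k : ℕ) : ℕ :=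
  if Acc k then 0 else 1 + (W (k + 1) - W k)

variable {S y}

/-- The true alignment is a competitor: a block received correctly costs nothing, any other one
costs the deletion of its own symbol and of the symbols accepted meanwhile. -/
lemma cost_truth_le {W : ℕ → ℕ} {Acc : ℕ → Prop} {K : ℕ} (h : Truth S y W Acc K) {κ k : ℕ}
    (hk : κ ≤ k) (hK : k ≤ K) :
    cost S y (W k) k ≤ cost S y (W κ) κ + ∑ i ∈ Finset.Ico κ k, defect W Acc i := by
  induction k, hk using Nat.le_induction with
  | base => simp
  | succ k hk ih =>
    rw [Finset.sum_Ico_succ_top hk]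
    have ih := ih (by omega)
    have key : cost S y (W (k + 1)) (k + 1) ≤ cost S y (W k) k + defect W Acc k := by
      unfold defect
      split_ifs with ha
      · obtain ⟨h1, h2⟩ := h.acc k (by omega) ha
        rw [h1]; exact cost_diag_le S y h2
      · have h1 : ∀ j, cost S y (W k + j) k ≤ cost S y (W k) k + j := by
          intro j
          induction j with
          | zero => simp
          | succ j ihj => have := cost_succ_left_le S y (W k + j) k; rw [← add_assoc]; omega
        have h2 := h1 (W (k + 1) - W k)
        have hm : W k ≤ W (k + 1) := h.mono (Nat.le_succ k)
        rw [Nat.add_sub_cancel' hm] at h2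
        have h3 := cost_succ_right_le S y (W (k + 1)) k
        omega
    omega

open Classical in
lemma truth_count {W : ℕ → ℕ} {Acc : ℕ → Prop} {K : ℕ} (h : Truth S y W Acc K) {κ k : ℕ}
    (hk : κ ≤ k) (hK : k ≤ K) :
    W k - W κ ≤ ((Finset.Ico κ k).filter Acc).card + ∑ i ∈ Finset.Ico κ k, defect W Acc i ∧
    k - κ ≤ ((Finset.Ico κ k).filter Acc).card + ∑ i ∈ Finset.Ico κ k, defect W Acc i := by
  induction k, hk using Nat.le_induction with
  | base => simp
  | succ k hk ih =>
    have ih := ih (by omega)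
    have hm : W k ≤ W (k + 1) := h.mono (Nat.le_succ k)
    have hm' := h.mono hk
    have : Finset.Ico κ (k + 1) = insert k (Finset.Ico κ k) := by ext; simp; omega
    rw [this, Finset.filter_insert, Finset.sum_insert (by simp)]
    unfold defect at ih ⊢
    by_cases ha : Acc k
    · obtain ⟨h1, h2⟩ := h.acc k (by omega) ha
      rw [if_pos ha, if_pos ha, Finset.card_insert_of_notMem (by simp)]
      omega
    · rw [if_neg ha, if_neg ha]
      omega

/-- A guess `g` of the number of blocks is off only if many of the last blocks are received
incorrectly. -/
lemma guess_bound {W : ℕ → ℕ} {Acc : ℕ → Prop} {K w g : ℕ} {ε : ℝ}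
    (h : Truth S y W Acc K) (hw : W K ≤ w)
    (hg : cost S y w g ≤ cost S y w K)
    (hS : ∀ lo M, lo ≤ max K g → SelfMatching S lo (max K g) M →
      (M.length : ℝ) ≤ ε * (((max K g : ℕ) : ℝ) - lo)) :
    ∃ κ ≤ K, κ ≤ g ∧ (1 - ε) * ((max K g : ℕ) - (κ : ℝ)) ≤
      3 * ((∑ i ∈ Finset.Ico κ K, defect W Acc i + (w - W K) : ℕ) : ℝ) := by
  classical
  obtain ⟨κ, h1, h2, h3, M, h4, h5, h6⟩ := cost_path S y h.zero K w g
  refine ⟨κ, h1, h3, ?_⟩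
  set μ := ∑ i ∈ Finset.Ico κ K, defect W Acc i + (w - W K) with hμ
  -- The competitor follows the truth up to `(W K, K)` and discards the remaining received symbols.
  have hcost : cost S y w K ≤ cost S y (W κ) κ + μ := by
    have g1 := cost_truth_le h h1 le_rfl
    have g2 : ∀ j, cost S y (W K + j) K ≤ cost S y (W K) K + j := by
      intro j
      induction j with
      | zero => simp
      | succ j ihj => have := cost_succ_left_le S y (W K + j) K; rw [← add_assoc]; omega
    have g3 := g2 (w - W K)
    rw [Nat.add_sub_cancel' hw] at g3
    omega
  obtain ⟨c1, c2⟩ := truth_count h h1 le_rfl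
  set A := (Finset.Ico κ K).filter Acc with hA
  have hWκ : W κ ≤ W K := h.mono h1
  have hinj : Set.InjOn W A := by
    intro a ha b hb hab
    by_contra hne
    simp only [hA, Finset.coe_filter, Finset.mem_Ico, Set.mem_ofPred_eq] at ha hb
    rcases lt_or_gt_of_ne hne with hlt | hlt
    · have := h.mono (show a + 1 ≤ b from hlt); have := (h.acc a ha.1.2 ha.2).1; omega
    · have := h.mono (show b + 1 ≤ a from hlt); have := (h.acc b hb.1.2 hb.2).1; omega
  set T := A.image W with hT
  have hTcard : T.card = A.card := Finset.card_image_of_injOn hinj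
  have hTsub : T ⊆ Finset.Ico (W κ) w := by
    intro l hl
    obtain ⟨k, hk, rfl⟩ := Finset.mem_image.mp hl
    simp only [hA, Finset.mem_filter, Finset.mem_Ico] at hk
    have g1 := h.mono hk.1.1
    have g2 := h.mono (show k + 1 ≤ K from hk.1.2)
    have g3 := (h.acc k hk.1.2 hk.2).1
    rw [Finset.mem_Ico]; omega
  -- the matches of the path with symbols that are received correctly
  have hbad : (M.filter fun a => a.1 ∉ T).length ≤ (w - W κ) - A.card := by
    have g1 : ((M.filter fun a => a.1 ∉ T).map Prod.fst).Nodup := by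
      rw [List.Nodup, List.pairwise_map]
      exact (h4.sublist List.filter_sublist).imp (fun h => ne_of_lt h.1)
    have g2 : ((M.filter fun a => a.1 ∉ T).map Prod.fst).toFinset ⊆ Finset.Ico (W κ) w \ T := by
      intro l hl
      rw [List.mem_toFinset, List.mem_map] at hl
      obtain ⟨a, ha, rfl⟩ := hl
      rw [List.mem_filter] at ha
      rw [Finset.mem_sdiff, Finset.mem_Ico]
      refine ⟨⟨(h5 a ha.1).1, (h5 a ha.1).2.1⟩, by simpa using ha.2⟩
    have g3 := Finset.card_le_card g2
    rw [List.toFinset_card_of_nodup g1, List.length_map, Finset.card_sdiff_of_subset hTsub, hTcard,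
      Nat.card_Ico] at g3
    exact g3
  have hTw := Finset.card_le_card hTsub
  rw [hTcard, Nat.card_Ico] at hTw
  have hsplit : (M.filter fun a => a.1 ∈ T).length + (M.filter fun a => a.1 ∉ T).length =
      M.length := by
    rw [← List.length_append]
    exact (List.filter_append_perm (fun a : ℕ × ℕ => decide (a.1 ∈ T)) M).length_eq ▸ by
      simp
  -- they form a self-matching
  have hinv : ∀ l ∈ T, ∃ k ∈ A, W k = l := fun l hl => by
    obtain ⟨k, hk, rfl⟩ := Finset.mem_image.mp hl; exact ⟨k, hk, rfl⟩
  -- `t l` is the block whose symbol was received as number `l`. Replacing received symbols by their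
  -- blocks turns the path into a matching of `S` with itself; no pair is diagonal, since the path
  -- does not return to the truth.
  choose! t ht1 ht2 using hinv
  have hself : SelfMatching S κ (max K g) ((M.filter fun a => a.1 ∈ T).map fun a => (t a.1,
    a.2)) := by
    refine ⟨?_, ?_, ?_, ?_⟩
    · rw [List.pairwise_map]
      refine List.Pairwise.imp_of_mem ?_ (h4.sublist List.filter_sublist)
      intro a b ha hb hab
      refine ⟨?_, hab.2⟩
      rw [List.mem_filter] at ha hb
      by_contra hcon
      have g1 := h.mono (not_lt.mp hcon)
      simp only at g1
      rw [ht2 _ (by simpa using hb.2), ht2 _ (by simpa using ha.2)] at g1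
      omega
    all_goals
      intro x hx
      obtain ⟨a, ha, rfl⟩ := List.mem_map.mp hx
      rw [List.mem_filter] at ha
      have haT : a.1 ∈ T := by simpa using ha.2
      have g1 := ht1 _ haT
      have g2 := ht2 _ haT
      simp only [hA, Finset.mem_filter, Finset.mem_Ico] at g1
      obtain ⟨e1, e2, e3, e4, e5, e6⟩ := h5 a ha.1
      have g3 := h.acc _ g1.1.2 g1.2
    · simp only; omega
    · simp only
      intro heq
      apply e6
      rw [← heq]
      exact ⟨g1.1.2, by rw [g3.1, g2]⟩
    · simp only
      rw [e5, g3.2, g2]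
  have hlen := hS κ _ (by omega) hself
  rw [List.length_map] at hlen
  -- arithmetic
  have f1 : w - W κ ≤ A.card + μ := by omega
  have f2 : K - κ ≤ A.card + μ := by omega
  have f3 : (w - W κ) + (g - κ) ≤ μ + 2 * M.length := by omega
  have f4 : M.length + A.card ≤ (M.filter fun a => a.1 ∈ T).length + (w - W κ) := by omega
  have f5 : M.length ≤ g - κ := by
    have g1 : (M.map Prod.snd).Nodup := by
      rw [List.Nodup, List.pairwise_map]
      exact h4.imp (fun h => ne_of_lt h.2)
    have g2 : (M.map Prod.snd).toFinset ⊆ Finset.Ico κ g := by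
      intro l hl
      rw [List.mem_toFinset, List.mem_map] at hl
      obtain ⟨a, ha, rfl⟩ := hl
      rw [Finset.mem_Ico]; exact ⟨(h5 a ha).2.2.1, (h5 a ha).2.2.2.1⟩
    have g3 := Finset.card_le_card g2
    rw [List.toFinset_card_of_nodup g1, List.length_map, Nat.card_Ico] at g3
    exact g3
  have f6 : M.length ≤ w - W κ := by
    have g1 : (M.map Prod.fst).Nodup := by
      rw [List.Nodup, List.pairwise_map]
      exact h4.imp (fun h => ne_of_lt h.1)
    have g2 : (M.map Prod.fst).toFinset ⊆ Finset.Ico (W κ) w := by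
      intro l hl
      rw [List.mem_toFinset, List.mem_map] at hl
      obtain ⟨a, ha, rfl⟩ := hl
      rw [Finset.mem_Ico]; exact ⟨(h5 a ha).1, (h5 a ha).2.1⟩
    have g3 := Finset.card_le_card g2
    rw [List.toFinset_card_of_nodup g1, List.length_map, Nat.card_Ico] at g3
    exact g3
  -- By `f3`, `f5` and `f6` the path leaves at most `μ` positions unmatched in total, and by `f1`
  -- and `f4` at most `μ` of its matches use symbols that are not received correctly.
  have f7 : max K g - κ ≤ (M.filter fun a => a.1 ∈ T).length + 3 * μ := by omega
  have f8 : ((max K g : ℕ) : ℝ) - κ ≤ ((M.filter fun a => a.1 ∈ T).length : ℕ) + 3 * (μ : ℝ) := by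
    have : max K g ≤ (M.filter fun a => a.1 ∈ T).length + 3 * μ + κ := by omega
    have h' : ((max K g : ℕ) : ℝ) ≤ (((M.filter fun a => a.1 ∈ T).length + 3 * μ + κ : ℕ) : ℝ) :=
      Nat.cast_le.mpr this
    push_cast at h' ⊢
    linarith
  linarith

end cost

lemma argmin_le (f : ℕ → ℕ) (n : ℕ) : argmin f n ≤ n ∧ ∀ k ≤ n, f (argmin f n) ≤ f k := by
  induction n with
  | zero => exact ⟨le_rfl, fun k hk => by rw [Nat.le_zero.mp hk]; rfl⟩
  | succ n ih =>
    rw [argmin]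
    split_ifs with h
    · refine ⟨le_rfl, fun k hk => ?_⟩
      rcases Nat.lt_or_ge n k with h' | h'
      · obtain rfl : k = n + 1 := by omega
        exact le_rfl
      · have := ih.2 k h'; omega
    · refine ⟨by omega, fun k hk => ?_⟩
      rcases Nat.lt_or_ge n k with h' | h'
      · obtain rfl : k = n + 1 := by omega
        omega
      · exact ih.2 k h'

/-- A one-sided covering lemma. -/
lemma card_dense_le (μ : ℕ → ℕ) {C : ℝ} (hC : 0 ≤ C) (B : ℕ → Prop) [DecidablePred B]
    (hB : ∀ x, B x → ∃ κ ≤ x, ((x + 1 : ℕ) : ℝ) - κ ≤ C * (∑ i ∈ Finset.Ico κ (x + 1), μ i : ℕ))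
    (K : ℕ) : (((Finset.range K).filter B).card : ℝ) ≤ C * (∑ i ∈ Finset.range K, μ i : ℕ) := by
  induction K using Nat.strong_induction_on with
  | _ K ih =>
    cases K with
    | zero => simp
    | succ x =>
      -- If the last index is bad, it is removed together with its whole stretch, whose length is
      -- paid for by the weights in the stretch. The stretches removed in this way are disjoint.
      by_cases hx : B x
      · obtain ⟨κ, hκ, h⟩ := hB x hx
        have h1 := ih κ (by omega)
        have h2 : ((Finset.range (x + 1)).filter B).card ≤
            ((Finset.range κ).filter B).card + (x + 1 - κ) := by
          have : (Finset.range (x + 1)).filter B ⊆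
              (Finset.range κ).filter B ∪ Finset.Ico κ (x + 1) := by
            intro i; simp; intro h1 h2
            by_cases h3 : i < κ
            · exact Or.inl ⟨h3, h2⟩
            · right; omega
          have h3 := (Finset.card_le_card this).trans (Finset.card_union_le _ _)
          rwa [Nat.card_Ico] at h3
        have h3 : (((Finset.range (x + 1)).filter B).card : ℝ) ≤
            ((Finset.range κ).filter B).card + (((x + 1 : ℕ) : ℝ) - κ) := by
          rw [← Nat.cast_sub (by omega)]; exact_mod_cast h2
        have h4 : ∑ i ∈ Finset.range (x + 1), μ i =
            ∑ i ∈ Finset.range κ, μ i + ∑ i ∈ Finset.Ico κ (x + 1), μ i :=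
          (Finset.sum_range_add_sum_Ico _ (by omega)).symm
        rw [h4, Nat.cast_add, mul_add]
        linarith
      · rw [Finset.range_add_one, Finset.filter_insert, if_neg hx, Finset.sum_insert (by simp)]
        have := ih x (by omega)
        push_cast at this ⊢
        have h0 : 0 ≤ C * (μ x : ℝ) := mul_nonneg hC (Nat.cast_nonneg _)
        linarith

end Par
end IndelSim

namespace IndelSim
namespace Par

/-! ### Scanning -/

section scan

variable (P : Par)

lemma scan_succ_of_ne {β : ℕ → Bool} {t : ℕ} (h : (P.scan β (t + 1)).zc ≠ P.h) :
    (P.scan β (t + 1)).tau = (P.scan β t).tau ∧ (P.scan β (t + 1)).na = (P.scan β t).na ∧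
    (P.scan β (t + 1)).cnt = (P.scan β t).cnt ∧ (P.scan β (t + 1)).y = (P.scan β t).y := by
  rw [scan] at h ⊢
  unfold scanStep at h ⊢
  dsimp only at h ⊢
  split_ifs at h ⊢ <;> simp_all

lemma scan_zc (β : ℕ → Bool) (t : ℕ) : (P.scan β (t + 1)).zc =
    if β t then 1 else if (P.scan β t).zc = 0 then 0 else (P.scan β t).zc + 1 := by
  rw [scan]
  unfold scanStep
  dsimp only
  split_ifs <;> simp_all

lemma scan_succ_of_eq {β : ℕ → Bool} {t : ℕ} (h : (P.scan β (t + 1)).zc = P.h) :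
    (P.scan β (t + 1)).tau = t + 1 ∧
    ((P.scan β t).na ≤ t + 1 → (P.scan β (t + 1)).na = t + 1 + P.R ∧
      (P.scan β (t + 1)).cnt = (P.scan β t).cnt + 1 ∧ (P.scan β (t + 1)).y =
        Function.update (P.scan β t).y (P.scan β t).cnt (P.sym β (t + 1))) ∧
    (¬ (P.scan β t).na ≤ t + 1 → (P.scan β (t + 1)).na = (P.scan β t).na ∧
      (P.scan β (t + 1)).cnt = (P.scan β t).cnt ∧ (P.scan β (t + 1)).y = (P.scan β t).y) := by
  have hz := P.scan_zc β t
  rw [h] at hz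
  rw [scan]
  unfold scanStep
  dsimp only
  rw [if_pos hz.symm]
  split_ifs <;> simp_all

lemma scan_na_le (β : ℕ → Bool) (t : ℕ) : (P.scan β t).na ≤ t + P.R := by
  induction t with
  | zero => exact Nat.zero_le _
  | succ t ih =>
    by_cases h : (P.scan β (t + 1)).zc = P.h
    · obtain ⟨-, h1, h2⟩ := P.scan_succ_of_eq h
      by_cases h3 : (P.scan β t).na ≤ t + 1
      · rw [(h1 h3).1]
      · rw [(h2 h3).1]; omega
    · rw [(P.scan_succ_of_ne h).2.1]; omega

lemma scan_cnt_mono (β : ℕ → Bool) : Monotone fun t => (P.scan β t).cnt := by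
  refine monotone_nat_of_le_succ fun t => ?_
  by_cases h : (P.scan β (t + 1)).zc = P.h
  · obtain ⟨-, h1, h2⟩ := P.scan_succ_of_eq h
    by_cases h3 : (P.scan β t).na ≤ t + 1
    · rw [(h1 h3).2.1]; omega
    · rw [(h2 h3).2.1]
  · rw [(P.scan_succ_of_ne h).2.2.1]

/-- Accepted markers are far apart. -/
lemma scan_cnt_le (β : ℕ → Bool) {t t' : ℕ} (htt : t ≤ t') :
    P.R * ((P.scan β t').cnt - (P.scan β t).cnt) ≤ (t' - t) + P.R := by
  -- Each acceptance after time `t` pushes `na` at least `R` further, so `na` bounds the number of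
  -- acceptances; `scan_na_le` bounds `na`.
  have key : (P.scan β t').cnt = (P.scan β t).cnt ∨
      P.R * ((P.scan β t').cnt - (P.scan β t).cnt) + t + 1 ≤ (P.scan β t').na := by
    induction t', htt using Nat.le_induction with
    | base => exact Or.inl rfl
    | succ s hs ih =>
      have hm : (P.scan β t).cnt ≤ (P.scan β s).cnt := P.scan_cnt_mono β hs
      by_cases h : (P.scan β (s + 1)).zc = P.h
      · obtain ⟨-, h1, h2⟩ := P.scan_succ_of_eq h
        by_cases h3 : (P.scan β s).na ≤ s + 1
        · rw [(h1 h3).1, (h1 h3).2.1]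
          right
          rcases ih with ih | ih
          · rw [ih]; simp; omega
          · rw [Nat.sub_add_comm hm, Nat.mul_add]; omega
        · rw [(h2 h3).1, (h2 h3).2.1]; exact ih
      · rw [(P.scan_succ_of_ne h).2.1, (P.scan_succ_of_ne h).2.2.1]; exact ih
  have := P.scan_na_le β t'
  rcases key with h | h
  · rw [h]; simp
  · omega

lemma sym_congr {β β' : ℕ → Bool} {a T : ℕ} (h : ∀ i < T, β i = β' i) (ha : a + P.h + P.q ≤ T) :
    P.sym β a = P.sym β' a := by
  unfold sym
  refine Finset.sum_congr rfl fun c hc => ?_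
  rw [Finset.mem_range] at hc
  rw [h _ (by omega), h _ (by omega)]

/-- Places and numbers of markers are determined by the bits scanned. A recorded symbol is read from
the `h + q` bits after its marker, and the last accepted marker ends at `na - R`; hence the extra
condition for `y`. -/
lemma scan_congr {β β' : ℕ → Bool} {T : ℕ} (h : ∀ i < T, β i = β' i) {t : ℕ} (ht : t ≤ T) :
    (P.scan β t).zc = (P.scan β' t).zc ∧ (P.scan β t).tau = (P.scan β' t).tau ∧
    (P.scan β t).na = (P.scan β' t).na ∧ (P.scan β t).cnt = (P.scan β' t).cnt ∧
    ((P.scan β t).na + P.h + P.q ≤ T + P.R → (P.scan β t).y = (P.scan β' t).y) := by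
  induction t with
  | zero => exact ⟨rfl, rfl, rfl, rfl, fun _ => rfl⟩
  | succ t ih =>
    obtain ⟨h1, h2, h3, h4, h5⟩ := ih (by omega)
    have hz : (P.scan β (t + 1)).zc = (P.scan β' (t + 1)).zc := by
      rw [scan_zc, scan_zc, h t (by omega), h1]
    refine ⟨hz, ?_⟩
    by_cases hm : (P.scan β (t + 1)).zc = P.h
    · obtain ⟨g1, g2, g3⟩ := P.scan_succ_of_eq hm
      obtain ⟨g1', g2', g3'⟩ := P.scan_succ_of_eq (hz ▸ hm)
      by_cases ha : (P.scan β t).na ≤ t + 1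
      · obtain ⟨f1, f2, f3⟩ := g2 ha
        obtain ⟨f1', f2', f3'⟩ := g2' (h3 ▸ ha)
        refine ⟨by rw [g1, g1'], by rw [f1, f1'], by rw [f2, f2', h4], fun hy => ?_⟩
        rw [f1] at hy
        rw [f3, f3', h4, h5 (by omega), P.sym_congr h (by omega)]
      · obtain ⟨f1, f2, f3⟩ := g3 ha
        obtain ⟨f1', f2', f3'⟩ := g3' (h3 ▸ ha)
        refine ⟨by rw [g1, g1'], by rw [f1, f1', h3], by rw [f2, f2', h4], fun hy => ?_⟩
        rw [f1] at hy
        rw [f3, f3', h5 hy]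
    · obtain ⟨f0, f1, f2, f3⟩ := P.scan_succ_of_ne hm
      obtain ⟨f0', f1', f2', f3'⟩ := P.scan_succ_of_ne (hz ▸ hm)
      refine ⟨by rw [f0, f0', h2], by rw [f1, f1', h3], by rw [f2, f2', h4], fun hy => ?_⟩
      rw [f1] at hy
      rw [f3, f3', h5 hy]

lemma scan_of_no_match {β : ℕ → Bool} {t t' : ℕ} (htt : t ≤ t')
    (h : ∀ s, t < s → s ≤ t' → (P.scan β s).zc ≠ P.h) :
    (P.scan β t').tau = (P.scan β t).tau ∧ (P.scan β t').na = (P.scan β t).na ∧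
    (P.scan β t').cnt = (P.scan β t).cnt ∧ (P.scan β t').y = (P.scan β t).y := by
  induction t', htt using Nat.le_induction with
  | base => simp
  | succ s hs ih =>
    obtain ⟨h1, h2, h3, h4⟩ := ih (fun s' h1 h2 => h s' h1 (by omega))
    obtain ⟨g1, g2, g3, g4⟩ := P.scan_succ_of_ne (h (s + 1) (by omega) le_rfl)
    exact ⟨g1.trans h1, g2.trans h2, g3.trans h3, g4.trans h4⟩

lemma scan_marker_zc {β : ℕ → Bool} {t i : ℕ} (h0 : β t = true)
    (h1 : ∀ j, 0 < j → j ≤ i → β (t + j) = false) : (P.scan β (t + i + 1)).zc = i + 1 := by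
  induction i with
  | zero => rw [scan_zc]; simp [h0]
  | succ i ih =>
    rw [scan_zc, ← add_assoc, ih (fun j hj hj' => h1 j hj (by omega))]
    rw [add_assoc, h1 (i + 1) (by omega) le_rfl]
    simp

/-- After a marker. -/
lemma scan_marker {β : ℕ → Bool} {t : ℕ} (hh : 0 < P.h) (h0 : β t = true)
    (h1 : ∀ j, 0 < j → j < P.h → β (t + j) = false) :
    (P.scan β (t + P.h)).zc = P.h ∧ (P.scan β (t + P.h)).tau = t + P.h ∧
    ((P.scan β t).na ≤ t + P.h → (P.scan β (t + P.h)).na = t + P.h + P.R ∧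
      (P.scan β (t + P.h)).cnt = (P.scan β t).cnt + 1 ∧ (P.scan β (t + P.h)).y =
        Function.update (P.scan β t).y (P.scan β t).cnt (P.sym β (t + P.h))) ∧
    (¬ (P.scan β t).na ≤ t + P.h → (P.scan β (t + P.h)).na = (P.scan β t).na ∧
      (P.scan β (t + P.h)).cnt = (P.scan β t).cnt ∧ (P.scan β (t + P.h)).y = (P.scan β t).y) := by
  obtain ⟨g, hg⟩ : ∃ g, P.h = g + 1 := ⟨P.h - 1, by omega⟩
  have hz : (P.scan β (t + g + 1)).zc = P.h := by
    rw [P.scan_marker_zc h0 (fun j hj hj' => h1 j hj (by omega)), hg]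
  obtain ⟨e1, e2, e3, e4⟩ := P.scan_of_no_match (β := β) (t := t) (t' := t + g) (by omega) (by
    intro s hs hs'
    obtain ⟨i, rfl⟩ : ∃ i, s = t + i + 1 := ⟨s - t - 1, by omega⟩
    rw [P.scan_marker_zc h0 (fun j hj hj' => h1 j hj (by omega))]
    omega)
  obtain ⟨f1, f2, f3⟩ := P.scan_succ_of_eq hz
  rw [e2, e3, e4] at f2 f3
  rw [hg, ← add_assoc]
  exact ⟨by rw [hz, hg], f1, f2, f3⟩

/-- Symbols of the synchronization string are transmitted in unary, and decoded as sums of bits. -/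
lemma sum_range_lt (q σ : ℕ) (h : σ ≤ q) :
    ∑ c ∈ Finset.range q, (decide (c < σ)).toNat = σ := by
  have : ∀ c ∈ Finset.range q, (decide (c < σ)).toNat = if c < σ then 1 else 0 := by
    intro c _; by_cases hc : c < σ <;> simp [hc]
  rw [Finset.sum_congr rfl this, ← Finset.sum_filter, Finset.sum_const]
  have : (Finset.range q).filter (fun c => c < σ) = Finset.range σ := by
    ext c; simp; omega
  rw [this]; simp

/-- The received bits `w` end with the first `c + 1` bits of a block with the plain symbols `x`, and
there is no marker after the first one in this block. -/
structure InBlock (w : List Bool) (t c σ : ℕ) (x : ℕ → Bool) : Prop where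
  length : w.length = t + c + 1
  le : P.h ≤ c + 1
  lt : c < P.R
  one : w.getD t false = true
  zero : ∀ j, 0 < j → j < P.h → w.getD (t + j) false = false
  plain : ∀ o, P.h + P.h ≤ o → o ≤ c →
    w.getD (t + o) false = xor (x o) (w.getD (t + o - P.h) false)
  code : ∀ o < P.q, P.h + P.h + o ≤ c → x (P.h + P.h + o) = decide (o < σ)
  lucky : ∀ o, P.h ≤ o → o ≤ c → (P.scan (fun i => w.getD i false) (t + o + 1)).zc ≠ P.h

variable {P}

lemma InBlock.scan_eq {w : List Bool} {t c σ : ℕ} {x : ℕ → Bool} (hb : P.InBlock w t c σ x)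
    (hh : 0 < P.h) (hσ : σ ≤ P.q) : let β := fun i => w.getD i false
    (P.scan β w.length).tau = t + P.h ∧
    ((P.scan β t).na ≤ t + P.h → (P.scan β w.length).na = t + P.h + P.R ∧
      (P.scan β w.length).cnt = (P.scan β t).cnt + 1 ∧ (P.H ≤ c → (P.scan β w.length).y =
        Function.update (P.scan β t).y (P.scan β t).cnt σ)) ∧
    (¬ (P.scan β t).na ≤ t + P.h → (P.scan β w.length).na = (P.scan β t).na ∧
      (P.scan β w.length).cnt = (P.scan β t).cnt) := by
  intro β
  obtain ⟨h1, h2, h3, h4⟩ := P.scan_marker (β := β) hh hb.one hb.zero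
  have hle := hb.le
  obtain ⟨e1, e2, e3, e4⟩ := P.scan_of_no_match (β := β) (t := t + P.h) (t' := w.length)
    (by have := hb.length; omega) (by
      intro s hs hs'
      obtain ⟨o, rfl⟩ : ∃ o, s = t + o + 1 := ⟨s - t - 1, by omega⟩
      have := hb.length
      exact hb.lucky o (by omega) (by omega))
  rw [e1, e2, e3, e4]
  refine ⟨h2, fun h => ?_, fun h => ⟨(h4 h).1, (h4 h).2.1⟩⟩
  obtain ⟨g1, g2, g3⟩ := h3 h
  refine ⟨g1, g2, fun hc => ?_⟩
  rw [g3]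
  congr 1
  unfold sym
  -- Each unary digit is unmasked separately, by the bit received `h` positions before it.
  rw [← sum_range_lt P.q σ hσ]
  refine Finset.sum_congr rfl fun d hd => ?_
  rw [Finset.mem_range] at hd
  unfold H at hc
  have k1 := hb.code d hd (by omega)
  have k2 := hb.plain (P.h + P.h + d) (by omega) (by omega)
  have e1 : t + (P.h + P.h + d) = t + P.h + P.h + d := by omega
  have e2 : t + (P.h + P.h + d) - P.h = t + P.h + d := by omega
  rw [e2, e1, k1] at k2
  change (xor (β (t + P.h + P.h + d)) (β (t + P.h + d))).toNat = _
  have k3 : β (t + P.h + P.h + d) = xor (decide (d < σ)) (β (t + P.h + d)) := k2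
  rw [k3]
  cases β (t + P.h + d) <;> simp

/-- What is decoded inside of a block. -/
lemma InBlock.dec_eq {w : List Bool} {t c σ : ℕ} {x : ℕ → Bool} (hb : P.InBlock w t c σ x)
    (hh : 0 < P.h) (hσ : σ ≤ P.q) : let s := P.scan (fun i => w.getD i false) t
    let g := argmin (cost P.S (Function.update s.y s.cnt σ) (s.cnt + 1)) P.n
    P.dec w = if s.na ≤ t + P.h ∧ P.H ≤ c ∧ 0 < g ∧ (g - 1) * P.dl + (c - P.H) < P.D then
      some ((g - 1) * P.dl + (c - P.H), x c) else none := by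
  intro s g
  obtain ⟨h1, h2, h3⟩ := hb.scan_eq hh hσ
  have hlen := hb.length
  have hle := hb.le
  have hlt := hb.lt
  have hu : w.length - (t + P.h) = c + 1 - P.h := by omega
  unfold dec
  dsimp only
  rw [h1, hu]
  by_cases ha : s.na ≤ t + P.h
  · obtain ⟨g1, g2, g3⟩ := h2 ha
    by_cases hc : P.H ≤ c
    · have hg : P.guess (P.scan (fun i => w.getD i false) w.length) = g := by
        unfold guess; rw [g2, g3 hc]
      have hi : c + 1 - P.h - (P.h + P.q + 1) = c - P.H := by unfold H; omega
      have hH : P.H = P.h + P.h + P.q := rfl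
      rw [hg, hi, g1]
      have hiff : (t + P.h + P.R = t + P.h + P.R ∧ 0 < g ∧ P.h + P.q + 1 ≤ c + 1 - P.h ∧
          c + 1 - P.h + P.h ≤ P.R ∧ (g - 1) * P.dl + (c - P.H) < P.D) ↔
          (s.na ≤ t + P.h ∧ P.H ≤ c ∧ 0 < g ∧ (g - 1) * P.dl + (c - P.H) < P.D) := by
        constructor
        · rintro ⟨-, a, -, -, b⟩; exact ⟨ha, hc, a, b⟩
        · rintro ⟨-, -, a, b⟩; exact ⟨rfl, a, by omega, by omega, b⟩
      rw [if_congr hiff rfl rfl]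
      congr 3
      have k1 := hb.plain c (by omega) le_rfl
      have e1 : w.length - 1 = t + c := by omega
      rw [e1, k1]
      cases w.getD (t + c - P.h) false <;> simp
    · rw [if_neg, if_neg (fun h => hc h.2.1)]
      rintro ⟨-, -, h, -⟩
      apply hc; unfold H; omega
  · obtain ⟨g1, g2⟩ := h3 ha
    have hr : ¬ (s.na ≤ t + P.h ∧ P.H ≤ c ∧ 0 < g ∧ (g - 1) * P.dl + (c - P.H) < P.D) :=
      fun h => ha h.1
    rw [if_neg hr, if_neg]
    rintro ⟨h, -⟩
    rw [g1] at h
    -- A refused marker is never used for decoding: this would need `na = t + h + R`, but `na`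
    -- cannot exceed `t + R`.
    have := P.scan_na_le (fun i => w.getD i false) t
    change s.na ≤ _ at this
    change s.na = _ at h
    omega

/-- Within a block without a false marker, what is decoded does not depend on the mask. -/
lemma InBlock.dec_congr {w w' : List Bool} {t c σ : ℕ} {x x' : ℕ → Bool}
    (hb : P.InBlock w t c σ x) (hb' : P.InBlock w' t c σ x') (hh : 0 < P.h) (hσ : σ ≤ P.q)
    (hH : P.H ≤ P.R) (hx : x c = x' c) (hw : ∀ i < t, w.getD i false = w'.getD i false) :
    P.dec w = P.dec w' := by
  rw [hb.dec_eq hh hσ, hb'.dec_eq hh hσ]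
  obtain ⟨-, -, h3, h4, h5⟩ := P.scan_congr hw (le_refl t)
  rw [← h3, ← h4, hx]
  by_cases ha : (P.scan (fun i => w.getD i false) t).na ≤ t + P.h
  -- Acceptance means `na ≤ t + h`, and the header fits into `R`; so the symbols recorded before the
  -- block have been read completely from the common bits.
  · rw [h5 (by unfold H at hH; omega)]
  · rw [if_neg (fun h => ha h.1), if_neg (fun h => ha h.1)]

end scan
end Par
end IndelSim

namespace IndelSim
namespace Par

/-! ### The transcript of the scheme -/

section transcript

variable (P : Par) (ω : ℕ → Bool) (users : Users) (adv : Adversary)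

def rev : Party → List Bool → List Bool
  | .alice => P.revA
  | .bob => P.revB

def out : Party → List Bool → Bool
  | .alice => P.outA ω users
  | .bob => P.outB users

/-- The state when Alice's intermediary is about to send the symbol at position `p`. -/
def rd (p : ℕ) : Talk :=
  round P.e adv (fun p => viewOf P.N users p (P.rev p)) (P.out ω users) p

/-- What Alice's intermediary has received before position `p`. -/
def recA (p : ℕ) : List Bool := (P.rd ω users adv p).received .alice
/-- What Bob's intermediary has received before position `p`. -/
def recB (p : ℕ) : List Bool := (P.rd ω users adv p).received .bob
def ed (p : ℕ) : ℕ := (P.rd ω users adv p).edits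

/-- The symbol sent at position `p`. -/
def sent (p : ℕ) : Bool := P.outA ω users (P.recA ω users adv p)
/-- The symbol sent at position `p` under the mask. -/
def pl (p : ℕ) : Bool :=
  P.plain (fun i => users .alice ((P.revA (P.recA ω users adv p)).take i)) p

/-- The block number `k` is transmitted without edits. -/
def Clean (k : ℕ) : Prop := P.ed ω users adv ((k + 1) * P.R) = P.ed ω users adv (k * P.R)

/-- The number of bits received by Bob's intermediary before the block number `k`. -/
def bt (k : ℕ) : ℕ := (P.recB ω users adv (k * P.R)).length

/-- A marker ends with the bit received after `o` further bits of the block number `k`. -/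
def Match (k o : ℕ) : Prop :=
  (P.scan (fun i => (P.recB ω users adv ((k + 1) * P.R)).getD i false)
    (P.bt ω users adv k + o + 1)).zc = P.h

/-- There is a second marker in the block number `k` although this block is transmitted without
edits. -/
def Unlucky (k : ℕ) : Prop :=
  P.Clean ω users adv k ∧ ∃ o, P.h ≤ o ∧ o < P.R ∧ P.Match ω users adv k o

structure Valid : Prop where
  h_pos : 0 < P.h
  H_lt : P.H < P.R
  S_le : ∀ k, P.S k ≤ P.q

variable {P ω users adv}

lemma recA_length (p : ℕ) : (P.recA ω users adv p).length = p := (round_spec p).2.1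

lemma ed_le (p : ℕ) : P.ed ω users adv p ≤ P.e := (round_spec p).2.2.1

lemma ed_mono : Monotone (P.ed ω users adv) :=
  monotone_nat_of_le_succ fun p => (round_spec p).2.2.2.edits_le

lemma recA_prefix {a b : ℕ} (h : a ≤ b) : P.recA ω users adv a <+: P.recA ω users adv b :=
  round_received_prefix .alice h

lemma recB_prefix {a b : ℕ} (h : a ≤ b) : P.recB ω users adv a <+: P.recB ω users adv b :=
  round_received_prefix .bob h

lemma recB_length_le {a b : ℕ} (h : a ≤ b) : (P.recB ω users adv b).length + P.ed ω users adv a ≤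
    (P.recB ω users adv a).length + (b - a) + P.ed ω users adv b := by
  induction b, h using Nat.le_induction with
  | base => omega
  | succ b hb ih =>
    have : (P.recB ω users adv (b + 1)).length + P.ed ω users adv b ≤
      (P.recB ω users adv b).length + 1 + P.ed ω users adv (b + 1) := (round_spec b).2.2.2.length
    omega

lemma recB_length_le_add (p : ℕ) : (P.recB ω users adv p).length ≤ p + P.ed ω users adv p := by
  have h := recB_length_le (P := P) (ω := ω) (users := users) (adv := adv) (Nat.zero_le p)
  have h0 : (P.recB ω users adv 0).length = 0 := rfl
  omega

lemma getD_of_prefix {u v : List Bool} (h : u <+: v) {i : ℕ} (hi : i < u.length) :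
    v.getD i false = u.getD i false := by
  obtain ⟨t, rfl⟩ := h
  simp [List.getD_eq_getElem?_getD, List.getElem?_append_left hi]

lemma revA_prefix {u v : List Bool} (h : u <+: v) : P.revA u <+: P.revA v := by
  obtain ⟨t, rfl⟩ := h
  induction t using List.reverseRecOn with
  | nil => simp
  | append_singleton t b ih =>
    rw [← List.append_assoc, revA_append]
    exact ih.trans (List.prefix_append _ _)

lemma revB_prefix {u v : List Bool} (h : u <+: v) : P.revB u <+: P.revB v := by
  obtain ⟨t, rfl⟩ := h
  induction t using List.reverseRecOn with
  | nil => simp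
  | append_singleton t b ih =>
    rw [← List.append_assoc, revB_append]
    exact ih.trans (List.prefix_append _ _)

/-- The recursion of `bit` in terms of the transcript. The symbol sent `h` positions earlier was
computed from fewer revealed symbols, but by causality the later knowledge gives the same value. -/
lemma sent_eq (hP : P.Valid) (p : ℕ) : P.sent ω users adv p =
    if p % P.R < P.h then decide (p % P.R = 0)
    else if p % P.R < P.h + P.h then ω p
    else xor (P.pl ω users adv p) (P.sent ω users adv (p - P.h)) := by
  have hh := hP.h_pos
  unfold sent outA
  rw [recA_length, recA_length, bit]
  have h0 : ¬ P.h = 0 := by omega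
  simp only [h0, or_false]
  split_ifs with h1 h2
  · rfl
  · rfl
  · unfold pl
    congr 1
    refine P.bit_congr _ (fun _ _ => rfl) fun i hi hd => ?_
    have hpre := revA_prefix (P := P) (recA_prefix (P := P) (ω := ω) (users := users) (adv := adv)
      (Nat.sub_le p P.h))
    have hle : P.idx i ≤ (P.revA (P.recA ω users adv (p - P.h))).length := by
      rw [P.revA_length hP.H_lt, recA_length]
      have h3 := P.count_data hP.H_lt i
      have h4 := P.count_data hP.H_lt (p - P.h)
      have h5 : ((List.range i).filter fun p => P.IsData p).length ≤
          ((List.range (p - P.h)).filter fun p => P.IsData p).length := by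
        apply List.Sublist.length_le
        apply List.Sublist.filter
        exact List.range_sublist.mpr hi
      have := hd.2
      omega
    obtain ⟨t, ht⟩ := hpre
    rw [← ht, List.take_append_of_le_length hle]

lemma clean_ed {k : ℕ} (hc : P.Clean ω users adv k) {o : ℕ} (ho : o ≤ P.R) :
    P.ed ω users adv (k * P.R + o) = P.ed ω users adv (k * P.R) := by
  have h1 : P.ed ω users adv (k * P.R) ≤ P.ed ω users adv (k * P.R + o) := ed_mono (by omega)
  have h2 : P.ed ω users adv (k * P.R + o) ≤ P.ed ω users adv ((k + 1) * P.R) :=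
    ed_mono (by rw [Nat.add_mul, Nat.one_mul]; omega)
  unfold Clean at hc
  omega

lemma clean_step {k : ℕ} (hc : P.Clean ω users adv k) {o : ℕ} (ho : o < P.R) :
    P.recB ω users adv (k * P.R + o + 1) =
      P.recB ω users adv (k * P.R + o) ++ [P.sent ω users adv (k * P.R + o)] ∧
    P.recA ω users adv (k * P.R + o + 1) = P.recA ω users adv (k * P.R + o) ++
      [P.outB users (P.recB ω users adv (k * P.R + o + 1))] := by
  have h1 := clean_ed hc (o := o) (by omega)
  have h2 := clean_ed hc (o := o + 1) (by omega)
  have h3 : P.ed ω users adv (k * P.R + o + 1) = P.ed ω users adv (k * P.R + o) := by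
    rw [h1]; exact h2
  have hs := (round_spec (e := P.e) (adv := adv) (view := fun p => viewOf P.N users p (P.rev p))
    (out := P.out ω users) (k * P.R + o)).2.2.2
  obtain ⟨y, hy, hy'⟩ := hs.alice
  refine ⟨hs.bob_clean h3, ?_⟩
  have := hy' h3
  rw [this] at hy
  exact hy

lemma clean_length {k : ℕ} (hc : P.Clean ω users adv k) {o : ℕ} (ho : o ≤ P.R) :
    (P.recB ω users adv (k * P.R + o)).length = P.bt ω users adv k + o := by
  induction o with
  | zero => rfl
  | succ o ih =>
    rw [← add_assoc, (clean_step hc (by omega)).1, List.length_append, ih (by omega)]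
    rfl

lemma clean_getD {k : ℕ} (hc : P.Clean ω users adv k) {o o' : ℕ} (ho' : o' < o) (ho : o ≤ P.R) :
    (P.recB ω users adv (k * P.R + o)).getD (P.bt ω users adv k + o') false =
      P.sent ω users adv (k * P.R + o') := by
  have h1 : P.recB ω users adv (k * P.R + o' + 1) <+: P.recB ω users adv (k * P.R + o) :=
    recB_prefix (by omega)
  have h2 := clean_length hc (o := o') (by omega)
  have h3 := clean_length hc (o := o' + 1) (by omega)
  rw [← add_assoc] at h3
  rw [getD_of_prefix h1 (by omega), (clean_step hc (by omega)).1, ← h2]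
  simp

lemma recB_getD {a b i : ℕ} (h : a ≤ b) (hi : i < (P.recB ω users adv a).length) :
    (P.recB ω users adv b).getD i false = (P.recB ω users adv a).getD i false :=
  getD_of_prefix (recB_prefix h) hi

lemma match_iff {k : ℕ} (hc : P.Clean ω users adv k) {o o' : ℕ} (ho' : o' < o) (ho : o ≤ P.R) :
    P.Match ω users adv k o' ↔ (P.scan (fun i => (P.recB ω users adv (k * P.R + o)).getD i false)
      (P.bt ω users adv k + o' + 1)).zc = P.h := by
  have h3 := clean_length hc ho
  unfold Match
  rw [(P.scan_congr (T := (P.recB ω users adv (k * P.R + o)).length)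
    (fun i hi => recB_getD (by rw [Nat.add_mul, Nat.one_mul]; omega) hi) (by omega)).1]

lemma block_mod {k o : ℕ} (ho : o < P.R) : (k * P.R + o) % P.R = o := by
  rw [Nat.add_comm, Nat.add_mul_mod_self_right, Nat.mod_eq_of_lt ho]

lemma block_div {k o : ℕ} (ho : o < P.R) : (k * P.R + o) / P.R = k := by
  rw [Nat.add_comm, Nat.add_mul_div_right _ _ (by omega), Nat.div_eq_of_lt ho, Nat.zero_add]

lemma inBlock (hP : P.Valid) {k : ℕ} (hc : P.Clean ω users adv k) {o : ℕ} (ho : o < P.R)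
    (hho : P.h ≤ o + 1) (hm : ∀ o', P.h ≤ o' → o' ≤ o → ¬ P.Match ω users adv k o') :
    P.InBlock (P.recB ω users adv (k * P.R + o + 1)) (P.bt ω users adv k) o (P.S k)
      (fun o => P.pl ω users adv (k * P.R + o)) where
  length := clean_length hc (o := o + 1) (by omega)
  le := hho
  lt := ho
  one := by
    have := clean_getD hc (o := o + 1) (o' := 0) (by omega) (by omega)
    rw [add_zero, add_zero, ← add_assoc] at this
    have hR : 0 < P.R := by omega
    have hh := hP.h_pos
    rw [this, sent_eq hP]
    simp [hh]
  zero j hj hj' := by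
    have := clean_getD hc (o := o + 1) (o' := j) (by omega) (by omega)
    rw [← add_assoc] at this
    rw [this, sent_eq hP, block_mod (by omega), if_pos hj']
    simp; omega
  plain o' h1 h2 := by
    have e1 := clean_getD hc (o := o + 1) (o' := o') (by omega) (by omega)
    have e2 := clean_getD hc (o := o + 1) (o' := o' - P.h) (by omega) (by omega)
    rw [← add_assoc] at e1 e2
    have hh := hP.h_pos
    have e3 : P.bt ω users adv k + o' - P.h = P.bt ω users adv k + (o' - P.h) := by omega
    have e4 : k * P.R + o' - P.h = k * P.R + (o' - P.h) := by omega
    rw [e3, e1, e2, sent_eq hP, block_mod (by omega), if_neg (by omega), if_neg (by omega), e4]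
  code o' h1 h2 := by
    unfold pl plain H
    rw [block_mod (by omega), block_div (by omega), if_pos (by omega), Nat.add_sub_cancel_left]
  lucky o' h1 h2 := by
    have := hm o' h1 h2
    rw [match_iff hc (o := o + 1) (by omega) (by omega)] at this
    exact this

/-- The counter is read backwards: its value fixes as many of the last bits. This is what makes a
false marker reveal the mask in `mask_unique`. -/
lemma zc_window {β : ℕ → Bool} {t z : ℕ} (hz : (P.scan β (t + 1)).zc = z + 1) :
    z ≤ t ∧ β (t - z) = true ∧ ∀ i, i < z → β (t - i) = false := by
  induction z generalizing t with
  | zero =>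
    rw [scan_zc] at hz
    refine ⟨Nat.zero_le _, ?_, fun i hi => by omega⟩
    by_contra h
    rw [Nat.sub_zero] at h
    rw [if_neg h] at hz
    split_ifs at hz; omega
  | succ z ih =>
    rw [scan_zc] at hz
    have h0 : ¬ β t = true := by intro h; rw [if_pos h] at hz; omega
    rw [if_neg h0] at hz
    split_ifs at hz
    cases t with
    | zero => simp [scan] at hz
    | succ t =>
      obtain ⟨h1, h2, h3⟩ := ih (t := t) (by omega)
      refine ⟨by omega, by rw [← h2]; congr 1; omega, fun i hi => ?_⟩
      cases i with
      | zero => simpa using h0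
      | succ i => rw [← h3 i (by omega)]; congr 1; omega

lemma goal_congr {w w' : List Bool} (hl : w.length = w'.length) (hd : P.dec w = P.dec w') :
    P.goal w = P.goal w' := by
  unfold goal; rw [hl, hd]

lemma revB_congr {w w' : List Bool} {b b' : Bool} (hl : w.length = w'.length)
    (hd : P.dec (w ++ [b]) = P.dec (w' ++ [b'])) (hr : P.revB w = P.revB w') :
    P.revB (w ++ [b]) = P.revB (w' ++ [b']) := by
  rw [revB_append, revB_append, hr, hd, goal_congr (by simp [hl]) hd]

/-- Two executions that agree before the block number `k`, with the first false marker in this block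
at the same place, have the same mask in this block. -/
lemma mask_unique (hP : P.Valid) {ω' : ℕ → Bool} {k : ℕ} (hω : ∀ i < k * P.R, ω i = ω' i)
    (hc : P.Clean ω users adv k) (hc' : P.Clean ω' users adv k) {o : ℕ} (hho : P.h ≤ o)
    (ho : o < P.R) (hm : P.Match ω users adv k o) (hm' : P.Match ω' users adv k o)
    (hn : ∀ o', P.h ≤ o' → o' < o → ¬ P.Match ω users adv k o')
    (hn' : ∀ o', P.h ≤ o' → o' < o → ¬ P.Match ω' users adv k o') :
    ∀ i, P.h ≤ i → i < P.h + P.h → ω (k * P.R + i) = ω' (k * P.R + i) := by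
  have hh := hP.h_pos
  have hrd : P.rd ω users adv (k * P.R) = P.rd ω' users adv (k * P.R) := by
    unfold rd
    refine round_congr (out := P.out ω users) (out' := P.out ω' users) rfl _ fun w hw => ?_
    exact P.bit_congr _ (fun i hi => hω i (by omega)) (fun _ _ _ => rfl)
  have hbt : P.bt ω users adv k = P.bt ω' users adv k := by
    unfold bt recB; rw [hrd]
  -- the marker
  have hB : ∀ o', o' ≤ P.h →
      P.recB ω users adv (k * P.R + o') = P.recB ω' users adv (k * P.R + o') := by
    intro o'
    induction o' with
    | zero => intro _; unfold recB; rw [add_zero, hrd]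
    | succ o' ih =>
      intro h
      rw [← add_assoc, (clean_step hc (by omega)).1, (clean_step hc' (by omega)).1, ih (by omega),
        sent_eq (ω := ω) hP, sent_eq (ω := ω') hP, block_mod (by omega), if_pos (by omega),
          if_pos (by omega)]
  have hpl : ∀ {o'}, P.recA ω users adv (k * P.R + o') = P.recA ω' users adv (k * P.R + o') →
      P.pl ω users adv (k * P.R + o') = P.pl ω' users adv (k * P.R + o') := by
    intro o' h; unfold pl; rw [h]
  -- Before the false marker Bob's end decodes and answers the same in both executions. So Alice's
  -- end receives the same, and the symbols under the mask coincide although the masks may differ.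
  have key : ∀ o', o' ≤ o →
      P.recA ω users adv (k * P.R + o') = P.recA ω' users adv (k * P.R + o') ∧
      P.revB (P.recB ω users adv (k * P.R + o')) = P.revB (P.recB ω' users adv (k * P.R + o')) := by
    intro o'
    induction o' with
    | zero => intro _; unfold recA recB; rw [add_zero, hrd]; exact ⟨rfl, rfl⟩
    | succ o' ih =>
      intro h
      obtain ⟨h1, h2⟩ := ih (by omega)
      obtain ⟨s1, s2⟩ := clean_step hc (o := o') (by omega)
      obtain ⟨s1', s2'⟩ := clean_step hc' (o := o') (by omega)
      have hlen : (P.recB ω users adv (k * P.R + o')).length =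
          (P.recB ω' users adv (k * P.R + o')).length := by
        rw [clean_length hc (by omega), clean_length hc' (by omega), hbt]
      have hdec : P.dec (P.recB ω users adv (k * P.R + o' + 1)) =
          P.dec (P.recB ω' users adv (k * P.R + o' + 1)) := by
        by_cases hlt : o' + 1 ≤ P.h
        · have := hB (o' + 1) hlt
          rw [← add_assoc] at this
          rw [this]
        · have i1 := inBlock hP hc (o := o') (by omega) (by omega)
            (fun o'' a b => hn o'' a (by omega))
          have i2 := inBlock hP hc' (o := o') (by omega) (by omega)
            (fun o'' a b => hn' o'' a (by omega))
          rw [← hbt] at i2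
          refine i1.dec_congr i2 hh (hP.S_le k) hP.H_lt.le (hpl h1) fun i hi => ?_
          have e1 : (P.recB ω users adv (k * P.R)).length = P.bt ω users adv k := rfl
          have e2 : (P.recB ω' users adv (k * P.R)).length = P.bt ω' users adv k := rfl
          rw [recB_getD (a := k * P.R) (by omega) (by omega),
            recB_getD (P := P) (ω := ω') (a := k * P.R) (by omega) (by omega)]
          unfold recB; rw [hrd]
      have hrev : P.revB (P.recB ω users adv (k * P.R + o' + 1)) =
          P.revB (P.recB ω' users adv (k * P.R + o' + 1)) := by
        rw [s1, s1'] at hdec ⊢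
        exact revB_congr hlen hdec h2
      rw [← add_assoc]
      refine ⟨?_, hrev⟩
      rw [s2, s2', h1]
      congr 2
      unfold outB
      rw [hdec, hrev]
      have d1 : (P.recB ω users adv (k * P.R + o' + 1)).dropLast =
          P.recB ω users adv (k * P.R + o') := by rw [s1, List.dropLast_concat]
      have d2 : (P.recB ω' users adv (k * P.R + o' + 1)).dropLast =
          P.recB ω' users adv (k * P.R + o') := by rw [s1', List.dropLast_concat]
      rw [d1, d2, h2]
  -- the false marker
  have win : ∀ {ω : ℕ → Bool}, P.Clean ω users adv k → P.Match ω users adv k o →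
      P.h + P.h ≤ o + 1 ∧ ∀ i < P.h, P.sent ω users adv (k * P.R + (o - i)) = decide
        (i = P.h - 1) := by
    intro ω hc hm
    rw [match_iff hc (o := o + 1) (by omega) (by omega)] at hm
    have hm2 : (P.scan (fun i => (P.recB ω users adv (k * P.R + (o + 1))).getD i false)
        (P.bt ω users adv k + o + 1)).zc = (P.h - 1) + 1 := by rw [hm]; omega
    obtain ⟨w1, w2, w3⟩ := zc_window hm2
    have hs : ∀ i < P.h, P.sent ω users adv (k * P.R + (o - i)) = decide (i = P.h - 1) := by
      intro i hi
      have e0 := clean_getD hc (o := o + 1) (o' := o - i) (by omega) (by omega)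
      have e1 : P.bt ω users adv k + (o - i) = P.bt ω users adv k + o - i := by omega
      rw [e1] at e0
      rw [← e0]
      by_cases h : i = P.h - 1
      · subst h; simpa using w2
      · have := w3 i (by omega); simp only [this]; simp [h]
    refine ⟨?_, hs⟩
    -- Otherwise the pattern would begin inside of the true marker, whose only `1` is its first bit,
    -- and so it would end too early.
    by_contra hcon
    have h1 := hs (P.h - 1) (by omega)
    rw [sent_eq hP, block_mod (by omega), if_pos (by omega)] at h1
    simp at h1
    omega
  obtain ⟨w1, w2⟩ := win hc hm
  obtain ⟨w1', w2'⟩ := win hc' hm'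
  -- The last `h` sent symbols show the pattern of the marker in both executions. Any earlier one is
  -- recovered from the symbol sent `h` positions later by removing the common plain symbol.
  have hsent : ∀ d c, c + d = o → P.h ≤ c →
      P.sent ω users adv (k * P.R + c) = P.sent ω' users adv (k * P.R + c) := by
    intro d
    induction d using Nat.strong_induction_on with
    | _ d ih =>
      intro c hcd hhc
      by_cases hd : d < P.h
      · obtain rfl : c = o - d := by omega
        rw [w2 d hd, w2' d hd]
      · have h1 := ih (d - P.h) (by omega) (c + P.h) (by omega) (by omega)
        have h2 := hpl (key (c + P.h) (by omega)).1
        rw [sent_eq (ω := ω) hP, sent_eq (ω := ω') hP, block_mod (by omega), if_neg (by omega),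
          if_neg (by omega),
          if_neg (by omega), if_neg (by omega), h2] at h1
        have e : k * P.R + (c + P.h) - P.h = k * P.R + c := by omega
        rw [e] at h1
        exact Bool.xor_right_inj.mp h1
  intro i hi hi'
  have := hsent (o - i) i (by omega) hi
  rw [sent_eq (ω := ω) hP, sent_eq (ω := ω') hP, block_mod (by omega)] at this
  simpa only [if_neg (show ¬ i < P.h by omega), if_pos hi'] using this

end transcript
end Par
end IndelSim

namespace IndelSim
namespace Par

/-! ### Decoding -/

section decoding

variable {P : Par} {ω : ℕ → Bool} {users : Users} {adv : Adversary}

lemma scan_prefix {u v : List Bool} (h : u <+: v) :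
    let s := P.scan (fun i => v.getD i false) u.length
    let s' := P.scan (fun i => u.getD i false) u.length
    s.zc = s'.zc ∧ s.tau = s'.tau ∧ s.na = s'.na ∧ s.cnt = s'.cnt ∧
      (s.na + P.h + P.q ≤ u.length + P.R → s.y = s'.y) :=
  P.scan_congr (fun _ hi => getD_of_prefix h hi) le_rfl

lemma scan_y_stable {β : ℕ → Bool} {t t' : ℕ} (h : t ≤ t') {j : ℕ} (hj : j < (P.scan β t).cnt) :
    (P.scan β t').y j = (P.scan β t).y j := by
  induction t', h using Nat.le_induction with
  | base => rfl
  | succ s hs ih =>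
    have hm : (P.scan β t).cnt ≤ (P.scan β s).cnt := P.scan_cnt_mono β hs
    by_cases h : (P.scan β (s + 1)).zc = P.h
    · obtain ⟨-, h1, h2⟩ := P.scan_succ_of_eq h
      by_cases h3 : (P.scan β s).na ≤ s + 1
      · rw [(h1 h3).2.2, Function.update_of_ne (by omega), ih]
      · rw [(h2 h3).2.2, ih]
    · rw [(P.scan_succ_of_ne h).2.2.2, ih]

variable (P) in
/-- What Bob's intermediary knows after it has received `w`. -/
def know (w : List Bool) : Scan := P.scan (fun i => w.getD i false) w.length

lemma know_cnt_mono {u v : List Bool} (h : u <+: v) : (P.know u).cnt ≤ (P.know v).cnt := by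
  unfold know
  rw [← (P.scan_prefix h).2.2.2.1]
  exact P.scan_cnt_mono _ h.length_le

variable (P ω users adv)

/-- The number of markers accepted before the block number `k`. -/
def W (k : ℕ) : ℕ := (P.know (P.recB ω users adv (k * P.R))).cnt

def Good (k : ℕ) : Prop := P.Clean ω users adv k ∧ ¬ P.Unlucky ω users adv k

/-- The block number `k` is good, and its marker is accepted. -/
def Acc (k : ℕ) : Prop := P.Good ω users adv k ∧
  (P.know (P.recB ω users adv (k * P.R))).na ≤ P.bt ω users adv k + P.h

/-- Block number `x` is at the end of a stretch of blocks with many defects. -/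
def Bad (ε : ℝ) (x : ℕ) : Prop := ∃ κ ≤ x, ((x + 1 : ℕ) : ℝ) - κ ≤ 3 / (1 - ε) *
  (∑ i ∈ Finset.Ico κ (x + 1), defect (P.W ω users adv) (P.Acc ω users adv) i : ℕ)

variable {P ω users adv}

lemma Good.inBlock (hP : P.Valid) {k : ℕ} (hg : P.Good ω users adv k) {c : ℕ} (hc : c < P.R)
    (hhc : P.h ≤ c + 1) : P.InBlock (P.recB ω users adv (k * P.R + c + 1)) (P.bt ω users adv k) c
      (P.S k) (fun o => P.pl ω users adv (k * P.R + o)) :=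
  Par.inBlock hP hg.1 hc hhc fun o h1 h2 hm => hg.2 ⟨hg.1, o, h1, by omega, hm⟩

lemma Good.know (hP : P.Valid) {k : ℕ} (hg : P.Good ω users adv k) {c : ℕ} (hc : c < P.R)
    (hhc : P.h ≤ c + 1) :
    (P.Acc ω users adv k →
      (P.know (P.recB ω users adv (k * P.R + c + 1))).na = P.bt ω users adv k + P.h + P.R ∧
      (P.know (P.recB ω users adv (k * P.R + c + 1))).cnt = P.W ω users adv k + 1 ∧
      (P.H ≤ c → (P.know (P.recB ω users adv (k * P.R + c + 1))).y (P.W ω users adv k) = P.S k)) ∧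
    (¬ P.Acc ω users adv k →
      (P.know (P.recB ω users adv (k * P.R + c + 1))).na =
        (P.know (P.recB ω users adv (k * P.R))).na ∧
      (P.know (P.recB ω users adv (k * P.R + c + 1))).cnt = P.W ω users adv k) := by
  obtain ⟨h1, h2, h3⟩ := (hg.inBlock hP hc hhc).scan_eq hP.h_pos (hP.S_le k)
  have hpre : P.recB ω users adv (k * P.R) <+: P.recB ω users adv (k * P.R + c + 1) :=
    recB_prefix (by omega)
  obtain ⟨-, -, e3, e4, -⟩ := P.scan_prefix hpre
  have hbt : (P.recB ω users adv (k * P.R)).length = P.bt ω users adv k := rfl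
  rw [hbt] at e3 e4
  have e3' : (P.scan (fun i => (P.recB ω users adv (k * P.R + c + 1)).getD i false)
    (P.bt ω users adv k)).na = (P.know (P.recB ω users adv (k * P.R))).na := e3
  have e4' : (P.scan (fun i => (P.recB ω users adv (k * P.R + c + 1)).getD i false)
    (P.bt ω users adv k)).cnt = P.W ω users adv k := e4
  rw [e3', e4'] at h2 h3
  constructor
  · intro ha
    obtain ⟨g1, g2, g3⟩ := h2 ha.2
    refine ⟨g1, g2, fun hH => ?_⟩
    unfold Par.know
    rw [g3 hH, Function.update_self]
  · intro ha
    exact h3 fun h => ha ⟨hg, h⟩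

lemma succ_block (hP : P.Valid) (k : ℕ) : k * P.R + (P.R - 1) + 1 = (k + 1) * P.R := by
  have := hP.H_lt
  rw [Nat.add_mul]; omega

lemma W_zero : P.W ω users adv 0 = 0 := by
  unfold W know
  rw [Nat.zero_mul]
  rfl

lemma W_mono : Monotone (P.W ω users adv) := fun _ _ h =>
  know_cnt_mono (recB_prefix (Nat.mul_le_mul_right _ h))

lemma Acc.W_succ (hP : P.Valid) {k : ℕ} (ha : P.Acc ω users adv k) :
    P.W ω users adv (k + 1) = P.W ω users adv k + 1 := by
  have hH := hP.H_lt
  have := ((ha.1.know hP (c := P.R - 1) (by omega) (by unfold H at hH; omega)).1 ha).2.1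
  rwa [succ_block hP] at this

/-- The bits from which the symbol is read lie within the block, so once the block is complete the
recorded symbol is correct and final. -/
lemma Acc.symbol (hP : P.Valid) {k : ℕ} (ha : P.Acc ω users adv k) {w : List Bool}
    (hw : P.recB ω users adv ((k + 1) * P.R) <+: w) : (P.know w).y (P.W ω users adv k) = P.S k := by
  have hH := hP.H_lt
  obtain ⟨h1, h2, h3⟩ := (ha.1.know hP (c := P.R - 1) (by omega) (by unfold H at hH; omega)).1 ha
  rw [succ_block hP] at h1 h2 h3
  rw [← h3 (by omega)]
  have hlen := clean_length ha.1.1 (o := P.R) le_rfl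
  have e : k * P.R + P.R = (k + 1) * P.R := by rw [Nat.add_mul, Nat.one_mul]
  rw [e] at hlen
  obtain ⟨-, -, e3, e4, e5⟩ := P.scan_prefix hw
  unfold know
  rw [scan_y_stable hw.length_le, e5]
  · rw [e3]
    change (P.know _).na + _ + _ ≤ _
    rw [h1, hlen]; unfold H at hH; omega
  · rw [e4]
    change _ < (P.know _).cnt
    rw [h2]; omega

lemma truth (hP : P.Valid) {K : ℕ} {w : List Bool} (hw : P.recB ω users adv (K * P.R) <+: w) :
    Truth P.S (P.know w).y (P.W ω users adv) (P.Acc ω users adv) K where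
  zero := W_zero
  mono := W_mono
  acc _ hk ha := ⟨ha.W_succ hP, (ha.symbol hP
    ((recB_prefix (Nat.mul_le_mul_right _ hk)).trans hw)).symm⟩

/-- By `guess_bound`, a guess beyond `x` with `κ ≤ x` exhibits a stretch that makes `x` bad. If `κ =
x + 1`, there is no defect left to pay for any deviation, and the guess is exact. Surplus markers of
a block in progress are charged to the defects of the blocks from `K` to `x`. -/
lemma guess_of_not_bad {ε : ℝ} (hε : ε < 1) (hS : ∀ lo hi M, lo ≤ hi → hi ≤ P.n →
      SelfMatching P.S lo hi M → (M.length : ℝ) ≤ ε * ((hi : ℝ) - lo))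
    {x K : ℕ} (hx : ¬ P.Bad ω users adv ε x) (hK : K ≤ x + 1) (hn : x + 1 ≤ P.n) {s : Scan}
    (ht : Truth P.S s.y (P.W ω users adv) (P.Acc ω users adv) K) (hw : P.W ω users adv K ≤ s.cnt)
    (hd : s.cnt - P.W ω users adv K ≤
      ∑ i ∈ Finset.Ico K (x + 1), defect (P.W ω users adv) (P.Acc ω users adv) i) :
    P.guess s ≤ x ∨ K = x + 1 ∧ P.guess s = x + 1 := by
  obtain ⟨g1, g2⟩ := argmin_le (cost P.S s.y s.cnt) P.n
  obtain ⟨κ, h1, h2, h3⟩ := guess_bound (ε := ε) ht hw (g2 K (by omega))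
    (fun lo M hlo hM => hS lo _ M hlo (max_le (by omega) g1) hM)
  change κ ≤ P.guess s at h2
  change (1 - ε) * ((max K (P.guess s) : ℕ) - (κ : ℝ)) ≤ _ at h3
  have hε' : 0 < 1 - ε := by linarith
  by_cases hκ : κ ≤ x
  · left
    by_contra hg
    refine hx ⟨κ, hκ, ?_⟩
    rw [div_mul_eq_mul_div, le_div_iff₀ hε']
    have h4 : ((x + 1 : ℕ) : ℝ) ≤ (max K (P.guess s) : ℕ) := by
      exact_mod_cast (by omega : x + 1 ≤ max K (P.guess s))
    have h5 : ((∑ i ∈ Finset.Ico κ K, defect (P.W ω users adv) (P.Acc ω users adv) i +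
        (s.cnt - P.W ω users adv K) : ℕ) : ℝ) ≤
        (∑ i ∈ Finset.Ico κ (x + 1), defect (P.W ω users adv) (P.Acc ω users adv) i : ℕ) := by
      rw [← Finset.sum_Ico_consecutive _ h1 hK]
      exact_mod_cast Nat.add_le_add_left hd _
    nlinarith
  · right
    obtain rfl : κ = x + 1 := by omega
    obtain rfl : K = x + 1 := by omega
    refine ⟨rfl, le_antisymm ?_ h2⟩
    simp only [Finset.Ico_self, Finset.sum_empty] at h3 hd
    have h6 : s.cnt - P.W ω users adv (x + 1) = 0 := by omega
    rw [h6] at h3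
    have h7 : ((max (x + 1) (P.guess s) : ℕ) : ℝ) ≤ (x + 1 : ℕ) := by
      simp only [Nat.cast_zero, add_zero, mul_zero] at h3
      by_contra hcon
      push Not at hcon
      nlinarith
    have h8 : max (x + 1) (P.guess s) ≤ x + 1 := by exact_mod_cast h7
    omega

/-- A block that is not accepted has defect at least `1`, and as `3 / (1 - ε) ≥ 1` the stretch that
consists of this block alone is already dense. -/
lemma acc_of_not_bad {ε : ℝ} (hε0 : 0 < ε) (hε : ε < 1) {x : ℕ} (hx : ¬ P.Bad ω users adv ε x) :
    P.Acc ω users adv x := by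
  by_contra ha
  refine hx ⟨x, le_rfl, ?_⟩
  have h1 : 1 ≤ defect (P.W ω users adv) (P.Acc ω users adv) x := by
    unfold defect; rw [if_neg ha]; omega
  have h2 : (1 : ℝ) ≤ defect (P.W ω users adv) (P.Acc ω users adv) x := by exact_mod_cast h1
  have h3 : 1 ≤ 3 / (1 - ε) := by rw [le_div_iff₀ (by linarith)]; linarith
  rw [Nat.Ico_succ_singleton, Finset.sum_singleton]
  push_cast
  nlinarith

/-- What can be decoded is bounded by the guess. -/
lemma dec_lt {w : List Bool} {i : ℕ} {b : Bool} (h : P.dec w = some (i, b)) :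
    i < P.guess (P.know w) * P.dl ∧ i < P.D := by
  unfold dec at h
  dsimp only at h
  split_ifs at h with hc
  obtain ⟨-, h2, h3, h4, h5⟩ := hc
  change 0 < P.guess (P.know w) at h2
  simp only [Option.some.injEq, Prod.mk.injEq] at h
  obtain ⟨h6, -⟩ := h
  rw [h6] at h5
  refine ⟨?_, h5⟩
  change (P.guess (P.know w) - 1) * P.dl + _ = i at h6
  have h7 : P.guess (P.know w) * P.dl = (P.guess (P.know w) - 1) * P.dl + P.dl := by
    conv_lhs => rw [← Nat.sub_add_cancel h2, Nat.add_mul, Nat.one_mul]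
  have h8 : P.dl = P.R - (P.h + P.h + P.q) := rfl
  omega

lemma eq_recB_of_clean {k : ℕ} (hc : P.Clean ω users adv k) {w : List Bool}
    (hw : w <+: P.recB ω users adv ((k + 1) * P.R)) (hk : P.bt ω users adv k ≤ w.length) :
    w.length - P.bt ω users adv k ≤ P.R ∧
      w = P.recB ω users adv (k * P.R + (w.length - P.bt ω users adv k)) := by
  have h1 := clean_length hc (o := P.R) le_rfl
  have e : k * P.R + P.R = (k + 1) * P.R := by rw [Nat.add_mul, Nat.one_mul]
  rw [e] at h1
  have h2 := hw.length_le
  refine ⟨by omega, ?_⟩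
  have h3 := clean_length hc (o := w.length - P.bt ω users adv k) (by omega)
  refine (List.prefix_of_prefix_length_le hw (recB_prefix (by rw [← e]; omega))
    (by omega)).eq_of_length_le (by omega)

/-- Before the marker of a block is complete. -/
lemma Acc.cnt_start (hP : P.Valid) {k : ℕ} (ha : P.Acc ω users adv k) {c : ℕ} (hc : c < P.h) :
    (P.know (P.recB ω users adv (k * P.R + c))).cnt = P.W ω users adv k := by
  have hH := hP.H_lt
  have hb := ha.1.inBlock hP (c := P.R - 1) (by omega) (by unfold H at hH; omega)
  have hlen := clean_length ha.1.1 (o := c) (by unfold H at hH; omega)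
  have p1 : P.recB ω users adv (k * P.R + c) <+: P.recB ω users adv (k * P.R + (P.R - 1) + 1) :=
    recB_prefix (by unfold H at hH; omega)
  have p2 : P.recB ω users adv (k * P.R) <+: P.recB ω users adv (k * P.R + (P.R - 1) + 1) :=
    recB_prefix (by omega)
  have e1 := (P.scan_prefix p1).2.2.2.1
  have e2 := (P.scan_prefix p2).2.2.2.1
  unfold W know
  rw [← e1, ← e2, hlen]
  refine (P.scan_of_no_match (by change P.bt ω users adv k ≤ _; omega) fun s h1 h2 => ?_).2.2.1
  change P.bt ω users adv k < s at h1
  obtain ⟨i, rfl⟩ : ∃ i, s = P.bt ω users adv k + i + 1 := ⟨s - P.bt ω users adv k - 1, by omega⟩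
  rw [P.scan_marker_zc hb.one (fun j hj hj' => hb.zero j hj (by omega))]
  omega

/-- What is decoded early does not interfere with a block that is not bad. -/
lemma dec_before (hP : P.Valid) {ε : ℝ} (hε0 : 0 < ε) (hε : ε < 1)
    (hS : ∀ lo hi M, lo ≤ hi → hi ≤ P.n →
      SelfMatching P.S lo hi M → (M.length : ℝ) ≤ ε * ((hi : ℝ) - lo))
    {x : ℕ} (hx : ¬ P.Bad ω users adv ε x) (hn : x + 1 ≤ P.n) {w : List Bool}
    (hw : w <+: P.recB ω users adv (x * P.R + P.H)) {i : ℕ} {b : Bool} (hd : P.dec w = some (i,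
      b)) :
    i < x * P.dl := by
  have hH := hP.H_lt
  have hHd : P.H = P.h + P.h + P.q := rfl
  -- `k` is a block during whose transmission the word `w` ends.
  obtain ⟨k, hkx, hk1, hk2⟩ : ∃ k ≤ x, P.bt ω users adv k ≤ w.length ∧
      w <+: P.recB ω users adv ((k + 1) * P.R) := by
    have key : ∀ y ≤ x, (∃ k ≤ y, P.bt ω users adv k ≤ w.length ∧
        w <+: P.recB ω users adv ((k + 1) * P.R)) ∨ P.bt ω users adv y ≤ w.length := by
      intro y
      induction y with
      | zero => intro _; right; simp [bt, recB, rd]; exact Nat.zero_le _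
      | succ y ih =>
        intro hy
        rcases ih (by omega) with ⟨k, h1, h2, h3⟩ | h
        · exact Or.inl ⟨k, by omega, h2, h3⟩
        · by_cases h' : P.bt ω users adv (y + 1) ≤ w.length
          · exact Or.inr h'
          · refine Or.inl ⟨y, by omega, h, List.prefix_of_prefix_length_le hw (recB_prefix ?_)
              (by unfold bt at h'; omega)⟩
            have := Nat.mul_le_mul_right P.R hy
            omega
    rcases key x le_rfl with h | h
    · exact h
    · refine ⟨x, le_rfl, h, hw.trans (recB_prefix ?_)⟩
      rw [Nat.add_mul]; omega
  have hpre : P.recB ω users adv (k * P.R) <+: w :=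
    List.prefix_of_prefix_length_le
      (recB_prefix (Nat.mul_le_mul_right _ (Nat.le_succ k))) hk2 hk1
  have hlt := (dec_lt hd).1
  suffices hg : P.guess (P.know w) ≤ x from hlt.trans_le (Nat.mul_le_mul_right _ hg)
  by_cases ha : P.Acc ω users adv k
  · obtain ⟨c1, c2⟩ := eq_recB_of_clean ha.1.1 hk2 hk1
    set c := w.length - P.bt ω users adv k with hcdef
    rcases Nat.lt_or_ge c P.h with hc | hc
    · have hcnt := ha.cnt_start hP hc
      rw [← c2] at hcnt
      rcases guess_of_not_bad hε hS hx (K := k) (by omega) hn (truth hP hpre) hcnt.ge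
        (by rw [hcnt]; omega) with h | h
      · exact h
      · omega
    · have hb := ha.1.inBlock hP (c := c - 1) (by omega) (by omega)
      have e : k * P.R + (c - 1) + 1 = k * P.R + c := by have := hP.h_pos; omega
      rw [e, ← c2] at hb
      have hdec := hb.dec_eq hP.h_pos (hP.S_le k)
      rw [hd] at hdec
      have hcH : P.H ≤ c - 1 := by
        by_contra hcon
        dsimp only at hdec
        rw [if_neg (fun h => hcon h.2.1)] at hdec
        cases hdec
      have hkn := (ha.1.know hP (c := c - 1) (by omega) (by omega)).1 ha
      rw [e, ← c2] at hkn
      have ht : Truth P.S (P.know w).y (P.W ω users adv) (P.Acc ω users adv) (k + 1) :=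
        ⟨W_zero, W_mono, fun j hj haj => by
          refine ⟨haj.W_succ hP, ?_⟩
          rcases Nat.lt_or_ge j k with h | h
          · exact ((truth hP hpre).acc j h haj).2
          · obtain rfl : j = k := by omega
            exact (hkn.2.2 hcH).symm⟩
      have hcnt : (P.know w).cnt = P.W ω users adv (k + 1) := by rw [ha.W_succ hP, hkn.2.1]
      rcases guess_of_not_bad hε hS hx (K := k + 1) (by omega) hn ht hcnt.ge
        (by rw [hcnt]; omega) with h | h
      · exact h
      -- The guess `x + 1` would need the complete header of block `x` and one more bit, but `w`
      -- ends at the latest with this header.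
      · exfalso
        obtain rfl : k = x := by omega
        have h1 := hw.length_le
        rw [clean_length ha.1.1 hH.le] at h1
        omega
  · have hkx' : k < x := by
      rcases Nat.lt_or_ge k x with h | h
      · exact h
      · obtain rfl : k = x := by omega
        exact absurd (acc_of_not_bad hε0 hε hx) ha
    have h1 : (P.know w).cnt ≤ P.W ω users adv (k + 1) := know_cnt_mono hk2
    have h2 : P.W ω users adv k ≤ (P.know w).cnt := know_cnt_mono hpre
    -- The markers accepted so far within the missed block `k` are part of its defect.
    have h3 : defect (P.W ω users adv) (P.Acc ω users adv) k ≤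
        ∑ i ∈ Finset.Ico k (x + 1), defect (P.W ω users adv) (P.Acc ω users adv) i :=
      Finset.single_le_sum (f := defect (P.W ω users adv) (P.Acc ω users adv))
        (fun _ _ => Nat.zero_le _) (by simp; omega)
    have h4 : defect (P.W ω users adv) (P.Acc ω users adv) k =
        1 + (P.W ω users adv (k + 1) - P.W ω users adv k) := by unfold defect; rw [if_neg ha]
    rcases guess_of_not_bad hε hS hx (K := k) (by omega) hn (truth hP hpre) h2 (by omega) with h | h
    · exact h
    · omega

/-- A block that is not bad is decoded. -/
lemma dec_good (hP : P.Valid) {ε : ℝ} (hε0 : 0 < ε) (hε : ε < 1)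
    (hS : ∀ lo hi M, lo ≤ hi → hi ≤ P.n →
      SelfMatching P.S lo hi M → (M.length : ℝ) ≤ ε * ((hi : ℝ) - lo))
    {x : ℕ} (hx : ¬ P.Bad ω users adv ε x) (hn : x + 1 ≤ P.n) {c : ℕ} (hcH : P.H ≤ c) (hc : c < P.R)
    (hD : x * P.dl + (c - P.H) < P.D) :
    P.dec (P.recB ω users adv (x * P.R + c + 1)) =
      some (x * P.dl + (c - P.H), P.pl ω users adv (x * P.R + c)) := by
  have ha := acc_of_not_bad hε0 hε hx
  have hHd : P.H = P.h + P.h + P.q := rfl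
  have hb := ha.1.inBlock hP hc (by omega)
  have hkn := (ha.1.know hP hc (by omega)).1 ha
  have hpre : P.recB ω users adv (x * P.R) <+: P.recB ω users adv (x * P.R + c + 1) :=
    recB_prefix (by omega)
  have ht : Truth P.S (P.know (P.recB ω users adv (x * P.R + c + 1))).y (P.W ω users adv)
      (P.Acc ω users adv) (x + 1) :=
    ⟨W_zero, W_mono, fun j hj haj => by
      refine ⟨haj.W_succ hP, ?_⟩
      rcases Nat.lt_or_ge j x with h | h
      · exact ((truth hP hpre).acc j h haj).2
      · obtain rfl : j = x := by omega
        exact (hkn.2.2 hcH).symm⟩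
  have hcnt : (P.know (P.recB ω users adv (x * P.R + c + 1))).cnt = P.W ω users adv (x + 1) := by
    rw [ha.W_succ hP, hkn.2.1]
  have hg : P.guess (P.know (P.recB ω users adv (x * P.R + c + 1))) = x + 1 := by
    -- A guess that is too small forces `κ ≤ x` as well, and then the stretch from `κ` to `x` makes
    -- `x` bad.
    have h0 : ¬ P.guess (P.know (P.recB ω users adv (x * P.R + c + 1))) ≤ x := by
      intro hle
      obtain ⟨g1, g2⟩ := argmin_le (cost P.S (P.know (P.recB ω users adv (x * P.R + c + 1))).y
        (P.know (P.recB ω users adv (x * P.R + c + 1))).cnt) P.n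
      obtain ⟨κ, h1, h2, h3⟩ := guess_bound (ε := ε) ht hcnt.ge (g2 (x + 1) hn)
        (fun lo M hlo hM => hS lo _ M hlo (max_le hn g1) hM)
      change κ ≤ P.guess _ at h2
      change (1 - ε) * ((max (x + 1) (P.guess _) : ℕ) - (κ : ℝ)) ≤ _ at h3
      refine hx ⟨κ, by omega, ?_⟩
      rw [div_mul_eq_mul_div, le_div_iff₀ (by linarith)]
      rw [max_eq_left (by omega), hcnt, Nat.sub_self, add_zero] at h3
      linarith
    rcases guess_of_not_bad hε hS hx (K := x + 1) le_rfl hn ht hcnt.ge (by rw [hcnt]; omega)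
      with h | h
    · exact absurd h h0
    · exact h.2
  obtain ⟨h1, h2, h3⟩ := hb.scan_eq hP.h_pos (hP.S_le x)
  obtain ⟨-, -, e3, e4, -⟩ := P.scan_prefix hpre
  have e3' : (P.scan (fun i => (P.recB ω users adv (x * P.R + c + 1)).getD i false)
    (P.bt ω users adv x)).na = (P.know (P.recB ω users adv (x * P.R))).na := e3
  have hna := ha.2
  rw [← e3'] at hna
  obtain ⟨g1, g2, g3⟩ := h2 hna
  have hdec := hb.dec_eq hP.h_pos (hP.S_le x)
  dsimp only at hdec
  have hg' : argmin (cost P.S (Function.update (P.scan (fun i =>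
      (P.recB ω users adv (x * P.R + c + 1)).getD i false) (P.bt ω users adv x)).y
      (P.scan (fun i => (P.recB ω users adv (x * P.R + c + 1)).getD i false)
        (P.bt ω users adv x)).cnt (P.S x)) ((P.scan (fun i =>
      (P.recB ω users adv (x * P.R + c + 1)).getD i false) (P.bt ω users adv x)).cnt + 1)) P.n =
      x + 1 := by
    rw [← hg]
    unfold guess know
    rw [g2, g3 hcH]
  rw [hg', if_pos ⟨hna, hcH, by omega, by simpa using hD⟩] at hdec
  simpa using hdec

end decoding
end Par
end IndelSim

namespace IndelSim
namespace Par

section correctness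

variable {P : Par} {ω : ℕ → Bool} {users : Users} {adv : Adversary}

/-! ### The number of bad blocks -/

/-- A marker is refused only if another one was accepted less than `R` bits before its end. In a
good block the only marker ends exactly `R` bits before the end of the next true marker, and markers
of earlier blocks are even further away. -/
lemma acc_of_good (hP : P.Valid) {k : ℕ} (hg : P.Good ω users adv k)
    (hg' : ∀ j, k = j + 1 → P.Good ω users adv j) : P.Acc ω users adv k := by
  refine ⟨hg, ?_⟩
  cases k with
  | zero =>
    have : (P.know (P.recB ω users adv (0 * P.R))).na = 0 := by rw [Nat.zero_mul]; rfl
    rw [this]; exact Nat.zero_le _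
  | succ j =>
    have hH := hP.H_lt
    have hj := hg' j rfl
    obtain ⟨h1, h2⟩ := hj.know hP (c := P.R - 1) (by omega) (by unfold H at hH; omega)
    have hbt : P.bt ω users adv (j + 1) = P.bt ω users adv j + P.R := by
      have := clean_length hj.1 (o := P.R) le_rfl
      rw [← this, bt, Nat.add_mul, Nat.one_mul]
    rw [succ_block hP] at h1 h2
    by_cases ha : P.Acc ω users adv j
    · rw [(h1 ha).1]; omega
    · rw [(h2 ha).1]
      have := P.scan_na_le (fun i => (P.recB ω users adv (j * P.R)).getD i false)
        (P.bt ω users adv j)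
      change (P.know _).na ≤ _ at this
      omega

/-- During a block Bob's end receives at most `R` symbols and one more per edit, and accepted
markers are `R` apart. -/
lemma W_succ_le (hP : P.Valid) (k : ℕ) : P.W ω users adv (k + 1) + P.ed ω users adv (k * P.R) ≤
    P.W ω users adv k + 2 + P.ed ω users adv ((k + 1) * P.R) := by
  have hH := hP.H_lt
  have hle : k * P.R ≤ (k + 1) * P.R := Nat.mul_le_mul_right _ (Nat.le_succ k)
  have hpre : P.recB ω users adv (k * P.R) <+: P.recB ω users adv ((k + 1) * P.R) := recB_prefix hle
  have h1 := P.scan_cnt_le (fun i => (P.recB ω users adv ((k + 1) * P.R)).getD i false)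
    hpre.length_le
  rw [(P.scan_prefix hpre).2.2.2.1] at h1
  change P.R * (P.W ω users adv (k + 1) - P.W ω users adv k) ≤ _ at h1
  have h2 := recB_length_le (P := P) (ω := ω) (users := users) (adv := adv) hle
  have h3 : (k + 1) * P.R - k * P.R = P.R := by rw [Nat.add_mul, Nat.one_mul]; omega
  rw [h3] at h2
  have h4 : P.ed ω users adv (k * P.R) ≤ P.ed ω users adv ((k + 1) * P.R) := ed_mono hle
  by_contra hcon
  have h5 : 3 + (P.ed ω users adv ((k + 1) * P.R) - P.ed ω users adv (k * P.R)) ≤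
      P.W ω users adv (k + 1) - P.W ω users adv k := by omega
  have h6 := Nat.mul_le_mul_left P.R h5
  rw [Nat.mul_add] at h6
  have h7 : P.ed ω users adv ((k + 1) * P.R) - P.ed ω users adv (k * P.R) ≤
      P.R * (P.ed ω users adv ((k + 1) * P.R) - P.ed ω users adv (k * P.R)) :=
    Nat.le_mul_of_pos_left _ (by omega)
  omega

open Classical in
variable (P ω users adv) in
/-- The number of unlucky blocks. -/
noncomputable def unluckyCount (K : ℕ) : ℕ :=
  ((Finset.range K).filter fun k => P.Unlucky ω users adv k).card

-- An amortized count. A block with edits has defect at most `3` plus the number of its edits, an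
-- unlucky one at most `3`. One more unit is put aside for the following block, which may be good
-- and nevertheless be refused, with defect `1`. This gives `5` per edit and `4` per unlucky block.
open Classical in
lemma sum_defect_le (hP : P.Valid) (K : ℕ) :
    ∑ k ∈ Finset.range K, defect (P.W ω users adv) (P.Acc ω users adv) k ≤
      5 * P.e + 4 * P.unluckyCount ω users adv K := by
  have key : ∑ k ∈ Finset.range K, defect (P.W ω users adv) (P.Acc ω users adv) k +
      (if K ≠ 0 ∧ ¬ P.Good ω users adv (K - 1) then 1 else 0) ≤
      5 * P.ed ω users adv (K * P.R) + 4 * P.unluckyCount ω users adv K := by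
    induction K with
    | zero => simp
    | succ K ih =>
      have hle : P.ed ω users adv (K * P.R) ≤ P.ed ω users adv ((K + 1) * P.R) :=
        ed_mono (Nat.mul_le_mul_right _ (Nat.le_succ K))
      have hU : P.unluckyCount ω users adv (K + 1) = P.unluckyCount ω users adv K +
          if P.Unlucky ω users adv K then 1 else 0 := by
        unfold unluckyCount
        rw [Finset.range_add_one, Finset.filter_insert]
        split_ifs with h
        · rw [Finset.card_insert_of_notMem (by simp)]
        · rfl
      have hW := W_succ_le (P := P) (ω := ω) (users := users) (adv := adv) hP K
      rw [Finset.sum_range_succ, hU, Nat.add_sub_cancel]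
      by_cases hg : P.Good ω users adv K
      · rw [if_neg (fun h => h.2 hg)]
        by_cases ha : P.Acc ω users adv K
        · unfold defect at ih ⊢; rw [if_pos ha]; omega
        · have h1 : K ≠ 0 ∧ ¬ P.Good ω users adv (K - 1) := by
            by_contra hcon
            refine ha (acc_of_good hP hg fun j hj => ?_)
            subst hj
            by_contra h; exact hcon ⟨by omega, by simpa using h⟩
          rw [if_pos h1] at ih
          have h2 : P.W ω users adv (K + 1) = P.W ω users adv K := by
            have hH := hP.H_lt
            have := ((hg.know hP (c := P.R - 1) (by omega) (by unfold H at hH; omega)).2 ha).2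
            rwa [succ_block hP] at this
          have h3 : defect (P.W ω users adv) (P.Acc ω users adv) K = 1 := by
            unfold defect; rw [if_neg ha, h2]; omega
          omega
      · rw [if_pos ⟨by omega, hg⟩]
        have ha : ¬ P.Acc ω users adv K := fun h => hg h.1
        have h3 : defect (P.W ω users adv) (P.Acc ω users adv) K =
            1 + (P.W ω users adv (K + 1) - P.W ω users adv K) := by
          unfold defect; rw [if_neg ha]
        by_cases hu : P.Unlucky ω users adv K
        · rw [if_pos hu]
          have hc := hu.1
          unfold Clean at hc
          omega
        · rw [if_neg hu]
          have hc : ¬ P.Clean ω users adv K := fun h => hg ⟨h, hu⟩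
          unfold Clean at hc
          omega
  have := ed_le (P := P) (ω := ω) (users := users) (adv := adv) (K * P.R)
  omega

open Classical in
lemma card_bad_le (hP : P.Valid) {ε : ℝ} (hε : ε < 1) (K : ℕ) :
    (((Finset.range K).filter fun x => P.Bad ω users adv ε x).card : ℝ) ≤
      3 / (1 - ε) * ((5 * P.e + 4 * P.unluckyCount ω users adv K : ℕ) : ℝ) := by
  have hC : 0 ≤ 3 / (1 - ε) := div_nonneg (by norm_num) (by linarith)
  refine (card_dense_le (defect (P.W ω users adv) (P.Acc ω users adv)) hC
    (fun x => P.Bad ω users adv ε x) (fun x hx => hx) K).trans (mul_le_mul_of_nonneg_left ?_ hC)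
  exact_mod_cast sum_defect_le hP K

/-! ### Correctness -/

/-- The synchronization string of the scheme has no long self-matchings. -/
structure Sync (P : Par) (ε : ℝ) : Prop where
  pos : 0 < ε
  lt_one : ε < 1
  selfMatching : ∀ lo hi M, lo ≤ hi → hi ≤ P.n →
    SelfMatching P.S lo hi M → (M.length : ℝ) ≤ ε * ((hi : ℝ) - lo)

/-- A symbol once revealed cannot be corrected. So correctness of a block that is not bad also needs
that nothing of it has been revealed earlier, not even on account of wrong guesses in bad blocks. -/
lemma revB_before (hP : P.Valid) {ε : ℝ} (hS : P.Sync ε) {x : ℕ} (hx : ¬ P.Bad ω users adv ε x)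
    (hn : x + 1 ≤ P.n) (hend : (x + 1) * P.R + P.e + P.e < P.n / 2) {w : List Bool}
    (hw : w <+: P.recB ω users adv (x * P.R + P.H)) : (P.revB w).length ≤ x * P.dl := by
  induction w using List.reverseRecOn with
  | nil => exact Nat.zero_le _
  | append_singleton w b ih =>
    rw [revB_length_append]
    refine max_le (ih ((List.prefix_append _ _).trans hw)) ?_
    have h1 := hw.length_le
    have h2 := recB_length_le_add (P := P) (ω := ω) (users := users) (adv := adv) (x * P.R + P.H)
    have h3 := ed_le (P := P) (ω := ω) (users := users) (adv := adv) (x * P.R + P.H)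
    have h4 := hP.H_lt
    rw [Nat.add_mul] at hend
    unfold goal
    rw [if_neg (by omega)]
    cases hd : P.dec (w ++ [b]) with
    | none => exact Nat.zero_le _
    | some z =>
      obtain ⟨i, y⟩ := z
      exact dec_before hP hS.pos hS.lt_one hS.selfMatching hx hn hw hd

/-- The symbol is revealed in the round in which it is sent. Hence the answer of Bob's user travels
back in the same round and arrives exactly where `C_A` is going to reveal it. -/
lemma revB_step (hP : P.Valid) {ε : ℝ} (hS : P.Sync ε) {x : ℕ} (hx : ¬ P.Bad ω users adv ε x)
    (hn : x + 1 ≤ P.n) (hend : (x + 1) * P.R + P.e + P.e < P.n / 2) {c : ℕ} (hcH : P.H ≤ c)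
    (hc : c < P.R) (hD : x * P.dl + (c - P.H) < P.D)
    (hle : (P.revB (P.recB ω users adv (x * P.R + c))).length ≤ x * P.dl + (c - P.H)) :
    (P.revB (P.recB ω users adv (x * P.R + c + 1))).length = x * P.dl + (c - P.H) + 1 ∧
    (P.revB (P.recB ω users adv (x * P.R + c + 1)))[x * P.dl + (c - P.H)]? =
      some (P.pl ω users adv (x * P.R + c)) ∧
    P.outB users (P.recB ω users adv (x * P.R + c + 1)) =
      users .bob (P.revB (P.recB ω users adv (x * P.R + c + 1))) := by
  have hdec := dec_good hP hS.pos hS.lt_one hS.selfMatching hx hn hcH hc hD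
  have hcl := (clean_step (acc_of_not_bad hS.pos hS.lt_one hx).1.1 hc).1
  have h2 := recB_length_le_add (P := P) (ω := ω) (users := users) (adv := adv) (x * P.R + c + 1)
  have h3 := ed_le (P := P) (ω := ω) (users := users) (adv := adv) (x * P.R + c + 1)
  have hgoal : P.goal (P.recB ω users adv (x * P.R + c + 1)) = x * P.dl + (c - P.H) + 1 := by
    rw [Nat.add_mul] at hend
    unfold goal
    rw [if_neg (by omega), hdec]
  have hlen : (P.revB (P.recB ω users adv (x * P.R + c + 1))).length =
      x * P.dl + (c - P.H) + 1 := by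
    have := hgoal
    rw [hcl] at this ⊢
    rw [revB_length_append, this]; omega
  refine ⟨hlen, ?_, ?_⟩
  · rw [List.getElem?_eq_getElem (by omega)]
    have hdec' := hdec
    have hlen' := hlen
    rw [hcl] at hdec' hlen'
    have := P.revB_getElem (P.recB ω users adv (x * P.R + c)) (P.sent ω users adv (x * P.R + c))
      _ hle (by omega)
    rw [hdec'] at this
    simp only [hcl]
    rw [this]
    simp
  · have hdrop : (P.recB ω users adv (x * P.R + c + 1)).dropLast =
        P.recB ω users adv (x * P.R + c) := by rw [hcl, List.dropLast_concat]
    unfold outB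
    rw [hdec]
    dsimp only
    rw [hdrop, if_pos ⟨hle, hlen⟩]

lemma revB_within (hP : P.Valid) {ε : ℝ} (hS : P.Sync ε) {x : ℕ} (hx : ¬ P.Bad ω users adv ε x)
    (hn : x + 1 ≤ P.n) (hend : (x + 1) * P.R + P.e + P.e < P.n / 2) {c : ℕ} (hcH : P.H ≤ c)
    (hc : c < P.R) (hD : x * P.dl + (c - P.H) < P.D) :
    (P.revB (P.recB ω users adv (x * P.R + c))).length ≤ x * P.dl + (c - P.H) := by
  induction c, hcH using Nat.le_induction with
  | base => exact (revB_before hP hS hx hn hend (List.prefix_refl _)).trans (Nat.le_add_right _ _)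
  | succ c hcH ih =>
    rw [← add_assoc, (revB_step hP hS hx hn hend hcH (by omega) (by omega)
      (ih (by omega) (by omega))).1]
    omega

variable (P) in
/-- The intermediaries of the scheme. -/
def act (ω : ℕ → Bool) : Party → List Event → Action
  | .alice => P.actA ω
  | .bob => P.actB

/-- Only symbols in bad blocks are corrupted. -/
lemma corrupted_bad (hP : P.Valid) {ε : ℝ} (hS : P.Sync ε) (hn : Even P.n) (hN : Even P.N)
    {K : ℕ} (hK : P.D ≤ K * P.dl) (hend : K * P.R + P.e + P.e < P.n / 2) :
    (run P.n P.e P.N users (P.act ω) adv).Completes P.N ∧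
    ∀ p ∈ (run P.n P.e P.N users (P.act ω) adv).corrupted P.N,
      p / 2 / P.dl < K ∧ P.Bad ω users adv ε (p / 2 / P.dl) := by
  have hH := hP.H_lt
  have hreact : ∀ p, Reacts P.N users p (P.act ω p) (P.rev p) (P.out ω users p) := by
    intro p
    cases p with
    | alice => exact P.reacts_alice hH ω users
    | bob => exact P.reacts_bob users
  obtain ⟨hcomp, w, h1, h2, h3⟩ := run_spec (adv := adv) hreact hn (e := P.e) (fun p w hw => by
    cases p with
    | alice => exact P.revA_length_end hH hK w (by omega)
    | bob => exact P.revB_length_end w hw (by omega))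
  refine ⟨hcomp, fun p hp => ?_⟩
  have hdl : 0 < P.dl := by unfold dl; omega
  rw [Config.corrupted, Finset.mem_filter, Finset.mem_range] at hp
  obtain ⟨hpN, hp⟩ := hp
  have hi : p / 2 < P.D := by
    obtain ⟨d, hd⟩ := hN
    unfold D; omega
  have hxK : p / 2 / P.dl < K := by
    rw [Nat.div_lt_iff_lt_mul hdl]; omega
  refine ⟨hxK, ?_⟩
  by_contra hx
  set x := p / 2 / P.dl with hxdef
  set c := P.H + p / 2 % P.dl with hcdef
  have hmod := Nat.mod_lt (p / 2) hdl
  have hc : c < P.R := by unfold dl at hmod hcdef; omega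
  have hidx : x * P.dl + (c - P.H) = p / 2 := by
    have := Nat.div_add_mod (p / 2) P.dl
    rw [Nat.mul_comm, ← hxdef] at this
    omega
  have hend' : (x + 1) * P.R + P.e + P.e < P.n / 2 := by
    have := Nat.mul_le_mul_right P.R (Nat.succ_le_of_lt hxK)
    simp only [Nat.succ_eq_add_one] at this
    omega
  have hxn : x + 1 ≤ P.n := by
    have := Nat.le_mul_of_pos_right (x + 1) (show 0 < P.R by omega)
    omega
  have hcH : P.H ≤ c := Nat.le_add_right _ _
  have hwithin := revB_within hP hS hx hxn hend' hcH hc (by omega)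
  obtain ⟨s1, s2, s3⟩ := revB_step hP hS hx hxn hend' hcH hc (by omega) hwithin
  have s4 := (clean_step (acc_of_not_bad hS.pos hS.lt_one hx).1.1 hc).2
  have hq : x * P.R + c + 1 + P.e ≤ P.n / 2 := by rw [Nat.add_mul] at hend'; omega
  have hB : P.recB ω users adv (x * P.R + c + 1) <+: w .bob := h3 _ .bob hq
  have hA : P.recA ω users adv (x * P.R + c + 1) <+: w .alice := h3 _ .alice hq
  obtain ⟨tB, htB⟩ := revB_prefix (P := P) hB
  obtain ⟨tA, htA⟩ := revA_prefix (P := P) hA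
  have hI : P.idx (x * P.R + c) = p / 2 := by
    unfold idx; rw [block_mod hc, block_div hc]; exact hidx
  have hdata : P.IsData (x * P.R + c) := ⟨by rw [block_mod hc]; exact hcH, by omega⟩
  have hlenA : (P.revA (P.recA ω users adv (x * P.R + c))).length = p / 2 := by
    rw [P.revA_length hH, recA_length, hI]; omega
  rw [s4, revA_append, recA_length, if_pos hdata, List.append_assoc] at htA
  rw [hidx] at s1 s2
  -- At the index `p / 2` given and revealed symbols agree in both directions, so `p` is not
  -- corrupted, whatever its parity.
  have gA : ((run P.n P.e P.N users (P.act ω) adv).given .alice)[p / 2]? =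
      some (P.pl ω users adv (x * P.R + c)) := by
    rw [h2 .alice]
    change (givenOf P.N users .alice (P.revA (w .alice)))[p / 2]? = _
    rw [← htA, givenOf_alice_getElem? _ _ _ (by simp; omega) hi,
      List.take_append_of_le_length (by omega)]
    unfold pl plain
    rw [block_mod hc, if_neg (by omega), hI, if_pos hi, hlenA.symm]
  have rB : ((run P.n P.e P.N users (P.act ω) adv).revealed .bob)[p / 2]? =
      some (P.pl ω users adv (x * P.R + c)) := by
    rw [h1 .bob]
    change (P.revB (w .bob))[p / 2]? = _
    rw [← htB, List.getElem?_append_left (by omega), s2]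
  have gB : ((run P.n P.e P.N users (P.act ω) adv).given .bob)[p / 2]? =
      some (users .bob (P.revB (P.recB ω users adv (x * P.R + c + 1)))) := by
    rw [h2 .bob]
    change (givenOf P.N users .bob (P.revB (w .bob)))[p / 2]? = _
    rw [← htB, givenOf_bob_getElem? _ _ _ (by simp; omega), ← s1,
      List.take_append_of_le_length le_rfl,
      List.take_length]
  have rA : ((run P.n P.e P.N users (P.act ω) adv).revealed .alice)[p / 2]? =
      some (users .bob (P.revB (P.recB ω users adv (x * P.R + c + 1)))) := by
    rw [h1 .alice]
    change (P.revA (w .alice))[p / 2]? = _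
    rw [← htA, List.getElem?_append_right (by omega), hlenA, Nat.sub_self, ← s3]
    rfl
  rw [gA, rB, gB, rA] at hp
  simp at hp

end correctness
end Par
end IndelSim

namespace IndelSim

/-! ### The probability of unlucky blocks -/

/-- Finitely many coins, followed by zeros. -/
def coins {L : ℕ} (ω : Fin L → Bool) (i : ℕ) : Bool := if h : i < L then ω ⟨i, h⟩ else false

/-- Two coin sequences agree except for the `h` coins from number `s` on. -/
def AgreeOff {L : ℕ} (s h : ℕ) (ω ω' : Fin L → Bool) : Prop :=
  ∀ i : Fin L, (i : ℕ) < s ∨ s + h ≤ i → ω i = ω' i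

open Classical in
lemma le_card_agreeOff {L s h : ℕ} (hs : s + h ≤ L) (ω : Fin L → Bool) :
    2 ^ h ≤ (Finset.univ.filter fun ω' => AgreeOff s h ω ω').card := by
  let g : (Fin h → Bool) → (Fin L → Bool) := fun m i =>
    if hi : s ≤ i ∧ (i : ℕ) < s + h then m ⟨i - s, by omega⟩ else ω i
  have hg : Function.Injective g := by
    intro m m' hm
    funext j
    have := congrFun hm ⟨s + j, by omega⟩
    simpa [g] using this
  calc 2 ^ h = (Finset.univ.image g).card := by
        rw [Finset.card_image_of_injective _ hg]; simp
    _ ≤ _ := by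
        apply Finset.card_le_card
        intro ω' hω'
        obtain ⟨m, -, rfl⟩ := Finset.mem_image.mp hω'
        rw [Finset.mem_filter]
        refine ⟨Finset.mem_univ _, fun i hi => ?_⟩
        simp only [g]
        rw [dif_neg (by omega)]

open Classical in
/-- If an event admits for each choice of the other coins at most `R` values of `h` coins, then its
probability is at most `R / 2 ^ h`, independently of the other coins. -/
lemma sum_event_le {L s h R : ℕ} (hs : s + h ≤ L) (U : (Fin L → Bool) → Prop)
    (o : (Fin L → Bool) → ℕ) (ho : ∀ ω, U ω → o ω < R)
    (hinj : ∀ ω ω', U ω → U ω' → o ω = o ω' → AgreeOff s h ω ω' → ω = ω')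
    (f : (Fin L → Bool) → ℝ) (hf0 : ∀ ω, 0 ≤ f ω)
    (hf : ∀ ω ω', AgreeOff s h ω ω' → f ω = f ω') :
    2 ^ h * ∑ ω, (if U ω then f ω else 0) ≤ R * ∑ ω, f ω := by
  -- Double counting of pairs that agree off the `h` coins: each `ω` has at least `2 ^ h` partners,
  -- and each `ω'` is the partner of at most `R` elements of the event, one for each value of `o`.
  have h1 : 2 ^ h * ∑ ω, (if U ω then f ω else 0) ≤
      ∑ ω, ∑ ω', (if U ω ∧ AgreeOff s h ω ω' then f ω' else 0) := by
    rw [Finset.mul_sum]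
    refine Finset.sum_le_sum fun ω _ => ?_
    by_cases hU : U ω
    · have h2 : ∀ ω', (if U ω ∧ AgreeOff s h ω ω' then f ω' else 0) =
          if AgreeOff s h ω ω' then f ω else 0 := by
        intro ω'
        by_cases ha : AgreeOff s h ω ω'
        · rw [if_pos ⟨hU, ha⟩, if_pos ha, hf _ _ ha]
        · rw [if_neg (fun h => ha h.2), if_neg ha]
      rw [if_pos hU, Finset.sum_congr rfl fun ω' _ => h2 ω', ← Finset.sum_filter, Finset.sum_const,
        nsmul_eq_mul]
      exact mul_le_mul_of_nonneg_right (by exact_mod_cast le_card_agreeOff hs ω) (hf0 ω)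
    · simp [hU]
  refine h1.trans ?_
  rw [Finset.sum_comm, Finset.mul_sum]
  refine Finset.sum_le_sum fun ω' _ => ?_
  rw [← Finset.sum_filter, Finset.sum_const, nsmul_eq_mul]
  refine mul_le_mul_of_nonneg_right ?_ (hf0 ω')
  have h3 : ((Finset.univ.filter fun ω => U ω ∧ AgreeOff s h ω ω').image o) ⊆ Finset.range R := by
    intro x hx
    obtain ⟨ω, hω, rfl⟩ := Finset.mem_image.mp hx
    exact Finset.mem_range.mpr (ho _ (Finset.mem_filter.mp hω).2.1)
  have h4 := Finset.card_le_card h3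
  rw [Finset.card_image_of_injOn, Finset.card_range] at h4
  · exact_mod_cast h4
  · intro a ha b hb hab
    have ha := (Finset.mem_filter.mp (Finset.mem_coe.mp ha)).2
    have hb := (Finset.mem_filter.mp (Finset.mem_coe.mp hb)).2
    exact hinj _ _ ha.1 hb.1 hab fun i hi => (ha.2 i hi).trans (hb.2 i hi).symm

namespace Par

variable {P : Par} {ω : ℕ → Bool} {users : Users} {adv : Adversary}

lemma rd_congr {ω' : ℕ → Bool} {p : ℕ} (h : ∀ i < p, ω i = ω' i) :
    P.rd ω users adv p = P.rd ω' users adv p := by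
  unfold rd
  refine round_congr (out := P.out ω users) (out' := P.out ω' users) rfl _ fun w hw => ?_
  exact P.bit_congr _ (fun i hi => h i (by omega)) (fun _ _ _ => rfl)

lemma unlucky_congr {ω' : ℕ → Bool} {k : ℕ} (h : ∀ i < (k + 1) * P.R, ω i = ω' i) :
    P.Unlucky ω users adv k ↔ P.Unlucky ω' users adv k := by
  have h1 := rd_congr (P := P) (users := users) (adv := adv) h
  have h2 : P.rd ω users adv (k * P.R) = P.rd ω' users adv (k * P.R) :=
    rd_congr fun i hi => h i (by rw [Nat.add_mul]; omega)
  unfold Unlucky Clean Match ed bt recB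
  rw [h1, h2]

open Classical in
lemma unluckyCount_congr {ω' : ℕ → Bool} {K : ℕ} (h : ∀ i < K * P.R, ω i = ω' i) :
    P.unluckyCount ω users adv K = P.unluckyCount ω' users adv K := by
  unfold unluckyCount
  congr 1
  refine Finset.filter_congr fun k hk => unlucky_congr fun i hi => h i ?_
  have := Nat.mul_le_mul_right P.R (Nat.succ_le_of_lt (Finset.mem_range.mp hk))
  simp only [Nat.succ_eq_add_one] at this
  omega

-- Induction over the blocks. The count for earlier blocks does not depend on the mask of block `K`,
-- and by `mask_unique` at most `R` of the `2 ^ h` masks make this block unlucky, one for each place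
-- of the first false marker.
open Classical in
lemma sum_pow_unluckyCount_le (hP : P.Valid) {L : ℕ} {z : ℝ} (hz : 0 ≤ z) (K : ℕ)
    (hK : K * P.R ≤ L) :
    ∑ ω : Fin L → Bool, z ^ P.unluckyCount (coins ω) users adv K ≤
      2 ^ L * (1 + z * P.R / 2 ^ P.h) ^ K := by
  induction K with
  | zero => simp [unluckyCount]
  | succ K ih =>
    have hH := hP.H_lt
    have hHd : P.H = P.h + P.h + P.q := rfl
    have hK' : K * P.R + P.R ≤ L := by rwa [Nat.add_mul, Nat.one_mul] at hK
    have ih := ih (by omega)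
    have hstep : ∀ ω : Fin L → Bool, z ^ P.unluckyCount (coins ω) users adv (K + 1) ≤
        z ^ P.unluckyCount (coins ω) users adv K + z * (if P.Unlucky (coins ω) users adv K then
          z ^ P.unluckyCount (coins ω) users adv K else 0) := by
      intro ω
      have hU : P.unluckyCount (coins ω) users adv (K + 1) = P.unluckyCount (coins ω) users adv K +
          if P.Unlucky (coins ω) users adv K then 1 else 0 := by
        unfold unluckyCount
        rw [Finset.range_add_one, Finset.filter_insert]
        split_ifs with h
        · rw [Finset.card_insert_of_notMem (by simp)]
        · rfl
      have h0 : 0 ≤ z ^ P.unluckyCount (coins ω) users adv K := pow_nonneg hz _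
      rw [hU]
      split_ifs with h
      · rw [pow_succ]; linarith
      · simp
    have hagree : ∀ ω ω' : Fin L → Bool, AgreeOff (K * P.R + P.h) P.h ω ω' →
        ∀ i < K * P.R, coins ω i = coins ω' i := by
      intro ω ω' h i hi
      unfold coins
      rw [dif_pos (by omega), dif_pos (by omega)]
      exact h _ (Or.inl (by simp; omega))
    have hev := sum_event_le (s := K * P.R + P.h) (h := P.h) (R := P.R) (L := L) (by omega)
      (fun ω => P.Unlucky (coins ω) users adv K)
      (fun ω => sInf {o | P.h ≤ o ∧ o < P.R ∧ P.Match (coins ω) users adv K o})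
      (fun ω hω => (Nat.sInf_mem (s := {o | P.h ≤ o ∧ o < P.R ∧ P.Match (coins ω) users adv K o})
        hω.2).2.1)
      (by
        intro ω ω' hω hω' ho ha
        obtain ⟨a1, a2, a3⟩ := Nat.sInf_mem
          (s := {o | P.h ≤ o ∧ o < P.R ∧ P.Match (coins ω) users adv K o}) hω.2
        obtain ⟨b1, b2, b3⟩ := Nat.sInf_mem
          (s := {o | P.h ≤ o ∧ o < P.R ∧ P.Match (coins ω') users adv K o}) hω'.2
        have a4 : ∀ o', P.h ≤ o' →
            o' < sInf {o | P.h ≤ o ∧ o < P.R ∧ P.Match (coins ω) users adv K o} →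
            ¬ P.Match (coins ω) users adv K o' := fun o' h1 h2 h3 =>
          Nat.notMem_of_lt_sInf h2 ⟨h1, by omega, h3⟩
        have b4 : ∀ o', P.h ≤ o' →
            o' < sInf {o | P.h ≤ o ∧ o < P.R ∧ P.Match (coins ω') users adv K o} →
            ¬ P.Match (coins ω') users adv K o' := fun o' h1 h2 h3 =>
          Nat.notMem_of_lt_sInf h2 ⟨h1, by omega, h3⟩
        rw [← ho] at b3 b4
        have hm := mask_unique hP (hagree ω ω' ha) hω.1 hω'.1 a1 a2 a3 b3 a4 b4
        funext i
        by_cases hi : (i : ℕ) < K * P.R + P.h ∨ K * P.R + P.h + P.h ≤ i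
        · exact ha i hi
        · have := hm (i - K * P.R) (by omega) (by omega)
          have e : K * P.R + ((i : ℕ) - K * P.R) = i := by omega
          rw [e] at this
          simpa [coins] using this)
      (fun ω => z ^ P.unluckyCount (coins ω) users adv K) (fun ω => pow_nonneg hz _)
      (fun ω ω' h => by
        rw [unluckyCount_congr (hagree ω ω' h)])
    have h2 : (0 : ℝ) < 2 ^ P.h := by positivity
    calc ∑ ω : Fin L → Bool, z ^ P.unluckyCount (coins ω) users adv (K + 1)
        ≤ ∑ ω : Fin L → Bool, (z ^ P.unluckyCount (coins ω) users adv K +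
          z * (if P.Unlucky (coins ω) users adv K then
            z ^ P.unluckyCount (coins ω) users adv K else 0)) :=
          Finset.sum_le_sum fun ω _ => hstep ω
      _ = ∑ ω : Fin L → Bool, z ^ P.unluckyCount (coins ω) users adv K +
          z * ∑ ω : Fin L → Bool, (if P.Unlucky (coins ω) users adv K then
            z ^ P.unluckyCount (coins ω) users adv K else 0) := by
          rw [Finset.sum_add_distrib, ← Finset.mul_sum]
      _ ≤ ∑ ω : Fin L → Bool, z ^ P.unluckyCount (coins ω) users adv K +
          z * (P.R / 2 ^ P.h * ∑ ω : Fin L → Bool, z ^ P.unluckyCount (coins ω) users adv K) := by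
          gcongr
          rw [div_mul_eq_mul_div, le_div_iff₀ h2, mul_comm _ ((2 : ℝ) ^ P.h)]
          exact hev
      _ = (1 + z * P.R / 2 ^ P.h) *
          ∑ ω : Fin L → Bool, z ^ P.unluckyCount (coins ω) users adv K := by ring
      _ ≤ (1 + z * P.R / 2 ^ P.h) * (2 ^ L * (1 + z * P.R / 2 ^ P.h) ^ K) := by
          gcongr
      _ = _ := by ring

-- Markov's inequality for the exponential moment.
open Classical in
lemma card_unlucky_mul_le (hP : P.Valid) {L : ℕ} {z : ℝ} (hz : 1 ≤ z) (K e : ℕ)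
    (hK : K * P.R ≤ L) :
    ((Finset.univ.filter fun ω : Fin L → Bool =>
      e ≤ P.unluckyCount (coins ω) users adv K).card : ℝ) * z ^ e ≤
      2 ^ L * (1 + z * P.R / 2 ^ P.h) ^ K := by
  refine le_trans ?_ (sum_pow_unluckyCount_le (users := users) (adv := adv) hP
    (zero_le_one.trans hz) K hK)
  rw [← nsmul_eq_mul, ← Finset.sum_const, Finset.sum_filter]
  refine Finset.sum_le_sum fun ω _ => ?_
  split_ifs with h
  · exact pow_le_pow_right₀ hz h
  · exact pow_nonneg (zero_le_one.trans hz) _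

end Par
end IndelSim

namespace IndelSim

/-! ### Parameters -/

/-- The scheme for the given numbers. -/
def scheme (q n e N r : ℕ) (S : ℕ → ℕ) : Par := ⟨n, e, N, r, 8 * r.size, q, S⟩

/-- The loss of rate, for `q` symbols. -/
def lossConst (q : ℕ) : ℝ := 4 * (48 + q) + 7

/-- The largest error rate, for `q` symbols. -/
noncomputable def maxRate (q : ℕ) : ℝ := 1 / (32 * lossConst q ^ 2) ^ 2

/-- Relations between the parameters. -/
structure Regime (q : ℕ) (δ l : ℝ) : Prop where
  pos : 0 < δ
  log_eq : Real.log (1 / δ) = l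
  two_le : 2 ≤ l
  loss_pos : 0 < loss δ
  loss_le : lossConst q * loss δ ≤ 1 / 4
  mul_block : δ * blockLength δ = loss δ
  loss_mul : loss δ * blockLength δ = l
  two_le_block : 2 ≤ blockLength δ
  le_loss : δ ≤ loss δ
  le_eighth : δ ≤ 1 / 8

lemma lossConst_ge (q : ℕ) : 199 ≤ lossConst q := by
  unfold lossConst
  have : (0 : ℝ) ≤ q := Nat.cast_nonneg q
  linarith

lemma maxRate_pos (q : ℕ) : 0 < maxRate q := by
  have := lossConst_ge q
  unfold maxRate
  positivity

lemma maxRate_le (q : ℕ) : maxRate q ≤ 1 / 8 := by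
  have h := lossConst_ge q
  unfold maxRate
  apply one_div_le_one_div_of_le (by norm_num)
  have h1 : 1 ≤ lossConst q ^ 2 := by nlinarith
  nlinarith

lemma regime {q : ℕ} {δ : ℝ} (h0 : 0 < δ) (h1 : δ ≤ maxRate q) :
    Regime q δ (Real.log (1 / δ)) := by
  have hC := lossConst_ge q
  have h8 : δ ≤ 1 / 8 := h1.trans (maxRate_le q)
  have hinv : 8 ≤ 1 / δ := by rw [le_div_iff₀ h0]; linarith
  have h2 : 2 ≤ Real.log (1 / δ) := by
    rw [Real.le_log_iff_exp_le (by positivity)]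
    have h3 := Real.exp_one_lt_d9
    have h4 : Real.exp 2 = Real.exp 1 * Real.exp 1 := by rw [← Real.exp_add]; norm_num
    have h5 := Real.exp_pos 1
    nlinarith
  set l := Real.log (1 / δ) with hl
  have hl0 : 0 < l := by linarith
  have hloss : 0 < loss δ := Real.sqrt_pos.mpr (by positivity)
  have hsq : loss δ ^ 2 = δ * l := Real.sq_sqrt (by positivity)
  have hblock : 0 < blockLength δ := Real.sqrt_pos.mpr (by positivity)
  have hbsq : blockLength δ ^ 2 = l / δ := Real.sq_sqrt (by positivity)
  have hm : δ * blockLength δ = loss δ := by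
    apply (sq_eq_sq₀ (by positivity) hloss.le).mp
    rw [mul_pow, hbsq, hsq]; field_simp
  have hlm : loss δ * blockLength δ = l := by
    apply (sq_eq_sq₀ (by positivity) hl0.le).mp
    rw [mul_pow, hbsq, hsq]; field_simp
  have hlossle : lossConst q * loss δ ≤ 1 / 4 := by
    -- Hence `loss δ ^ 2 ≤ 2 √δ`, and `maxRate` is chosen such that `lossConst q ^ 2` times this is
    -- at most `1 / 16`.
    have e1 : l ≤ 2 * √(1 / δ) := by
      have h5 : l = 2 * Real.log (√(1 / δ)) := by
        rw [Real.log_sqrt (by positivity), ← hl]; ring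
      have h6 := Real.log_le_sub_one_of_pos (x := √(1 / δ)) (Real.sqrt_pos.mpr (by positivity))
      linarith
    have e2 : √(1 / δ) * √δ = 1 := by
      rw [← Real.sqrt_mul (by positivity), one_div_mul_cancel h0.ne', Real.sqrt_one]
    have e3 : √δ ^ 2 = δ := Real.sq_sqrt h0.le
    have e4 : √δ ≤ 1 / (32 * lossConst q ^ 2) := by
      rw [Real.sqrt_le_left (by positivity)]
      rw [div_pow, one_pow]; exact h1
    have e5 : loss δ ^ 2 ≤ 2 * √δ := by
      rw [hsq]
      have e6 : δ * l ≤ δ * (2 * √(1 / δ)) := by gcongr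
      have e7 : δ * (2 * √(1 / δ)) = 2 * √δ * (√(1 / δ) * √δ) := by
        linear_combination (-2 * √(1 / δ)) * e3
      rw [e7, e2] at e6
      linarith
    have e8 : (lossConst q * loss δ) ^ 2 ≤ (1 / 4) ^ 2 := by
      rw [le_div_iff₀ (by positivity)] at e4
      rw [mul_pow]
      have : lossConst q ^ 2 * loss δ ^ 2 ≤ lossConst q ^ 2 * (2 * √δ) := by gcongr
      nlinarith
    exact (sq_le_sq₀ (by positivity) (by norm_num)).mp e8
  refine ⟨h0, rfl, h2, hloss, hlossle, hm, hlm, ?_, ?_, h8⟩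
  · have h6 : loss δ ≤ 1 := by nlinarith
    nlinarith
  · apply (sq_le_sq₀ h0.le hloss.le).mp
    rw [hsq]; nlinarith

section numbers

variable {q : ℕ} {δ l : ℝ} (hr : Regime q δ l) {n : ℕ}

lemma Regime.floor_ge (hr : Regime q δ l) : blockLength δ / 2 ≤ ⌊blockLength δ⌋₊ := by
  have := Nat.lt_floor_add_one (blockLength δ)
  have := hr.two_le_block
  linarith

lemma Regime.floor_le (hr : Regime q δ l) : (⌊blockLength δ⌋₊ : ℝ) ≤ blockLength δ :=
  Nat.floor_le (by linarith [hr.two_le_block])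

lemma Regime.header_le (hr : Regime q δ l) :
    ((8 * ⌊blockLength δ⌋₊.size + 8 * ⌊blockLength δ⌋₊.size + q : ℕ) : ℝ) ≤ (48 + q) * l := by
  set r := ⌊blockLength δ⌋₊ with hrdef
  have h0 := hr.pos
  have hB := hr.two_le_block
  have h1 : (r : ℝ) ≤ 1 / δ := by
    refine hr.floor_le.trans ?_
    rw [le_div_iff₀ h0, mul_comm, hr.mul_block]
    have := hr.loss_le
    have := lossConst_ge q
    have := hr.loss_pos
    nlinarith
  have hr1 : 0 < r := by
    have := hr.floor_ge
    rw [← hrdef] at this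
    have : (0 : ℝ) < r := by linarith
    exact_mod_cast this
  have hs : 0 < r.size := Nat.size_pos.mpr hr1
  have h2 : 2 ^ (r.size - 1) ≤ r := Nat.lt_size.mp (by omega)
  have h3 : ((2 : ℝ) ^ (r.size - 1)) ≤ 1 / δ := le_trans (by exact_mod_cast h2) h1
  have h4 := Real.log_le_log (by positivity) h3
  rw [Real.log_pow, hr.log_eq, Nat.cast_sub hs] at h4
  have h5 := Real.log_two_gt_d9
  have h6 := hr.two_le
  -- This is the origin of the constant `48 = 16 · 3`: marker and mask together have length `16 *
  -- r.size`.
  have h7 : (r.size : ℝ) ≤ 3 * l := by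
    have : (1 : ℝ) ≤ r.size := by exact_mod_cast hs
    push_cast at h4
    nlinarith
  have hq : (0 : ℝ) ≤ q := Nat.cast_nonneg q
  push_cast
  nlinarith

lemma Regime.header_le_half (hr : Regime q δ l) :
    2 * ((8 * ⌊blockLength δ⌋₊.size + 8 * ⌊blockLength δ⌋₊.size + q : ℕ) : ℝ) ≤
      ⌊blockLength δ⌋₊ := by
  have h1 := hr.header_le
  have h2 := hr.floor_ge
  have h3 := hr.loss_le
  have h4 := hr.loss_mul
  have h5 := hr.two_le_block
  unfold lossConst at h3
  have h6 : (48 + q) * l ≤ blockLength δ / 16 := by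
    rw [← h4]
    have h7 : (48 + (q : ℝ)) * loss δ ≤ 1 / 16 := by linarith [hr.loss_pos]
    nlinarith
  linarith

lemma Regime.simRounds_le (C : ℝ) (hC : C * loss δ ≤ 1) :
    ((simRounds C δ n / 2 : ℕ) : ℝ) ≤ n * (1 - C * loss δ) / 2 := by
  unfold simRounds
  rw [Nat.mul_div_cancel_left _ (by norm_num)]
  apply Nat.floor_le
  have : (0 : ℝ) ≤ n := Nat.cast_nonneg n
  apply div_nonneg (mul_nonneg this (by linarith)) (by norm_num)

lemma Regime.simRounds_ge (hr : Regime q δ l) (hn : 1 ≤ n * δ) :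
    (n : ℝ) / 2 ≤ simRounds (lossConst q) δ n := by
  unfold simRounds
  have h1 := Nat.lt_floor_add_one ((n : ℝ) * (1 - lossConst q * loss δ) / 2)
  have h2 := hr.loss_le
  have h3 : (8 : ℝ) ≤ n := by
    have := hr.le_eighth
    have h0 : (0 : ℝ) ≤ n := Nat.cast_nonneg n
    nlinarith
  push_cast
  nlinarith

/-- The blocks fit into the communication. -/
lemma Regime.fits (hr : Regime q δ l) (hn : 1 ≤ n * δ) (hev : Even n) (S : ℕ → ℕ) :
    let P := scheme q n ⌊(n : ℝ) * δ⌋₊ (simRounds (lossConst q) δ n) ⌊blockLength δ⌋₊ S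
    P.H < P.R ∧ P.D ≤ (P.D / P.dl + 1) * P.dl ∧
      (P.D / P.dl + 1) * P.R + P.e + P.e < P.n / 2 := by
  intro P
  have hhalf : 2 * (P.H : ℝ) ≤ P.R := hr.header_le_half
  have hH : (P.H : ℝ) ≤ (48 + q) * l := hr.header_le
  have hRB : (P.R : ℝ) ≤ blockLength δ := hr.floor_le
  have hR : blockLength δ / 2 ≤ P.R := hr.floor_ge
  have hB := hr.two_le_block
  have hlt : P.H < P.R := by
    have h1 : (1 : ℝ) ≤ P.R := by linarith
    have h2 : 2 * P.H ≤ P.R := by exact_mod_cast hhalf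
    have h3 : 1 ≤ P.R := by exact_mod_cast h1
    omega
  have hdl : 0 < P.dl := by unfold Par.dl; omega
  refine ⟨hlt, ?_, ?_⟩
  · have := Nat.div_add_mod P.D P.dl
    have := Nat.mod_lt P.D hdl
    rw [Nat.add_mul, Nat.mul_comm]; omega
  · have hdlR : (P.dl : ℝ) = P.R - P.H := by
      unfold Par.dl; rw [Nat.cast_sub hlt.le]
    have h1 : ((P.D / P.dl : ℕ) : ℝ) * P.dl ≤ P.D := by exact_mod_cast Nat.div_mul_le_self _ _
    have hl1 := hr.loss_le
    have hl0 := hr.loss_pos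
    have h2 : (P.D : ℝ) ≤ n * (1 - lossConst q * loss δ) / 2 :=
      Regime.simRounds_le (lossConst q) (by linarith)
    have he : (P.e : ℝ) ≤ n * δ := Nat.floor_le (by linarith)
    -- the overhead of a block
    have hq : (0 : ℝ) ≤ q := Nat.cast_nonneg q
    have hHB : (P.H : ℝ) ≤ (48 + q) * loss δ * blockLength δ := by
      rw [mul_assoc, hr.loss_mul]; exact hH
    -- The header takes at most half of the block, so `dl` is at least a quarter of `blockLength δ`,
    -- and relative to it the header has size at most `4 (48 + q) loss δ`.
    have h3 : (P.R : ℝ) ≤ (1 + 4 * (48 + q) * loss δ) * P.dl := by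
      have h5 : blockLength δ / 4 ≤ P.dl := by rw [hdlR]; linarith
      have h6 : (P.H : ℝ) ≤ 4 * (48 + q) * loss δ * P.dl := by
        have : (48 + (q : ℝ)) * loss δ * blockLength δ ≤
          (48 + q) * loss δ * (4 * P.dl) := by gcongr; linarith
        linarith
      linarith
    have h4 : ((P.D / P.dl : ℕ) : ℝ) * P.R ≤
        (1 + 4 * (48 + q) * loss δ) * (n * (1 - lossConst q * loss δ) / 2) := by
      calc ((P.D / P.dl : ℕ) : ℝ) * P.R
          ≤ ((P.D / P.dl : ℕ) : ℝ) * ((1 + 4 * (48 + q) * loss δ) * P.dl) := by gcongr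
        _ = (1 + 4 * (48 + q) * loss δ) * (((P.D / P.dl : ℕ) : ℝ) * P.dl) := by ring
        _ ≤ _ := by gcongr; linarith
    -- As `n δ ≥ 1`, one incomplete block is no more than the admissible loss.
    have h7 : blockLength δ ≤ n * loss δ := by
      rw [← hr.mul_block]
      nlinarith
    have h8 : n * δ ≤ n * loss δ := by gcongr; exact hr.le_loss
    have hn0 : (0 : ℝ) < n := by
      by_contra hcon
      have : (n : ℝ) * δ ≤ 0 := by
        have := hr.pos
        nlinarith
      linarith
    have h9 : (((P.D / P.dl + 1) * P.R + P.e + P.e : ℕ) : ℝ) < (n : ℝ) / 2 := by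
      push_cast
      -- The part `4 * (48 + q)` of `lossConst q` pays for the headers. The part `7`, halved,
      -- exceeds the `3` units of `n * loss δ` that the incomplete last block and twice the number
      -- of edits may take.
      have h10 : (1 + 4 * (48 + q) * loss δ) * (n * (1 - lossConst q * loss δ) / 2) ≤
          n / 2 - (7 / 2) * (n * loss δ) := by
        unfold lossConst
        have : 0 ≤ (n : ℝ) * loss δ ^ 2 * (4 * (48 + q)) * (4 * (48 + q) + 7) := by positivity
        nlinarith
      have h11 : 0 < n * loss δ := by positivity
      nlinarith
    have h12 : ((P.n / 2 : ℕ) : ℝ) = (n : ℝ) / 2 := by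
      obtain ⟨m, rfl⟩ := hev
      change (((m + m) / 2 : ℕ) : ℝ) = _
      have : (m + m) / 2 = m := by omega
      rw [this]; push_cast; ring
    rw [← h12] at h9
    exact_mod_cast h9

end numbers
end IndelSim

/-! ### The block corruption pattern and the failure probability of the scheme. -/

namespace IndelSim

/-- A set of corruptions in few blocks. -/
lemma isBlockCorruption_of_blocks {N d R : ℕ} {δ' r : ℝ} {E : Finset ℕ} (X : Finset ℕ)
    (hE : E ⊆ Finset.range N) (hd : 0 < d) (hdR : d ≤ R) (hRr : (R : ℝ) ≤ r)
    (hX : ∀ p ∈ E, p / 2 / d ∈ X) (hcard : 2 * (X.card : ℝ) * r ≤ N * δ') :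
    IsBlockCorruption N δ' r E := by
  have hr : 0 < r := by
    have : (1 : ℝ) ≤ R := by exact_mod_cast (by omega : 1 ≤ R)
    linarith
  -- The `d` data symbols of a block and their answers are `2 d` transmitted symbols. Two blocks of
  -- length `d ≤ r` cover them.
  refine ⟨hE, ?_, (X.image fun x => 2 * d * x) ∪ (X.image fun x => 2 * d * x + d), ?_, ?_⟩
  · have h1 : E ⊆ X.biUnion fun x => Finset.Ico (2 * d * x) (2 * d * x + 2 * d) := by
      intro p hp
      rw [Finset.mem_biUnion]
      refine ⟨_, hX p hp, ?_⟩
      rw [Finset.mem_Ico, Nat.div_div_eq_div_mul]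
      have h1 := Nat.div_add_mod p (2 * d)
      have h2 := Nat.mod_lt p (show 0 < 2 * d by omega)
      omega
    have h2 := (Finset.card_le_card h1).trans Finset.card_biUnion_le
    simp only [Nat.card_Ico, Nat.add_sub_cancel_left, Finset.sum_const, smul_eq_mul] at h2
    have h3 : (E.card : ℝ) ≤ X.card * (2 * d) := by exact_mod_cast h2
    have h4 : (d : ℝ) ≤ R := by exact_mod_cast hdR
    have h5 : (0 : ℝ) ≤ X.card := Nat.cast_nonneg _
    nlinarith
  · rw [le_div_iff₀ hr]
    refine le_trans ?_ hcard
    have h1 := Finset.card_union_le (X.image fun x => 2 * d * x) (X.image fun x => 2 * d * x + d)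
    have h2 := Finset.card_image_le (s := X) (f := fun x => 2 * d * x)
    have h3 := Finset.card_image_le (s := X) (f := fun x => 2 * d * x + d)
    have h4 : (((X.image fun x => 2 * d * x) ∪ (X.image fun x => 2 * d * x + d)).card : ℝ) ≤
        2 * X.card := by exact_mod_cast (by omega)
    gcongr
  · intro p hp
    have h1 := Nat.div_add_mod p (2 * d)
    have h2 := Nat.mod_lt p (show 0 < 2 * d by omega)
    have hx := hX p hp
    rw [Nat.div_div_eq_div_mul] at hx
    have h4 : (d : ℝ) ≤ r := le_trans (by exact_mod_cast hdR) hRr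
    rcases Nat.lt_or_ge (p % (2 * d)) d with h | h
    · refine ⟨2 * d * (p / (2 * d)), ?_, by omega, ?_⟩
      · rw [Finset.mem_union, Finset.mem_image]; exact Or.inl ⟨_, hx, rfl⟩
      · have h5 : p < 2 * d * (p / (2 * d)) + d := by omega
        have h6 : (p : ℝ) < (2 * d * (p / (2 * d)) : ℕ) + d := by exact_mod_cast h5
        linarith
    · refine ⟨2 * d * (p / (2 * d)) + d, ?_, by omega, ?_⟩
      · rw [Finset.mem_union, Finset.mem_image, Finset.mem_image]; exact Or.inr ⟨_, hx, rfl⟩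
      · have h5 : p < 2 * d * (p / (2 * d)) + d + d := by omega
        have h6 : (p : ℝ) < (2 * d * (p / (2 * d)) + d : ℕ) + d := by exact_mod_cast h5
        linarith

/-- The error rate, for `ε`-synchronization strings. -/
noncomputable def rateConst (ε : ℝ) : ℝ := 108 / (1 - ε)

/-- The coins matter only through the number of unlucky blocks: as soon as this number is less than
`P.e`, the corruption pattern is admissible. Completion holds for all coins. -/
lemma scheme_simulates {ε δ : ℝ} {q n : ℕ} (hε0 : 0 < ε) (hε : ε < 1) (h0 : 0 < δ)
    (h1 : δ ≤ maxRate q) (hev : Even n) (hn : 1 ≤ n * δ) {S : List (Fin q)} (hlen : S.length = n)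
    (hS : IsSyncString ε S) :
    let P := scheme q n ⌊(n : ℝ) * δ⌋₊ (simRounds (lossConst q) δ n) ⌊blockLength δ⌋₊
      fun i => (S.map Fin.val).getD i 0
    Simulates n ⌊(n : ℝ) * δ⌋₊ (simRounds (lossConst q) δ n) (rateConst ε * loss δ) (blockLength δ)
      (Real.exp (-(1 * (n * δ * Real.log (1 / δ))))) (L := n)
      (fun ω => P.actA (coins ω)) (fun _ => P.actB) := by
  classical
  intro P users adv
  have hr := regime h0 h1
  set l := Real.log (1 / δ) with hl
  obtain ⟨hH, hK, hfit⟩ := hr.fits hn hev fun i => (S.map Fin.val).getD i 0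
  change P.H < P.R at hH
  change P.D ≤ (P.D / P.dl + 1) * P.dl at hK
  change (P.D / P.dl + 1) * P.R + P.e + P.e < P.n / 2 at hfit
  set K := P.D / P.dl + 1 with hKdef
  have hB := hr.two_le_block
  have hRB : (P.R : ℝ) ≤ blockLength δ := hr.floor_le
  have hR2 : blockLength δ / 2 ≤ P.R := hr.floor_ge
  have hR1 : 0 < P.R := by omega
  have hvalid : P.Valid := by
    refine ⟨?_, hH, fun k => ?_⟩
    · have : 0 < P.R.size := Nat.size_pos.mpr hR1
      change 0 < 8 * P.R.size; omega
    · change (S.map Fin.val).getD k 0 ≤ q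
      rw [List.getD_eq_getElem?_getD]
      cases h : (S.map Fin.val)[k]? with
      | none => simp
      | some v =>
        obtain ⟨hk, hv⟩ := List.getElem?_eq_some_iff.mp h
        simp at hv
        simp [← hv]
  have hsync : P.Sync ε := ⟨hε0, hε, fun lo hi M hlo hhi hM =>
    selfMatching_length hε0 hS (by rw [hlen]; exact hhi) hlo M hM⟩
  have heven : Even P.N := ⟨_, two_mul _⟩
  have hpair : ∀ ω : (Fin n → Bool) × (Fin n → Bool),
      pair (fun ω => P.actA (coins ω)) (fun _ => P.actB) ω = P.act (coins ω.1) := by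
    intro ω; funext p; cases p <;> rfl
  have hcor := fun ω : Fin n → Bool => Par.corrupted_bad (ω := coins ω) (users := users)
    (adv := adv) hvalid hsync hev heven hK hfit
  refine ⟨fun ω => by rw [hpair]; exact (hcor ω.1).1, ?_⟩
  -- few unlucky blocks
  have he1 : 1 ≤ P.e := Nat.le_floor (by simpa using hn)
  have he : (P.e : ℝ) ≤ n * δ := Nat.floor_le (by linarith)
  have he2 : n * δ ≤ 2 * P.e := by
    have h2 : n * δ < P.e + 1 := Nat.lt_floor_add_one _
    have h3 : (1 : ℝ) ≤ P.e := by exact_mod_cast he1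
    linarith
  have hgood : ∀ ω : Fin n → Bool, ¬ P.e ≤ P.unluckyCount (coins ω) users adv K →
      IsBlockCorruption P.N (rateConst ε * loss δ) (blockLength δ)
        ((run P.n P.e P.N users (P.act (coins ω)) adv).corrupted P.N) := by
    intro ω hω
    refine isBlockCorruption_of_blocks (d := P.dl) (R := P.R)
      ((Finset.range K).filter fun x => P.Bad (coins ω) users adv ε x)
      (Finset.filter_subset _ _) (by unfold Par.dl; omega) (Nat.sub_le _ _) hRB ?_ ?_
    · intro p hp
      rw [Finset.mem_filter, Finset.mem_range]
      exact (hcor ω).2 p hp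
    · have h2 := Par.card_bad_le (ω := coins ω) (users := users) (adv := adv) hvalid hε K
      -- With fewer than `P.e` unlucky blocks the defects sum up to at most `(5 + 4) P.e`.
      have h3 : ((5 * P.e + 4 * P.unluckyCount (coins ω) users adv K : ℕ) : ℝ) ≤ 9 * P.e := by
        exact_mod_cast (by omega)
      have h4 : (n : ℝ) / 2 ≤ P.N := hr.simRounds_ge hn
      have hε' : 0 < 1 - ε := by linarith
      have h5 : 0 < 3 / (1 - ε) := by positivity
      -- The factor `36` is `2 · 9 · 2`: two covering blocks for each bad block, `9` defects per
      -- edit, and `N ≥ n / 2`.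
      have h6 : rateConst ε = 36 * (3 / (1 - ε)) := by unfold rateConst; ring
      rw [h6, ← hr.mul_block]
      set c := 3 / (1 - ε)
      calc _ ≤ 2 * (c * (9 * (n * δ))) * blockLength δ := by
            gcongr
            exact h2.trans (mul_le_mul_of_nonneg_left (by linarith) h5.le)
        _ = (n / 2) * (36 * c * (δ * blockLength δ)) := by ring
        _ ≤ P.N * (36 * c * (δ * blockLength δ)) := by gcongr
  -- the probability
  set F := Finset.univ.filter fun ω : Fin n → Bool =>
    P.e ≤ P.unluckyCount (coins ω) users adv K with hF
  have hFle : (F.card : ℝ) ≤ 2 ^ n * Real.exp (-(1 * (n * δ * l))) := by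
    -- The factor `8` in the marker length makes `2 ^ h` at least `blockLength δ ^ 8`, which is at
    -- least `(1 / δ) ^ 4` since `blockLength δ ^ 2 ≥ 1 / δ`.
    have hpow : δ * 1 / δ ^ 4 ≤ 2 ^ P.h * δ := by
      have h2 : P.R < 2 ^ P.R.size := Nat.lt_size_self _
      have h3 : blockLength δ ≤ 2 ^ P.R.size := by
        have h4 : blockLength δ < P.R + 1 := Nat.lt_floor_add_one _
        have h5 : ((P.R + 1 : ℕ) : ℝ) ≤ 2 ^ P.R.size := by exact_mod_cast h2
        push_cast at h5
        linarith
      have h4 : 1 / δ ≤ blockLength δ ^ 2 := by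
        rw [div_le_iff₀ h0]
        have h5 := hr.loss_mul
        rw [← hr.mul_block] at h5
        have := hr.two_le
        nlinarith
      have h5 : (1 / δ) ^ 4 ≤ 2 ^ P.h := by
        calc (1 / δ) ^ 4 ≤ (blockLength δ ^ 2) ^ 4 := by gcongr
          _ = blockLength δ ^ 8 := by ring
          _ ≤ (2 ^ P.R.size) ^ 8 := by gcongr
          _ = 2 ^ P.h := by
            rw [← pow_mul]; congr 1; change _ = 8 * P.R.size; ring
      calc δ * 1 / δ ^ 4 = (1 / δ) ^ 4 * δ := by rw [one_div_pow]; ring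
        _ ≤ _ := by gcongr
    have hpow' : (1 / δ) ^ 3 ≤ 2 ^ P.h * δ := by
      refine le_trans (le_of_eq ?_) hpow
      field_simp
    have hone : 1 ≤ 1 / δ := by
      rw [le_div_iff₀ h0]; have := hr.le_eighth; linarith
    -- The moment is taken at `z = 2 ^ h * δ`. Then `1 + z R / 2 ^ h` is `1 + δ R`, whose power `K`
    -- is at most `exp (n δ)`, while `z ^ e` is at least `(1 / δ) ^ (3 e)`.
    have hz : 1 ≤ 2 ^ P.h * δ := (one_le_pow₀ hone).trans hpow'
    have hKR : K * P.R ≤ n := by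
      change _ < n / 2 at hfit; omega
    have hmain := Par.card_unlucky_mul_le (users := users) (adv := adv) (L := n) hvalid hz K P.e hKR
    have e1 : 2 ^ P.h * δ * P.R / 2 ^ P.h = δ * P.R := by
      rw [mul_assoc, mul_div_cancel_left₀ _ (by positivity)]
    have hexp : (1 + δ * P.R) ^ K ≤ Real.exp (2 * P.e) := by
      calc (1 + δ * P.R) ^ K ≤ Real.exp (δ * P.R) ^ K := by
            gcongr
            rw [add_comm]; exact Real.add_one_le_exp _
        _ = Real.exp (K * (δ * P.R)) := by rw [← Real.exp_nat_mul]
        _ ≤ Real.exp (2 * P.e) := by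
            apply Real.exp_le_exp.mpr
            have h6 : ((K * P.R : ℕ) : ℝ) ≤ n := by exact_mod_cast hKR
            push_cast at h6
            nlinarith
    have hinv : 1 / δ = Real.exp l := by
      rw [hl, Real.exp_log (one_div_pos.mpr h0)]
    have hzpow : Real.exp (3 * l * P.e) ≤ (2 ^ P.h * δ) ^ P.e := by
      calc Real.exp (3 * l * P.e) = ((1 / δ) ^ 3) ^ P.e := by
            rw [hinv, ← pow_mul, ← Real.exp_nat_mul, Nat.cast_mul]
            congr 1
            norm_num
            ring
        _ ≤ _ := by gcongr
    rw [e1] at hmain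
    have h7 : (F.card : ℝ) * Real.exp (3 * l * P.e) ≤ 2 ^ n * Real.exp (2 * P.e) := by
      calc (F.card : ℝ) * Real.exp (3 * l * P.e) ≤ F.card * (2 ^ P.h * δ) ^ P.e :=
            mul_le_mul_of_nonneg_left hzpow (Nat.cast_nonneg _)
        _ ≤ 2 ^ n * (1 + δ * P.R) ^ K := hmain
        _ ≤ _ := mul_le_mul_of_nonneg_left hexp (by positivity)
    have h8 : (F.card : ℝ) ≤ 2 ^ n * Real.exp (2 * P.e - 3 * l * P.e) := by
      rw [Real.exp_sub, ← mul_div_assoc, le_div_iff₀ (Real.exp_pos _)]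
      exact h7
    -- As `l ≥ 2`, the exponent `2 e - 3 l e` is at most `-2 l e`, and `n δ ≤ 2 e`.
    refine h8.trans ?_
    gcongr
    have := hr.two_le
    have h9 : (0 : ℝ) ≤ P.e := Nat.cast_nonneg _
    nlinarith
  have hsub : ((Fᶜ ×ˢ (Finset.univ : Finset (Fin n → Bool)) : Finset _) :
      Set ((Fin n → Bool) × (Fin n → Bool))) ⊆
      {ω | IsBlockCorruption P.N (rateConst ε * loss δ) (blockLength δ)
        ((run P.n P.e P.N users (pair (fun ω => P.actA (coins ω)) (fun _ => P.actB) ω)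
          adv).corrupted P.N)} := by
    intro ω hω
    rw [Finset.mem_coe, Finset.mem_product, Finset.mem_compl, hF, Finset.mem_filter] at hω
    rw [Set.mem_ofPred_eq, hpair]
    exact hgood ω.1 fun h => hω.1 ⟨Finset.mem_univ _, h⟩
  have hcard := Set.ncard_le_ncard hsub (Set.toFinite _)
  rw [Set.ncard_coe_finset, Finset.card_product, Finset.card_compl] at hcard
  simp only [Fintype.card_pi, Fintype.card_bool, Finset.prod_const, Finset.card_univ,
    Fintype.card_fin] at hcard
  have hFn : F.card ≤ 2 ^ n := by
    have := Finset.card_le_univ F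
    simpa using this
  have hcard' := (Nat.cast_le (α := ℝ)).mpr hcard
  rw [Nat.cast_mul, Nat.cast_sub hFn] at hcard'
  push_cast at hcard'
  have h2n : (0 : ℝ) < 2 ^ n := by positivity
  rw [le_div_iff₀ (by positivity)]
  refine le_trans ?_ hcard'
  nlinarith

end IndelSim

namespace IndelSim

/-! ### Existence of synchronization strings -/

/-- All strings of length `n`. -/
def words (q n : ℕ) : Finset (List (Fin q)) :=
  (Finset.univ : Finset (Fin n → Fin q)).image List.ofFn

lemma mem_words {q n : ℕ} {w : List (Fin q)} : w ∈ words q n ↔ w.length = n := by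
  unfold words
  rw [Finset.mem_image]
  constructor
  · rintro ⟨f, -, rfl⟩; simp
  · rintro rfl; exact ⟨w.get, Finset.mem_univ _, List.ofFn_get w⟩

lemma card_words (q n : ℕ) : (words q n).card = q ^ n := by
  unfold words
  rw [Finset.card_image_of_injective _ List.ofFn_injective]
  simp

open Classical in
/-- The number of strings with a given subsequence. -/
lemma card_superseq_le (q b : ℕ) (l : List (Fin q)) :
    ((words q b).filter fun y => l.Sublist y).card * q ^ l.length ≤ (2 * q) ^ b := by
  induction b generalizing l with
  | zero =>
    cases l with
    | nil =>
      have := Finset.card_filter_le (words q 0) fun y => ([] : List (Fin q)).Sublist y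
      rw [card_words] at this
      simpa using this
    | cons a l =>
      have : ((words q 0).filter fun y => (a :: l).Sublist y) = ∅ := by
        rw [Finset.filter_eq_empty_iff]
        intro y hy
        rw [mem_words, List.length_eq_zero_iff] at hy
        simp [hy]
      rw [this]; simp
  | succ b ih =>
    cases l with
    | nil =>
      have := Finset.card_filter_le (words q (b + 1)) fun y => ([] : List (Fin q)).Sublist y
      rw [card_words] at this
      simp only [List.length_nil, pow_zero, mul_one]
      exact this.trans (Nat.pow_le_pow_left (by omega) _)
    | cons a l =>
      -- The first letter of a superstring is either matched with `a`, or it is arbitrary and the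
      -- rest still contains `a :: l`.
      have hsub : ((words q (b + 1)).filter fun y => (a :: l).Sublist y) ⊆
          (((words q b).filter fun y => l.Sublist y).image fun y => a :: y) ∪
          ((Finset.univ : Finset (Fin q)) ×ˢ ((words q b).filter fun y => (a :: l).Sublist y)).image
            fun x => x.1 :: x.2 := by
        intro w hw
        rw [Finset.mem_filter, mem_words] at hw
        obtain ⟨h1, h2⟩ := hw
        rw [Finset.mem_union, Finset.mem_image, Finset.mem_image]
        cases h2 with
        | cons c h =>
          right
          exact ⟨(c, _), by simpa [mem_words, h] using h1, rfl⟩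
        | cons_cons c h =>
          left
          exact ⟨_, by simpa [mem_words, h] using h1, rfl⟩
      have h1 := (Finset.card_le_card hsub).trans (Finset.card_union_le _ _)
      have h2 := Finset.card_image_le (s := (words q b).filter fun y => l.Sublist y)
        (f := fun y => a :: y)
      have h3 := Finset.card_image_le (s := (Finset.univ : Finset (Fin q)) ×ˢ
        ((words q b).filter fun y => (a :: l).Sublist y)) (f := fun x => x.1 :: x.2)
      rw [Finset.card_product, Finset.card_univ, Fintype.card_fin] at h3
      have i1 := ih l
      have i2 := ih (a :: l)
      rw [List.length_cons] at i2 ⊢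
      calc _ ≤ (((words q b).filter fun y => l.Sublist y).card +
              q * ((words q b).filter fun y => (a :: l).Sublist y).card) * q ^ (l.length + 1) :=
            Nat.mul_le_mul_right _ (by omega)
        _ = q * (((words q b).filter fun y => l.Sublist y).card * q ^ l.length) +
            q * (((words q b).filter fun y => (a :: l).Sublist y).card * q ^ (l.length + 1)) := by
            ring
        _ ≤ q * (2 * q) ^ b + q * (2 * q) ^ b := by gcongr
        _ = _ := by ring

/-- Strings with a cut for which the parts before and after the cut have a common subsequence of
length `r`. -/
def Repetitive {q : ℕ} (r : ℕ) (u : List (Fin q)) : Prop :=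
  ∃ j < u.length, ∃ l : List (Fin q), l.length = r ∧ l.Sublist (u.take j) ∧ l.Sublist (u.drop j)

-- For each cut `j` there are `q ^ j` first parts with at most `2 ^ j` subsequences each, and
-- `card_superseq_le` counts the second parts that contain a given one. The product is `(2 q) ^ m /
-- q ^ r` for every `j`.
open Classical in
lemma card_repetitive_le (q r m : ℕ) :
    ((words q m).filter (Repetitive r)).card * q ^ r ≤ m * (2 * q) ^ m := by
  have hsub : (words q m).filter (Repetitive r) ⊆ (Finset.range m).biUnion fun j =>
      (words q j).biUnion fun x => (x.sublists.toFinset.filter fun l => l.length = r).biUnion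
        fun l => ((words q (m - j)).filter fun y => l.Sublist y).image fun y => x ++ y := by
    intro u hu
    rw [Finset.mem_filter, mem_words] at hu
    obtain ⟨hm, j, hj, l, h1, h2, h3⟩ := hu
    rw [hm] at hj
    refine Finset.mem_biUnion.mpr ⟨j, Finset.mem_range.mpr hj, Finset.mem_biUnion.mpr ⟨u.take j,
      mem_words.mpr (by simp; omega), Finset.mem_biUnion.mpr ⟨l, ?_, Finset.mem_image.mpr
      ⟨u.drop j, ?_, List.take_append_drop j u⟩⟩⟩⟩
    · rw [Finset.mem_filter, List.mem_toFinset, List.mem_sublists]; exact ⟨h2, h1⟩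
    · rw [Finset.mem_filter, mem_words]; exact ⟨by simp [hm], h3⟩
  have key : ∀ j ∈ Finset.range m, ((words q j).biUnion fun x =>
      (x.sublists.toFinset.filter fun l => l.length = r).biUnion fun l =>
        ((words q (m - j)).filter fun y => l.Sublist y).image fun y => x ++ y).card * q ^ r ≤
      (2 * q) ^ m := by
    intro j hj
    rw [Finset.mem_range] at hj
    have h1 : ∀ x ∈ words q j, ((x.sublists.toFinset.filter fun l => l.length = r).biUnion fun l =>
        ((words q (m - j)).filter fun y => l.Sublist y).image fun y => x ++ y).card * q ^ r ≤
        2 ^ j * (2 * q) ^ (m - j) := by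
      intro x hx
      rw [mem_words] at hx
      calc _ ≤ (∑ l ∈ x.sublists.toFinset.filter fun l => l.length = r,
              (((words q (m - j)).filter fun y => l.Sublist y).image fun y => x ++ y).card) *
              q ^ r := Nat.mul_le_mul_right _ Finset.card_biUnion_le
        _ = ∑ l ∈ x.sublists.toFinset.filter fun l => l.length = r,
              (((words q (m - j)).filter fun y => l.Sublist y).image fun y => x ++ y).card *
              q ^ r := Finset.sum_mul _ _ _
        _ ≤ ∑ l ∈ x.sublists.toFinset.filter fun l => l.length = r, (2 * q) ^ (m - j) := by
            refine Finset.sum_le_sum fun l hl => ?_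
            rw [← (Finset.mem_filter.mp hl).2]
            exact (Nat.mul_le_mul_right _ Finset.card_image_le).trans (card_superseq_le q (m - j) l)
        _ ≤ _ := by
            rw [Finset.sum_const, smul_eq_mul]
            refine Nat.mul_le_mul_right _ ((Finset.card_filter_le _ _).trans ?_)
            refine (List.toFinset_card_le _).trans ?_
            rw [List.length_sublists, hx]
    calc _ ≤ (∑ x ∈ words q j, ((x.sublists.toFinset.filter fun l => l.length = r).biUnion fun l =>
            ((words q (m - j)).filter fun y => l.Sublist y).image fun y => x ++ y).card) * q ^ r :=
          Nat.mul_le_mul_right _ Finset.card_biUnion_le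
      _ = ∑ x ∈ words q j, ((x.sublists.toFinset.filter fun l => l.length = r).biUnion fun l =>
            ((words q (m - j)).filter fun y => l.Sublist y).image fun y => x ++ y).card * q ^ r :=
          Finset.sum_mul _ _ _
      _ ≤ ∑ x ∈ words q j, 2 ^ j * (2 * q) ^ (m - j) := Finset.sum_le_sum h1
      _ = (2 * q) ^ m := by
          rw [Finset.sum_const, card_words, smul_eq_mul, ← mul_assoc, ← mul_pow, mul_comm q 2,
            ← pow_add]
          congr 1; omega
  calc _ ≤ (∑ j ∈ Finset.range m, ((words q j).biUnion fun x =>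
      (x.sublists.toFinset.filter fun l => l.length = r).biUnion fun l =>
        ((words q (m - j)).filter fun y => l.Sublist y).image fun y => x ++ y).card) * q ^ r :=
        Nat.mul_le_mul_right _ ((Finset.card_le_card hsub).trans Finset.card_biUnion_le)
    _ = ∑ j ∈ Finset.range m, ((words q j).biUnion fun x =>
      (x.sublists.toFinset.filter fun l => l.length = r).biUnion fun l =>
        ((words q (m - j)).filter fun y => l.Sublist y).image fun y => x ++ y).card * q ^ r :=
        Finset.sum_mul _ _ _
    _ ≤ ∑ j ∈ Finset.range m, (2 * q) ^ m := Finset.sum_le_sum key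
    _ = _ := by simp

lemma substring_take {α : Type*} (S : List α) {i j n : ℕ} (h : j ≤ n) :
    substring (S.take n) i j = substring S i j := by
  unfold substring
  rw [List.drop_take, List.take_take, min_eq_left (by omega)]

lemma IsSyncString.take {α : Type*} {ε : ℝ} {S : List α} (h : IsSyncString ε S) (n : ℕ) :
    IsSyncString ε (S.take n) := by
  intro i j k hij hjk hk
  rw [List.length_take] at hk
  rw [substring_take _ (by omega), substring_take _ (by omega)]
  exact h i j k hij hjk (by omega)

/-- The last symbol spoils a synchronization string only together with a repetitive end. -/
lemma repetitive_of_not_sync {q n : ℕ} {w : List (Fin q)} (hw : w.length = n + 1)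
    (h : IsSyncString (1 / 2) (w.take n)) (h' : ¬ IsSyncString (1 / 2) w) :
    ∃ i < n, Repetitive ((n + 1 - i + 3) / 4) (w.drop i) := by
  unfold IsSyncString at h'
  push Not at h'
  obtain ⟨i, j, k, hij, hjk, hk, hed⟩ := h'
  -- A violation that avoids the last symbol would already be one in `w.take n`.
  have hkn : k = n + 1 := by
    by_contra hne
    have h1 := h i j k hij hjk (by simp; omega)
    rw [substring_take _ (by omega), substring_take _ (by omega)] at h1
    linarith
  subst hkn
  have hmem := Nat.sInf_mem (s := {d | ∃ l : List (Fin q), l.Sublist (substring w i j) ∧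
    l.Sublist (substring w j (n + 1)) ∧ d = ((substring w i j).length - l.length) +
      ((substring w j (n + 1)).length - l.length)}) ⟨_, [], by simp, by simp, rfl⟩
  obtain ⟨l, h1, h2, h3⟩ := hmem
  have e1 : substring w i j = (w.drop i).take (j - i) := rfl
  have e2 : substring w j (n + 1) = (w.drop i).drop (j - i) := by
    unfold substring
    rw [List.drop_drop, List.take_of_length_le (by simp; omega)]
    congr 1; omega
  have l1 : (substring w i j).length = j - i := by rw [e1]; simp; omega
  have l2 : (substring w j (n + 1)).length = n + 1 - j := by rw [e2]; simp; omega
  have h4 := h1.length_le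
  have h5 := h2.length_le
  rw [l1, l2] at h3
  rw [l1] at h4
  rw [l2] at h5
  have h6 : editDist (substring w i j) (substring w j (n + 1)) =
    j - i - l.length + (n + 1 - j - l.length) := by unfold editDist; rw [l1, l2]; exact h3
  rw [h6] at hed
  -- An edit distance of at most half the total length leaves a common subsequence of at least a
  -- quarter of it.
  have h7 : n + 1 - i ≤ 4 * l.length := by
    have h8 : ((n + 1 - i : ℕ) : ℝ) = ((n + 1 : ℕ) : ℝ) - i := Nat.cast_sub (by omega)
    rw [← h8] at hed
    have h9 : ((2 * (j - i - l.length + (n + 1 - j - l.length)) : ℕ) : ℝ) ≤ (n + 1 - i : ℕ) := by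
      push_cast at hed ⊢
      linarith
    have h10 : 2 * (j - i - l.length + (n + 1 - j - l.length)) ≤ n + 1 - i := by exact_mod_cast h9
    omega
  refine ⟨i, by omega, j - i, by simp; omega, l.take ((n + 1 - i + 3) / 4), ?_,
    (List.take_sublist _ _).trans (e1 ▸ h1), (List.take_sublist _ _).trans (e2 ▸ h2)⟩
  rw [List.length_take]; omega

open Classical in
/-- The synchronization strings of length `n`. -/
noncomputable def syncWords (q n : ℕ) : Finset (List (Fin q)) :=
  (words q n).filter (IsSyncString (1 / 2))

-- Among the extensions of synchronization strings by one letter, those that fail split into a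
-- shorter synchronization string and a repetitive end.
open Classical in
lemma mul_card_syncWords_le (q n : ℕ) : q * (syncWords q n).card ≤ (syncWords q (n + 1)).card +
    ∑ i ∈ Finset.range n, (syncWords q i).card *
      ((words q (n + 1 - i)).filter (Repetitive ((n + 1 - i + 3) / 4))).card := by
  have hsub : (((Finset.univ : Finset (Fin q)) ×ˢ syncWords q n).image fun x => x.2 ++ [x.1]) ⊆
      syncWords q (n + 1) ∪ (Finset.range n).biUnion fun i => (syncWords q i ×ˢ
        ((words q (n + 1 - i)).filter (Repetitive ((n + 1 - i + 3) / 4)))).image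
          fun x => x.1 ++ x.2 := by
    intro w hw
    obtain ⟨⟨a, u⟩, hau, rfl⟩ := Finset.mem_image.mp hw
    obtain ⟨-, hu⟩ := Finset.mem_product.mp hau
    obtain ⟨hu1, hu2⟩ := Finset.mem_filter.mp hu
    dsimp only at hu1 hu2 ⊢
    rw [mem_words] at hu1
    have hlen : (u ++ [a]).length = n + 1 := by simp [hu1]
    have htake : (u ++ [a]).take n = u := by rw [← hu1]; simp
    rw [Finset.mem_union]
    by_cases hs : IsSyncString (1 / 2) (u ++ [a])
    · left; exact Finset.mem_filter.mpr ⟨mem_words.mpr hlen, hs⟩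
    · right
      obtain ⟨i, hi, hrep⟩ := repetitive_of_not_sync hlen (by rw [htake]; exact hu2) hs
      refine Finset.mem_biUnion.mpr ⟨i, Finset.mem_range.mpr hi, Finset.mem_image.mpr
        ⟨((u ++ [a]).take i, (u ++ [a]).drop i), Finset.mem_product.mpr ⟨?_, ?_⟩,
          List.take_append_drop _ _⟩⟩
      · refine Finset.mem_filter.mpr ⟨mem_words.mpr (by simp; omega), ?_⟩
        have : (u ++ [a]).take i = u.take i := by
          rw [List.take_append_of_le_length (by omega)]
        dsimp only
        rw [this]; exact hu2.take i
      · exact Finset.mem_filter.mpr ⟨mem_words.mpr (by simp [hu1]), hrep⟩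
  have h1 := Finset.card_le_card hsub
  rw [Finset.card_image_of_injective _ (by
      rintro ⟨a, u⟩ ⟨b, v⟩ h
      have := List.append_inj' h rfl
      simp at this
      simp [this])] at h1
  rw [Finset.card_product, Finset.card_univ, Fintype.card_fin] at h1
  refine h1.trans ((Finset.card_union_le _ _).trans (Nat.add_le_add_left ?_ _))
  refine Finset.card_biUnion_le.trans (Finset.sum_le_sum fun i _ => ?_)
  exact Finset.card_image_le.trans (Finset.card_product _ _).le

/-- A counting argument in place of the local lemma. By induction the strings of length `i` number
at most `(q / 2) ^ (i - n)` times those of length `n`, and there are at most `(q / 8) ^ m`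
repetitive ends of length `m`. So the failing extensions form a geometric series with ratio `1 / 4`,
and they are at most half of all extensions. -/
lemma syncWords_growth {q : ℕ} (hq : q = 2 ^ 20) (n : ℕ) :
    (q / 2 : ℝ) * (syncWords q n).card ≤ (syncWords q (n + 1)).card := by
  classical
  have hqr : (q : ℝ) = 2 ^ 20 := by rw [hq]; norm_num
  induction n using Nat.strong_induction_on with
  | _ n ih =>
    set c : ℕ → ℝ := fun n => (syncWords q n).card with hc
    have hpow : ∀ i ≤ n, (q / 2 : ℝ) ^ (n - i) * c i ≤ c n := by
      intro i hi
      induction n, hi using Nat.le_induction with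
      | base => simp
      | succ n hn ih' =>
        have h1 := ih' (fun m hm => ih m (by omega))
        have h2 := ih n (by omega)
        rw [Nat.sub_add_comm hn, pow_succ']
        calc _ = (q / 2 : ℝ) * ((q / 2) ^ (n - i) * c i) := by ring
          _ ≤ (q / 2 : ℝ) * c n := by gcongr
          _ ≤ _ := h2
    have hbad : ∀ i < n, c i * (((words q (n + 1 - i)).filter
        (Repetitive ((n + 1 - i + 3) / 4))).card : ℝ) ≤
        (q / 2) * c n * (1 / 4) ^ (n + 1 - i) := by
      intro i hi
      set m := n + 1 - i with hm
      have h1 := card_repetitive_le q ((m + 3) / 4) m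
      set b := ((words q m).filter (Repetitive ((m + 3) / 4))).card
      -- The size `2 ^ 20` is chosen for this: a quarter of the exponent yields `32 ^ m`, which
      -- turns the bound `m (2 q) ^ m` into `(q / 8) ^ m`.
      have h2 : (32 : ℕ) ^ m ≤ q ^ ((m + 3) / 4) := by
        rw [hq, show (32 : ℕ) = 2 ^ 5 by norm_num, ← pow_mul, ← pow_mul]
        exact Nat.pow_le_pow_right (by norm_num) (by omega)
      have h3 : b * 32 ^ m ≤ m * (2 * q) ^ m := (Nat.mul_le_mul_left _ h2).trans h1
      have h4 : m ≤ 2 ^ m := Nat.lt_two_pow_self.le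
      have h5 : b * 32 ^ m ≤ 2 ^ m * (2 * q) ^ m := h3.trans (Nat.mul_le_mul_right _ h4)
      have h6 : (b : ℝ) * 32 ^ m ≤ 2 ^ m * (2 * q) ^ m := by exact_mod_cast h5
      have h7 : (b : ℝ) ≤ (q / 8) ^ m := by
        have e : ((q : ℝ) / 8) ^ m * 32 ^ m = 2 ^ m * (2 * q) ^ m := by
          rw [← mul_pow, ← mul_pow]; congr 1; ring
        rw [← e] at h6
        exact le_of_mul_le_mul_right h6 (by positivity)
      have h8 := hpow i hi.le
      have h9 : n - i + 1 = m := by omega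
      have h10 : ((q : ℝ) / 8) ^ m = (q / 2) * (q / 2) ^ (n - i) * (1 / 4) ^ m := by
        rw [← pow_succ', h9, ← mul_pow]; congr 1; ring
      have hci : 0 ≤ c i := Nat.cast_nonneg _
      calc c i * (b : ℝ) ≤ c i * (q / 8) ^ m := by gcongr
        _ = (q / 2) * ((q / 2) ^ (n - i) * c i) * (1 / 4) ^ m := by rw [h10]; ring
        _ ≤ _ := by gcongr
    have hsum : ∑ i ∈ Finset.range n, ((1 : ℝ) / 4) ^ (n + 1 - i) ≤ 1 := by
      have h1 : ∀ n : ℕ, ∑ i ∈ Finset.range n, ((1 : ℝ) / 4) ^ (n + 1 - i) ≤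
          1 - (1 / 4) ^ n := by
        intro n
        induction n with
        | zero => simp
        | succ n ih =>
          have e : ∑ i ∈ Finset.range n, ((1 : ℝ) / 4) ^ (n + 1 + 1 - i) =
              1 / 4 * ∑ i ∈ Finset.range n, ((1 : ℝ) / 4) ^ (n + 1 - i) := by
            rw [Finset.mul_sum]
            refine Finset.sum_congr rfl fun i hi => ?_
            rw [Finset.mem_range] at hi
            rw [← pow_succ']; congr 1; omega
          rw [Finset.sum_range_succ, e]
          have e2 : n + 1 + 1 - n = 2 := by omega
          have h16 : ((1 : ℝ) / 4) ^ 2 = 1 / 16 := by norm_num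
          rw [e2, h16, pow_succ]
          have h4 : ((1 : ℝ) / 4) ^ n ≤ 1 := pow_le_one₀ (by norm_num) (by norm_num)
          have : (0 : ℝ) ≤ (1 / 4) ^ n := by positivity
          linarith
      have : (0 : ℝ) ≤ (1 / 4) ^ n := by positivity
      linarith [h1 n]
    have h1 : (q : ℝ) * c n ≤ c (n + 1) + ∑ i ∈ Finset.range n, c i *
        (((words q (n + 1 - i)).filter (Repetitive ((n + 1 - i + 3) / 4))).card : ℝ) := by
      simp only [hc]
      exact_mod_cast mul_card_syncWords_le q n
    have h2 : ∑ i ∈ Finset.range n, c i * (((words q (n + 1 - i)).filter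
        (Repetitive ((n + 1 - i + 3) / 4))).card : ℝ) ≤ (q / 2) * c n := by
      refine (Finset.sum_le_sum fun i hi => hbad i (Finset.mem_range.mp hi)).trans ?_
      rw [← Finset.mul_sum]
      have : 0 ≤ c n := Nat.cast_nonneg _
      have h3 : 0 ≤ (q / 2) * c n := by positivity
      nlinarith
    change _ * c n ≤ c (n + 1)
    linarith

/-- There are synchronization strings of every length over some finite alphabet. -/
lemma exists_syncString (n : ℕ) :
    ∃ S : List (Fin (2 ^ 20)), S.length = n ∧ IsSyncString (1 / 2) S := by
  classical
  have h : 0 < (syncWords (2 ^ 20) n).card := by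
    induction n with
    | zero =>
      rw [Finset.card_pos]
      exact ⟨[], Finset.mem_filter.mpr ⟨mem_words.mpr rfl,
        fun i j k h1 h2 h3 => by simp at h3; omega⟩⟩
    | succ n ih =>
      have h1 := syncWords_growth (q := 2 ^ 20) rfl n
      have h2 : (0 : ℝ) < (syncWords (2 ^ 20) n).card := by exact_mod_cast ih
      have h3 : (0 : ℝ) < (syncWords (2 ^ 20) (n + 1)).card := 
        lt_of_lt_of_le (mul_pos (by norm_num) h2) h1
      exact_mod_cast h3
  obtain ⟨S, hS⟩ := Finset.card_pos.mp h
  obtain ⟨h1, h2⟩ := Finset.mem_filter.mp hS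
  exact ⟨S, mem_words.mp h1, h2⟩

end IndelSim

namespace IndelSim

/-! ### A channel without edits -/

/-- The intermediary that passes on what it receives. -/
def passOn (N : ℕ) (ev : List Event) : Action :=
  match ev.getLast? with
  | some (.channel y) => if (channelBits ev).length ≤ N / 2 then .reveal y else .send false
  | some (.user x) => .send x
  | _ => .send false

/-- What it sends after it has received `w`. -/
def passOut (N : ℕ) (users : Users) (p : Party) (w : List Bool) : Bool :=
  if w ≠ [] ∧ (N / 2 < w.length ∨ p = .alice ∧ N / 2 ≤ w.length) then false else users p w

lemma reacts_passOn (N : ℕ) (users : Users) (p : Party) :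
    Reacts N users p (passOn N) (fun w => w.take (N / 2)) (passOut N users p) where
  rev_nil := by simp
  rev_prefix w b := by rw [List.take_append]; exact List.prefix_append _ _
  rev_le w := by simp
  reveal w b j h1 h2 := by
    simp only [List.length_take, List.length_append, List.length_singleton] at h1 h2
    obtain rfl : j = w.length := by omega
    have hl : (w.take (N / 2)).length = w.length := by simp; omega
    have hans : answers N users p ((w ++ [b]).take (N / 2)) (w.take (N / 2)).length w.length =
        [] := by simp [answers, hl]
    rw [hans]
    unfold passOn
    rw [List.getLast?_concat, channelBits_append, channelBits_viewOf]
    simp only [channelBits_channel]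
    rw [if_pos (by simp [channelBits]; omega)]
    simp
  send w hw := by
    rcases List.eq_nil_or_concat w with rfl | ⟨w, b, rfl⟩
    · have hp : p = .alice := by rcases hw with h | h; exacts [absurd rfl h, h]
      subst hp
      simp [viewOf_nil, initEvents, passOn, passOut]
    · rw [List.concat_eq_append]
      have hc : (channelBits (viewOf N users p (fun w => w.take (N / 2)) (w ++ [b]))).length =
          w.length + 1 := by rw [channelBits_viewOf]; simp
      unfold passOn
      rw [hc, viewOf_append, List.getLast?_append, List.getLast?_cons]
      rcases Nat.lt_or_ge (N / 2) (w.length + 1) with h | h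
      · have hans : answers N users p ((w ++ [b]).take (N / 2)) (w.take (N / 2)).length
            ((w ++ [b]).take (N / 2)).length = [] := by simp [answers]; omega
        rw [hans]
        simp [passOut, h]
        omega
      · rw [Par.getLast?_answers N users p _ (by simp; omega), List.take_of_length_le
          (l := (w ++ [b])) (by simp; omega), List.take_length]
        simp only [Option.getD_some, Option.some_or, answer, passOut, List.length_append,
          List.length_singleton]
        by_cases hp : p = .alice ∧ N / 2 ≤ w.length + 1
        · rw [if_pos hp, if_pos ⟨by simp, Or.inr hp⟩]
        · rw [if_neg hp, if_neg]
          rintro ⟨-, h' | h'⟩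
          · omega
          · exact hp h'

/-- This settles `n δ < 1`: no edit is possible, and a block of the scheme need not even fit into
the communication. -/
lemma passOn_run {n N : ℕ} (hn : Even n) (hN : Even N) (hle : N ≤ n) (users : Users)
    (adv : Adversary) : (run n 0 N users (fun _ => passOn N) adv).Completes N ∧
      (run n 0 N users (fun _ => passOn N) adv).corrupted N = ∅ := by
  obtain ⟨hcomp, w, h1, h2, h3⟩ := run_spec (n := n) (e := 0) (adv := adv)
    (fun p => reacts_passOn N users p) hn (fun p w hw => by simp; omega)
  refine ⟨hcomp, ?_⟩
  set rd := round 0 adv (fun p => viewOf N users p (fun w => w.take (N / 2))) (passOut N users)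
    with hrd
  have hed : ∀ p, (rd p).edits = 0 := fun p => Nat.le_zero.mp (round_spec p).2.2.1
  have hstep : ∀ p, (rd (p + 1)).received .bob = (rd p).received .bob ++
        [passOut N users .alice ((rd p).received .alice)] ∧
      (rd (p + 1)).received .alice = (rd p).received .alice ++
        [passOut N users .bob ((rd (p + 1)).received .bob)] := by
    intro p
    have hs := (round_spec (e := 0) (adv := adv)
      (view := fun p => viewOf N users p (fun w => w.take (N / 2))) (out := passOut N users)
      p).2.2.2
    obtain ⟨y, hy, hy'⟩ := hs.alice
    have he : (rd (p + 1)).edits = (rd p).edits := by rw [hed, hed]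
    refine ⟨hs.bob_clean he, ?_⟩
    rw [hy' he] at hy
    exact hy
  have hA : ∀ p, ((rd p).received .alice).length = p := fun p => (round_spec p).2.1
  have hB : ∀ p, ((rd p).received .bob).length = p := by
    intro p
    induction p with
    | zero => rfl
    | succ p ih => rw [(hstep p).1]; simp [ih]
  unfold Config.corrupted
  rw [Finset.filter_eq_empty_iff]
  intro p hp
  rw [Finset.mem_range] at hp
  have hi : p / 2 < N / 2 := by obtain ⟨d, rfl⟩ := hN; omega
  set i := p / 2
  obtain ⟨tB, htB⟩ : (rd (i + 1)).received .bob <+: w .bob := h3 (i + 1) .bob (by omega)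
  obtain ⟨tA, htA⟩ : (rd (i + 1)).received .alice <+: w .alice := h3 (i + 1) .alice (by omega)
  have hlA := hA i
  have hlB := hB i
  have hlB' := hB (i + 1)
  have hlA' := hA (i + 1)
  have tk : ∀ {u t : List Bool} {j : ℕ}, u.length = j → j ≤ N / 2 →
      ((u ++ t).take (N / 2)).take j = u := by
    intro u t j hu hj
    rw [List.take_take, min_eq_left hj, ← hu, List.take_left']
    rfl
  have gA : ((run n 0 N users (fun _ => passOn N) adv).given .alice)[i]? =
      some (users .alice ((rd i).received .alice)) := by
    rw [h2 .alice, ← htA, (hstep i).2, List.append_assoc, givenOf_alice_getElem? _ _ _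
      (by simp; omega) hi, tk hlA hi.le]
  have rB : ((run n 0 N users (fun _ => passOn N) adv).revealed .bob)[i]? =
      some (users .alice ((rd i).received .alice)) := by
    rw [h1 .bob, ← htB, (hstep i).1, List.getElem?_take_of_lt hi, List.append_assoc,
      List.getElem?_append_right (by omega), hlB, Nat.sub_self]
    simp only [List.singleton_append, List.getElem?_cons_zero, passOut]
    rw [if_neg]
    rintro ⟨-, h | h⟩ <;> omega
  have gB : ((run n 0 N users (fun _ => passOn N) adv).given .bob)[i]? =
      some (users .bob ((rd (i + 1)).received .bob)) := by
    rw [h2 .bob, ← htB, givenOf_bob_getElem? _ _ _ (by simp; omega), tk hlB' hi]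
  have rA : ((run n 0 N users (fun _ => passOn N) adv).revealed .alice)[i]? =
      some (users .bob ((rd (i + 1)).received .bob)) := by
    rw [h1 .alice, ← htA, (hstep i).2, List.getElem?_take_of_lt hi, List.append_assoc,
      List.getElem?_append_right (by omega), hlA, Nat.sub_self]
    simp only [List.singleton_append, List.getElem?_cons_zero, passOut]
    rw [if_neg]
    rintro ⟨-, h | h⟩
    · omega
    · exact absurd h.1 (by decide)
  rw [gA, rB, gB, rA]
  simp

lemma passOn_simulates {n N : ℕ} (hn : Even n) (hN : Even N) (hle : N ≤ n) {δ' r η : ℝ}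
    (hδ' : 0 ≤ δ') (hr : 0 ≤ r) (hη : 0 ≤ η) (L : ℕ) :
    Simulates n 0 N δ' r η (L := L) (fun _ => passOn N) (fun _ => passOn N) := by
  intro users adv
  have hpair : ∀ ω : (Fin L → Bool) × (Fin L → Bool),
      pair (fun _ => passOn N) (fun _ => passOn N) ω = fun _ => passOn N := by
    intro ω; funext p; cases p <;> rfl
  have h := passOn_run hn hN hle users adv
  refine ⟨fun ω => by rw [hpair]; exact h.1, ?_⟩
  have huniv : {ω : (Fin L → Bool) × (Fin L → Bool) | IsBlockCorruption N δ' r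
      ((run n 0 N users (pair (fun _ => passOn N) (fun _ => passOn N) ω) adv).corrupted N)} =
      Set.univ := by
    rw [Set.eq_univ_iff_forall]
    intro ω
    rw [Set.mem_ofPred_eq, hpair, h.2]
    refine ⟨by simp, by simp; positivity, ∅, by simp; positivity, by simp⟩
  rw [huniv, Set.ncard_univ]
  simp only [Nat.card_eq_fintype_card, Fintype.card_prod, Fintype.card_pi, Fintype.card_bool,
    Finset.prod_const, Finset.card_univ, Fintype.card_fin]
  push_cast
  rw [div_self (by positivity)]
  linarith

end IndelSim

namespace IndelSim

/-! ### Programs with bounded loops -/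

/-- Programs in which every loop is a for-loop: `rep a j c P` repeats `P` as often as the number in
cell `j` of array `0` plus `c` says, and counts in array `a`. -/
inductive FProg
  | put (a : ℕ) (i x : Expr)
  | seq (P Q : FProg)
  | ite (x : Expr) (P Q : FProg)
  | rep (a j c : ℕ) (P : FProg)

/-- Assignment to a cell of the memory. -/
def Mem.set (m : Mem) (a i v : ℕ) : Mem := Function.update m a (Function.update (m a) i v)

lemma Mem.set_apply (m : Mem) (a i v b k : ℕ) :
    m.set a i v b k = if b = a then if k = i then v else m b k else m b k := by
  unfold Mem.set
  by_cases h : b = a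
  · subst h; simp [Function.update_apply]
  · simp [h]

lemma Mem.set_ne (m : Mem) {a b : ℕ} (i v : ℕ) (h : b ≠ a) : m.set a i v b = m b := by
  unfold Mem.set; rw [Function.update_of_ne h]

/-- The number in the first cell of an array. -/
abbrev Expr.var (a : ℕ) : Expr := .load a (.lit 0)

namespace FProg

/-- Assignment to the first cell of an array. -/
abbrev set (a : ℕ) (x : Expr) : FProg := put a (.lit 0) x

/-- The effect of a program. -/
def den : FProg → Mem → Mem
  | put a i x, m => m.set a (i.eval m) (x.eval m)
  | seq P Q, m => den Q (den P m)
  | ite x P Q, m => if x.eval m ≠ 0 then den P m else den Q m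
  | rep a j c P, m => (fun m' => (den P m').set a 0 (m' a 0 + 1))^[m 0 j + c] (m.set a 0 0)

/-- The arrays in which a program writes. -/
def writes : FProg → List ℕ
  | put a _ _ => [a]
  | seq P Q => writes P ++ writes Q
  | ite _ P Q => writes P ++ writes Q
  | rep a _ _ P => a :: writes P

/-- Parameters and counters are protected. -/
def Wf : FProg → Prop
  | put a _ _ => a ≠ 0
  | seq P Q => Wf P ∧ Wf Q
  | ite _ P Q => Wf P ∧ Wf Q
  | rep a j _ P => Wf P ∧ a ≠ 0 ∧ a ∉ writes P ∧ (j = 0 ∨ j = 4)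

/-- The guard is the limit minus the counter, computed anew for every pass. The number of passes is
the intended one because, by `Wf`, the body changes neither array `0` nor the counter. -/
def compile : FProg → Prog
  | put a i x => .store a i x
  | seq P Q => .seq (compile P) (compile Q)
  | ite x P Q => .cond x (compile P) (compile Q)
  | rep a j c P => .seq (.store a (.lit 0) (.lit 0))
      (.loop (.sub (.add (.load 0 (.lit j)) (.lit c)) (.var a))
        (.seq (compile P) (.store a (.lit 0) (.add (.var a) (.lit 1)))))

/-- A bound for the number of steps. -/
def bound (B : ℕ) : FProg → ℕ
  | put _ i x => i.cost + x.cost + 1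
  | seq P Q => bound B P + bound B Q
  | ite x P Q => x.cost + 1 + (bound B P + bound B Q)
  -- Initialization takes `3` steps, a pass `8` for the guard and `6` for the counter besides the
  -- body, and the last guard `8`. The number of passes is at most `(c + 1) * B`.
  | rep _ _ c P => 3 + ((c + 1) * B * (14 + bound B P) + 8)

/-- Each loop raises the degree by one. For compositions the sum of the degrees serves as a common
degree. -/
lemma bound_le (P : FProg) : ∃ K d, ∀ B, 1 ≤ B → bound B P ≤ K * B ^ d := by
  induction P with
  | put a i x => exact ⟨i.cost + x.cost + 1, 0, fun B _ => by simp [bound]⟩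
  | seq P Q hP hQ =>
    obtain ⟨K, d, h⟩ := hP
    obtain ⟨K', d', h'⟩ := hQ
    refine ⟨K + K', d + d', fun B hB => ?_⟩
    have h1 : B ^ d ≤ B ^ (d + d') := Nat.pow_le_pow_right hB (by omega)
    have h2 : B ^ d' ≤ B ^ (d + d') := Nat.pow_le_pow_right hB (by omega)
    calc bound B P + bound B Q ≤ K * B ^ d + K' * B ^ d' := Nat.add_le_add (h B hB) (h' B hB)
      _ ≤ K * B ^ (d + d') + K' * B ^ (d + d') := by gcongr
      _ = _ := by ring
  | ite x P Q hP hQ =>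
    obtain ⟨K, d, h⟩ := hP
    obtain ⟨K', d', h'⟩ := hQ
    refine ⟨x.cost + 1 + (K + K'), d + d', fun B hB => ?_⟩
    have h1 : B ^ d ≤ B ^ (d + d') := Nat.pow_le_pow_right hB (by omega)
    have h2 : B ^ d' ≤ B ^ (d + d') := Nat.pow_le_pow_right hB (by omega)
    have h3 : 1 ≤ B ^ (d + d') := Nat.one_le_pow _ _ hB
    calc x.cost + 1 + (bound B P + bound B Q)
        ≤ (x.cost + 1) * 1 + (K * B ^ d + K' * B ^ d') := by
          have := h B hB; have := h' B hB; omega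
      _ ≤ (x.cost + 1) * B ^ (d + d') + (K * B ^ (d + d') + K' * B ^ (d + d')) := by gcongr
      _ = _ := by ring
  | rep a j c P hP =>
    obtain ⟨K, d, h⟩ := hP
    refine ⟨11 + (c + 1) * (14 + K), d + 1, fun B hB => ?_⟩
    have h1 : B ^ d ≤ B ^ (d + 1) := Nat.pow_le_pow_right hB (by omega)
    have h2 : 1 ≤ B ^ d := Nat.one_le_pow _ _ hB
    calc 3 + ((c + 1) * B * (14 + bound B P) + 8)
        ≤ 11 * B ^ (d + 1) + (c + 1) * B * (14 * B ^ d + K * B ^ d) := by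
          have h3 : 14 + bound B P ≤ 14 * B ^ d + K * B ^ d :=
            Nat.add_le_add (by omega) (h B hB)
          have h4 := Nat.mul_le_mul_left ((c + 1) * B) h3
          omega
      _ = _ := by ring

/-- The frame rule, by which facts about the memory are carried past subprograms. -/
lemma den_of_notMem (P : FProg) {a : ℕ} (h : a ∉ writes P) (m : Mem) : den P m a = m a := by
  induction P generalizing m with
  | put b i x => exact Mem.set_ne _ _ _ (by simpa [writes] using h)
  | seq P Q hP hQ =>
    simp only [writes, List.mem_append, not_or] at h
    rw [den, hQ h.2, hP h.1]
  | ite x P Q hP hQ =>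
    simp only [writes, List.mem_append, not_or] at h
    rw [den]
    split_ifs
    · exact hP h.1 m
    · exact hQ h.2 m
  | rep b j c P hP =>
    simp only [writes, List.mem_cons, not_or] at h
    rw [den]
    have : ∀ t, (fun m' => (den P m').set b 0 (m' b 0 + 1))^[t] (m.set b 0 0) a = m a := by
      intro t
      induction t with
      | zero => exact Mem.set_ne _ _ _ h.1
      | succ t ih => rw [Function.iterate_succ_apply', Mem.set_ne _ _ _ h.1, hP h.2, ih]
    exact this _

lemma zero_notMem {P : FProg} (h : Wf P) : 0 ∉ writes P := by
  induction P with
  | put a i x => simpa [writes] using Ne.symm h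
  | seq P Q hP hQ => simp [writes, hP h.1, hQ h.2]
  | ite x P Q hP hQ => simp [writes, hP h.1, hQ h.2]
  | rep a j c P hP => simp [writes, hP h.1, Ne.symm h.2.1]

/-- The rule for loops. -/
lemma rep_induct {a j c : ℕ} {P : FProg} (m : Mem) (I : ℕ → Mem → Prop)
    (h0 : I 0 (m.set a 0 0))
    (hI : ∀ x < m 0 j + c, ∀ m', (∀ b ∉ writes (rep a j c P), m' b = m b) → m' a 0 = x → I x m' →
      I (x + 1) ((den P m').set a 0 (x + 1))) :
    I (m 0 j + c) (den (rep a j c P) m) := by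
  rw [den]
  have key : ∀ t ≤ m 0 j + c, I t ((fun m' => (den P m').set a 0 (m' a 0 + 1))^[t] (m.set a 0 0)) ∧
      (fun m' => (den P m').set a 0 (m' a 0 + 1))^[t] (m.set a 0 0) a 0 = t ∧
      ∀ b ∉ writes (rep a j c P),
        (fun m' => (den P m').set a 0 (m' a 0 + 1))^[t] (m.set a 0 0) b = m b := by
    intro t
    induction t with
    | zero =>
      refine fun _ => ⟨h0, by simp [Mem.set_apply], fun b hb => Mem.set_ne _ _ _ ?_⟩
      simp only [writes, List.mem_cons, not_or] at hb
      exact hb.1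
    | succ t ih =>
      intro ht
      obtain ⟨i1, i2, i3⟩ := ih (by omega)
      rw [Function.iterate_succ_apply', i2]
      refine ⟨hI t (by omega) _ i3 i2 i1, by simp [Mem.set_apply], fun b hb => ?_⟩
      have hb' := hb
      simp only [writes, List.mem_cons, not_or] at hb
      rw [Mem.set_ne _ _ _ hb.1, den_of_notMem P hb.2, i3 b hb']
  exact (key _ le_rfl).1

/-- `B` only has to bound the two cells that can limit loops. Array `0` is never written, so the
bound remains valid for all subprograms. -/
lemma exec_compile {P : FProg} (h : Wf P) {B : ℕ} (m : Mem) (h0 : m 0 0 + 1 ≤ B)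
    (h4 : m 0 4 + 1 ≤ B) : ∃ t ≤ bound B P, Exec (compile P) m t (den P m) := by
  induction P generalizing m with
  | put a i x => exact ⟨_, le_rfl, .store a i x m⟩
  | seq P Q hP hQ =>
    obtain ⟨t, ht, e⟩ := hP h.1 m h0 h4
    have hz := den_of_notMem P (zero_notMem h.1) m
    obtain ⟨t', ht', e'⟩ := hQ h.2 (den P m) (by rwa [hz]) (by rwa [hz])
    exact ⟨t + t', Nat.add_le_add ht ht', .seq e e'⟩
  | ite x P Q hP hQ =>
    rw [den]
    split_ifs with hx
    · obtain ⟨t, ht, e⟩ := hP h.1 m h0 h4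
      exact ⟨_, by unfold bound; omega, .condTrue hx e⟩
    · obtain ⟨t, ht, e⟩ := hQ h.2 m h0 h4
      exact ⟨_, by unfold bound; omega, .condFalse (by simpa using hx) e⟩
  | rep a j c P hP =>
    obtain ⟨hwf, ha0, haw, hj⟩ := h
    set M := m 0 j + c with hM
    set f := fun m' : Mem => (den P m').set a 0 (m' a 0 + 1) with hf
    set x : Expr := .sub (.add (.load 0 (.lit j)) (.lit c)) (.var a) with hx
    have hxc : x.cost = 7 := rfl
    have key : ∀ s ≤ M, ∀ m', m' 0 = m 0 → m' a 0 + s = M → ∃ t ≤ s * (14 + bound B P) + 8,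
        Exec (.loop x (.seq (compile P) (.store a (.lit 0) (.add (.var a) (.lit 1))))) m' t
          (f^[s] m') := by
      intro s
      induction s with
      | zero =>
        intro _ m' hm' hs
        refine ⟨_, ?_, .loopEnd ?_⟩
        · rw [hxc]; omega
        · simp only [hx, Expr.eval, hm']; omega
      | succ s ih =>
        intro hsM m' hm' hs
        obtain ⟨t, ht, e⟩ := hP hwf m' (by rwa [hm']) (by rwa [hm'])
        have hfm : (den P m').set a 0 (den P m' a 0 + 1) = f m' := by
          simp only [hf]; rw [den_of_notMem P haw]
        have hz := den_of_notMem P (zero_notMem hwf) m'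
        obtain ⟨t', ht', e'⟩ := ih (by omega) (f m')
          (by simp only [hf]; rw [Mem.set_ne _ _ _ (Ne.symm ha0), hz, hm'])
          (by simp [hf, Mem.set_apply]; omega)
        have es := Exec.seq e (Exec.store a (.lit 0) (.add (.var a) (.lit 1)) (den P m'))
        rw [Function.iterate_succ_apply]
        refine ⟨_, ?_, .loopStep ?_ es (by
          change Exec _ ((den P m').set a 0 (den P m' a 0 + 1)) _ _
          rw [hfm]; exact e')⟩
        · rw [hxc]
          simp only [Expr.cost]
          rw [Nat.add_mul, Nat.one_mul]; omega
        · simp only [hx, Expr.eval, hm']; omega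
    obtain ⟨t, ht, e⟩ := key M le_rfl (m.set a 0 0) (Mem.set_ne _ _ _ (Ne.symm ha0))
      (by simp [Mem.set_apply])
    refine ⟨3 + t, ?_, Exec.seq (Exec.store a (.lit 0) (.lit 0) m) e⟩
    unfold bound
    have hMB : M ≤ (c + 1) * B := by
      rw [Nat.add_mul, Nat.one_mul]
      have : c ≤ c * B := Nat.le_mul_of_pos_right _ (by omega)
      rcases hj with rfl | rfl <;> omega
    have := Nat.mul_le_mul_right (14 + bound B P) hMB
    omega

end FProg
end IndelSim

namespace IndelSim

set_option linter.unusedSimpArgs false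

namespace FProg

/-! ### Reading the events

Arrays `6` to `10` receive the number and the list of the symbols that have arrived over the
channel, the number and the list of the symbols given by the user,
  and the code of the last event. -/

/-- Does nothing of interest. -/
def skip : FProg := set 40 (.lit 0)

/-- Truncated subtraction serves for comparisons: `x - 2` is nonzero for channel symbols, `2 - x`
for symbols from the user, and both vanish for the notice. -/
def readEvent : FProg :=
  seq (set 10 (.load 3 (.var 5)))
    (ite (.sub (.var 10) (.lit 2))
      (seq (put 7 (.var 6) (.sub (.var 10) (.lit 3))) (set 6 (.add (.var 6) (.lit 1))))
      (ite (.sub (.lit 2) (.var 10))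
        (seq (put 9 (.var 8) (.var 10)) (set 8 (.add (.var 8) (.lit 1))))
        skip))

/-- The initial `2` is the code of the notice, which `lastCode` takes as its default if there is no
event. -/
def readEvents : FProg := seq (set 10 (.lit 2)) (rep 5 4 0 readEvent)

lemma wf_readEvents : Wf readEvents := by
  simp [readEvents, readEvent, Wf, skip, writes]

end FProg

open FProg

/-- The code of the last event. -/
def lastCode (ev : List Event) : ℕ := (ev.getLast?.map Event.code).getD 2

/-- The bits of a list as numbers. -/
def bitArray (w : List Bool) (i : ℕ) : ℕ := (w.getD i false).toNat

lemma bitArray_append (w : List Bool) (b : Bool) (i : ℕ) :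
    bitArray (w ++ [b]) i = if i = w.length then b.toNat else bitArray w i := by
  unfold bitArray
  simp only [List.getD_eq_getElem?_getD]
  split_ifs with h
  · subst h; simp
  · rcases Nat.lt_or_gt_of_ne h with h | h
    · rw [List.getElem?_append_left h]
    · rw [List.getElem?_eq_none (by simp; omega), List.getElem?_eq_none (by omega)]

/-- The events have been read. -/
structure HasRead (ev : List Event) (m : Mem) : Prop where
  channel_length : m 6 0 = (channelBits ev).length
  channel : ∀ i, m 7 i = bitArray (channelBits ev) i
  user_length : m 8 0 = (userBits ev).length
  user : ∀ i, m 9 i = bitArray (userBits ev) i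
  last : m 10 0 = lastCode ev

lemma hasRead_readEvents {ev : List Event} {m : Mem}
    (h3 : ∀ i, m 3 i = (ev.map Event.code).getD i 0) (h04 : m 0 4 = ev.length)
    (hfree : ∀ a, 4 ≤ a → ∀ i, m a i = 0) : HasRead ev (den readEvents m) := by
  have := rep_induct (a := 5) (j := 4) (c := 0) (P := readEvent) (den (set 10 (.lit 2)) m)
    (fun x m' => HasRead (ev.take x) m')
    (by
      constructor <;> simp [den, Mem.set_apply, Expr.eval, hfree, channelBits, userBits, lastCode,
        bitArray])
    (by
      intro x hx m' hf h5 hr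
      simp only [den, Mem.set_apply, Expr.eval, h04] at hx
      have hx' : x < ev.length := by simpa using hx
      have hm3 : m' 3 x = (ev[x]).code := by
        rw [hf 3 (by simp [writes, readEvent, skip])]
        simp [den, Mem.set_apply, Expr.eval, h3, hx']
      obtain ⟨r1, r2, r3, r4, r5⟩ := hr
      rw [List.take_succ_eq_append_getElem hx']
      cases hev : ev[x] with
      | channel b =>
        have hb : m' 3 x = 3 + b.toNat := by rw [hm3, hev]; rfl
        constructor <;> cases b <;>
          simp [readEvent, den, Mem.set_apply, Expr.eval, h5, hb, r1, r2, r3, r4, lastCode,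
            Event.code,
            channelBits_append, userBits_append, bitArray_append] <;>
          try simp [channelBits, userBits, bitArray_append]
      | user b =>
        have hb : m' 3 x = b.toNat := by rw [hm3, hev]; rfl
        constructor <;> cases b <;>
          simp [readEvent, den, Mem.set_apply, Expr.eval, h5, hb, r1, r2, r3, r4, lastCode,
            Event.code,
            channelBits_append, userBits_append] <;>
          try simp [channelBits, userBits, bitArray_append]
      | userDone =>
        have hb : m' 3 x = 2 := by rw [hm3, hev]; rfl
        constructor <;>
          simp [readEvent, den, Mem.set_apply, Expr.eval, h5, hb, r1, r2, r3, r4, lastCode,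
            Event.code,
            channelBits_append, userBits_append, skip] <;>
          try simp [channelBits, userBits])
  have hM : den (set 10 (.lit 2)) m 0 4 + 0 = ev.length := by
    simp [den, Mem.set_apply, h04]
  rw [hM, List.take_length] at this
  exact this

end IndelSim

namespace IndelSim

set_option linter.unusedSimpArgs false

namespace FProg

/-! ### The intermediary that passes on -/

/-- There is no division, so a comparison with `N / 2` is made by doubling. -/
def passOnProg : FProg :=
  ite (.sub (.var 10) (.lit 2))
    (ite (.sub (.add (.var 6) (.var 6)) (.load 0 (.lit 2)))
      (set 4 (.lit 2)) (set 4 (.sub (.var 10) (.lit 3))))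
    (ite (.sub (.lit 2) (.var 10)) (set 4 (.add (.lit 2) (.var 10))) (set 4 (.lit 2)))

lemma den_passOnProg {ev : List Event} {m : Mem} (h : HasRead ev m) :
    den passOnProg m 4 0 = (passOn (m 0 2) ev).code := by
  obtain ⟨h1, -, -, -, h5⟩ := h
  unfold passOn
  unfold lastCode at h5
  rcases hl : ev.getLast? with _ | (b | _ | b)
  · simp [hl] at h5
    simp [passOnProg, den, Mem.set_apply, ite_apply, tsub_eq_zero_iff_le, Expr.eval, h5,
      Action.code]
  · simp [hl, Event.code] at h5
    cases b <;> simp at h5 <;> simp [passOnProg, den, Mem.set_apply, ite_apply,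
      tsub_eq_zero_iff_le, Expr.eval, h5, Action.code]
  · simp [hl, Event.code] at h5
    simp [passOnProg, den, Mem.set_apply, ite_apply, tsub_eq_zero_iff_le, Expr.eval, h5,
      Action.code]
  · simp [hl, Event.code] at h5
    by_cases hc : (channelBits ev).length ≤ m 0 2 / 2
    · have hc' : (channelBits ev).length + (channelBits ev).length ≤ m 0 2 := by omega
      cases b <;> simp at h5 <;>
        simp [passOnProg, den, Mem.set_apply, ite_apply, tsub_eq_zero_iff_le, Expr.eval, h5,
          Action.code, h1, hc, hc']
    · have hc' : ¬ (channelBits ev).length + (channelBits ev).length ≤ m 0 2 := by omega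
      cases b <;> simp at h5 <;>
        simp [passOnProg, den, Mem.set_apply, ite_apply, tsub_eq_zero_iff_le, Expr.eval, h5,
          Action.code, h1, hc, hc']

/-! ### The lengths of the parts of a block

Array `12` receives the number of binary digits of the block length, arrays `14` to `16` the lengths
of the marker, of the header, and of the rest of the block. -/

/-- Array `13` runs through the powers of two until it exceeds the block length. As the block length
is at most `n`, the `n` passes of `sizeProg` are enough. -/
def doubleStep : FProg :=
  ite (.sub (.add (.load 0 (.lit 3)) (.lit 1)) (.var 13))
    (seq (set 13 (.add (.var 13) (.var 13))) (set 12 (.add (.var 12) (.lit 1)))) skip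

def sizeProg : FProg := seq (seq (set 12 (.lit 0)) (set 13 (.lit 1))) (rep 11 0 0 doubleStep)

def lengthsProg (q : ℕ) : FProg :=
  seq sizeProg (seq (set 14 (.add (.var 12) (.var 12))) (seq (set 14 (.add (.var 14) (.var 14)))
    (seq (set 14 (.add (.var 14) (.var 14))) (seq (set 15 (.add (.add (.var 14) (.var 14))
      (.lit q)))
      (set 16 (.sub (.load 0 (.lit 3)) (.var 15)))))))

lemma den_sizeProg {m : Mem} (hr : m 0 3 ≤ m 0 0) : den sizeProg m 12 0 = (m 0 3).size := by
  have := rep_induct (a := 11) (j := 0) (c := 0) (P := doubleStep)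
    (den (seq (set 12 (.lit 0)) (set 13 (.lit 1))) m)
    (fun x m' => m' 12 0 = min x (m 0 3).size ∧ m' 13 0 = 2 ^ min x (m 0 3).size)
    (by simp [den, Mem.set_apply, ite_apply, tsub_eq_zero_iff_le, Expr.eval])
    (by
      intro x hx m' hf h11 ⟨h1, h2⟩
      have h03 : m' 0 3 = m 0 3 := by
        rw [hf 0 (by simp [writes, doubleStep, skip])]
        simp [den, Mem.set_apply, ite_apply, tsub_eq_zero_iff_le, Expr.eval]
      rcases Nat.lt_or_ge x (m 0 3).size with h | h
      · have h4 := Nat.lt_size.mp h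
        rw [min_eq_left h.le] at h1 h2
        rw [min_eq_left (Nat.succ_le_of_lt h)]
        have h5 : ¬ m 0 3 + 1 ≤ 2 ^ x := by omega
        simp [doubleStep, den, Mem.set_apply, ite_apply, tsub_eq_zero_iff_le, Expr.eval, h1, h2,
          h03, h5]
        rw [pow_succ]; omega
      · have h4 : m 0 3 < 2 ^ (m 0 3).size := Nat.lt_size_self _
        rw [min_eq_right h] at h1 h2
        rw [min_eq_right (by omega)]
        have h5 : m 0 3 + 1 ≤ 2 ^ (m 0 3).size := h4
        simp [doubleStep, skip, den, Mem.set_apply, ite_apply, tsub_eq_zero_iff_le, Expr.eval, h1,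
          h2, h03, h5])
  have hM : den (seq (set 12 (.lit 0)) (set 13 (.lit 1))) m 0 0 + 0 = m 0 0 := by
    simp [den, Mem.set_apply]
  rw [hM] at this
  have hs : (m 0 3).size ≤ m 0 0 :=
    Nat.size_le.mpr (lt_of_le_of_lt hr Nat.lt_two_pow_self)
  rw [min_eq_right hs] at this
  exact this.1

end FProg

open FProg

/-- The parameters of the scheme are in the memory. -/
structure HasPar (P : Par) (m : Mem) : Prop where
  n : m 0 0 = P.n
  e : m 0 1 = P.e
  N : m 0 2 = P.N
  R : m 0 3 = P.R
  S : ∀ i, m 1 i = P.S i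

structure HasLengths (P : Par) (m : Mem) : Prop where
  h : m 14 0 = P.h
  H : m 15 0 = P.H
  dl : m 16 0 = P.dl

lemma hasLengths_lengthsProg {q n e N r : ℕ} {S : ℕ → ℕ} {m : Mem}
    (h : HasPar (scheme q n e N r S) m) (hr : r ≤ n) :
    HasLengths (scheme q n e N r S) (den (lengthsProg q) m) := by
  have h03 : m 0 3 = r := h.R
  have h00 : m 0 0 = n := h.n
  have hs := den_sizeProg (m := m) (by omega)
  have h03' : den sizeProg m 0 3 = r := by
    rw [den_of_notMem _ (by simp [sizeProg, doubleStep, writes, skip]), h03]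
  rw [h03] at hs
  unfold lengthsProg
  simp only [den]
  generalize den sizeProg m = m' at *
  constructor <;> simp [Mem.set_apply, Expr.eval, hs, h03', scheme, Par.H, Par.dl] <;> omega

namespace FProg

/-! ### Alice's intermediary

Array `17` counts the positions; arrays `18` to `21` hold the place in the block, the number of the
block, the number of data symbols in earlier blocks, and the number of the data symbol. Arrays `23`
and `24` receive the symbols sent and the positions of the data symbols. -/

/-- The exclusive or of two bits. -/
def xorE (x y : Expr) : Expr := .add (.sub x y) (.sub y x)

lemma eval_xorE (m : Mem) (x y : Expr) {a b : Bool} (hx : x.eval m = a.toNat)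
    (hy : y.eval m = b.toNat) : (xorE x y).eval m = (xor a b).toNat := by
  cases a <;> cases b <;> simp [xorE, Expr.eval, hx, hy]

/-- The number in array `a` is the number of a data symbol. -/
def isDataE (a : ℕ) : Expr := .sub (.load 0 (.lit 2)) (.add (.add (.var a) (.var a)) (.lit 1))

lemma eval_isDataE {P : Par} {m : Mem} (h : m 0 2 = P.N) (a : ℕ) :
    (isDataE a).eval m = 0 ↔ ¬ m a 0 < P.D := by
  simp only [isDataE, Expr.eval, h, Par.D]; omega

def plainProg : FProg :=
  ite (.sub (.var 15) (.var 18))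
    (ite (.sub (.load 1 (.var 19)) (.sub (.var 18) (.add (.var 14) (.var 14))))
      (set 22 (.lit 1)) (set 22 (.lit 0)))
    (ite (isDataE 21) (set 22 (.load 9 (.var 21))) (set 22 (.lit 0)))

def bitProg : FProg :=
  ite (.sub (.var 14) (.var 18))
    (ite (.var 18) (put 23 (.var 17) (.lit 0)) (put 23 (.var 17) (.lit 1)))
    (ite (.sub (.add (.var 14) (.var 14)) (.var 18)) (put 23 (.var 17) (.load 2 (.var 17)))
      (seq plainProg
        (put 23 (.var 17) (xorE (.var 22) (.load 23 (.sub (.var 17) (.var 14)))))))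

def dataProg : FProg :=
  ite (.sub (.var 15) (.var 18)) (put 24 (.var 17) (.lit 0))
    (ite (isDataE 21) (put 24 (.var 17) (.lit 1)) (put 24 (.var 17) (.lit 0)))

/-- Remainder, quotient, and the product of the quotient with `dl` are updated from position to
position, since the machine neither divides nor multiplies. -/
def nextProg : FProg :=
  ite (.sub (.load 0 (.lit 3)) (.add (.var 18) (.lit 1))) (set 18 (.add (.var 18) (.lit 1)))
    (seq (set 18 (.lit 0)) (seq (set 19 (.add (.var 19) (.lit 1)))
      (set 20 (.add (.var 20) (.var 16)))))

def aliceStep : FProg :=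
  seq (set 21 (.add (.var 20) (.sub (.var 18) (.var 15)))) (seq bitProg (seq dataProg nextProg))

def aliceOut : FProg :=
  ite (.sub (.var 10) (.lit 2))
    (ite (.load 24 (.sub (.var 6) (.lit 1))) (set 4 (.sub (.var 10) (.lit 3)))
      (set 4 (.add (.lit 2) (.load 23 (.var 6)))))
    (set 4 (.add (.lit 2) (.load 23 (.var 6))))

/-- The number of possible edits decides between relaying and the scheme. The loop makes one pass
more than there are events, because after `c` receptions the symbol at position `c` is needed. -/
def aliceProg (q : ℕ) : FProg :=
  seq readEvents (ite (.load 0 (.lit 1))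
    (seq (lengthsProg q) (seq (rep 17 4 1 aliceStep) aliceOut)) passOnProg)

lemma wf_aliceProg (q : ℕ) : Wf (aliceProg q) := by
  simp [aliceProg, wf_readEvents, lengthsProg, sizeProg, doubleStep, aliceStep, bitProg, plainProg,
    dataProg, nextProg, aliceOut, passOnProg, Wf, skip, writes]

end FProg

/-- The loop of Alice's intermediary is about to treat position `p`. -/
structure AlicePos (P : Par) (p : ℕ) (m : Mem) : Prop where
  pos : m 17 0 = p
  off : m 18 0 = p % P.R
  block : m 19 0 = p / P.R
  base : m 20 0 = p / P.R * P.dl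
  par : HasPar P m
  lengths : HasLengths P m

lemma divMod_succ {x R : ℕ} (hR : 0 < R) : if x % R + 1 < R then
    (x + 1) % R = x % R + 1 ∧ (x + 1) / R = x / R else
    (x + 1) % R = 0 ∧ (x + 1) / R = x / R + 1 := by
  have h0 := Nat.div_add_mod x R
  have h1 := Nat.mod_lt x hR
  split_ifs with h
  · have e : x + 1 = (x % R + 1) + R * (x / R) := by omega
    constructor
    · rw [e, Nat.add_mul_mod_self_left, Nat.mod_eq_of_lt h]
    · conv_lhs => rw [e]
      rw [Nat.add_mul_div_left _ _ hR, Nat.div_eq_of_lt h, Nat.zero_add]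
  · have e : x + 1 = R * (x / R + 1) := by rw [Nat.mul_add]; omega
    constructor
    · rw [e, Nat.mul_mod_right]
    · conv_lhs => rw [e]
      rw [Nat.mul_div_cancel_left _ hR]

lemma den_plainProg {P : Par} {p : ℕ} {m : Mem} (h : AlicePos P p m) (h21 : m 21 0 = P.idx p)
    {X : ℕ → Bool} (hX : ∀ i, m 9 i = (X i).toNat) :
    den plainProg m 22 0 = (P.plain X p).toNat := by
  obtain ⟨-, h18, h19, -, ⟨-, -, hN, -, hS⟩, ⟨h14, h15, -⟩⟩ := h
  have hd := eval_isDataE hN 21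
  unfold Par.plain
  by_cases h1 : p % P.R < P.H
  · have h1' : ¬ P.H ≤ p % P.R := by omega
    by_cases h2 : p % P.R - (P.h + P.h) < P.S (p / P.R)
    · have h2' : ¬ P.S (p / P.R) ≤ p % P.R - (P.h + P.h) := by omega
      simp [plainProg, den, Mem.set_apply, ite_apply, tsub_eq_zero_iff_le, Expr.eval, h15, h18,
        h19, h14, hS, h1, h1', h2, h2',
        -tsub_le_iff_right, -Nat.sub_le_iff_le_add]
    · have h2' : P.S (p / P.R) ≤ p % P.R - (P.h + P.h) := by omega
      simp [plainProg, den, Mem.set_apply, ite_apply, tsub_eq_zero_iff_le, Expr.eval, h15, h18,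
        h19, h14, hS, h1, h1', h2, h2',
        -tsub_le_iff_right, -Nat.sub_le_iff_le_add]
  · have h1' : P.H ≤ p % P.R := by omega
    rw [h21] at hd
    by_cases h2 : P.idx p < P.D
    · have hd' : ¬ (isDataE 21).eval m = 0 := by rw [hd]; simpa using h2
      simp [plainProg, den, Mem.set_apply, ite_apply, tsub_eq_zero_iff_le, Expr.eval, h15, h18,
        h19, h14, hS, h1, h1', h2, hd', h21,
        hX]
    · have hd' : (isDataE 21).eval m = 0 := by rw [hd]; exact h2
      simp [plainProg, den, Mem.set_apply, ite_apply, tsub_eq_zero_iff_le, Expr.eval, h15, h18,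
        h19, h14, hS, h1, h1', h2, hd', h21,
        hX]

/-- The bits at earlier positions are kept in array `23`, so the recursion of `bit` becomes a
look-up. It would take exponential effort neither way, but here each position costs a bounded number
of steps. -/
lemma den_bitProg {P : Par} {p : ℕ} {m : Mem} (h : AlicePos P p m) (hh : 0 < P.h)
    (h21 : m 21 0 = P.idx p)
    {X : ℕ → Bool} (hX : ∀ i, m 9 i = (X i).toNat) {ω : ℕ → Bool} (hω : ∀ i, m 2 i = (ω i).toNat)
    (h23 : ∀ i < p, m 23 i = (P.bit ω X i).toNat) (i : ℕ) (hi : i ≤ p) :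
    den bitProg m 23 i = (P.bit ω X i).toNat := by
  have hpl := den_plainProg h h21 hX
  have hf : ∀ a, a ≠ 22 → den plainProg m a = m a := fun a ha =>
    den_of_notMem _ (by simpa [plainProg, writes] using ha) m
  obtain ⟨h17, h18, h19, -, ⟨-, -, hN, -, hS⟩, ⟨h14, h15, -⟩⟩ := h
  have h0 : ¬ P.h = 0 := by omega
  by_cases h1 : p % P.R < P.h
  · have h1' : ¬ P.h ≤ p % P.R := by omega
    rcases Nat.lt_or_ge i p with hip | hip
    · by_cases hz : p % P.R = 0 <;>
        simp [bitProg, den, Mem.set_apply, ite_apply, tsub_eq_zero_iff_le, Expr.eval, h14, h18,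
          h17, h1', hz, h23 i hip, hip.ne, h0]
    · obtain rfl : i = p := by omega
      rw [Par.bit, if_pos h1]
      by_cases hz : i % P.R = 0 <;>
        simp [bitProg, den, Mem.set_apply, ite_apply, tsub_eq_zero_iff_le, Expr.eval, h14, h18,
          h17, h1', hz, h0]
  · have h1' : P.h ≤ p % P.R := by omega
    by_cases h2 : p % P.R < P.h + P.h
    · have h2' : ¬ P.h + P.h ≤ p % P.R := by omega
      rcases Nat.lt_or_ge i p with hip | hip
      · simp [bitProg, den, Mem.set_apply, ite_apply, tsub_eq_zero_iff_le, Expr.eval, h14, h18,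
          h17, h1', h2', h23 i hip, hip.ne]
      · obtain rfl : i = p := by omega
        rw [Par.bit, if_neg h1, if_pos (Or.inl h2)]
        simp [bitProg, den, Mem.set_apply, ite_apply, tsub_eq_zero_iff_le, Expr.eval, h14, h18,
          h17, h1', h2', hω]
    · have h2' : P.h + P.h ≤ p % P.R := by omega
      have hle : p % P.R ≤ p := Nat.mod_le _ _
      have hden : den bitProg m = (den plainProg m).set 23 p
          ((xorE (.var 22) (.load 23 (.sub (.var 17) (.var 14)))).eval (den plainProg m)) := by
        simp [bitProg, den, Expr.eval, h14, h18, h1', h2', hf 17 (by norm_num), h17]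
      rw [hden, Mem.set_apply, if_pos rfl]
      split_ifs with hip
      · subst hip
        rw [Par.bit, if_neg h1, if_neg (by omega)]
        refine eval_xorE _ _ _ (by simpa [Expr.eval] using hpl) ?_
        simp only [Expr.eval]
        rw [hf 23 (by norm_num), hf 17 (by norm_num), hf 14 (by norm_num), h17, h14,
          h23 _ (by omega)]
      · rw [hf 23 (by norm_num), h23 i (by omega)]

end IndelSim

namespace IndelSim

set_option linter.unusedSimpArgs false

open FProg

lemma den_dataProg {P : Par} {p : ℕ} {m : Mem} (h : AlicePos P p m) (h21 : m 21 0 = P.idx p)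
    (h24 : ∀ i < p, m 24 i ≠ 0 ↔ P.IsData i) (i : ℕ) (hi : i ≤ p) :
    den dataProg m 24 i ≠ 0 ↔ P.IsData i := by
  obtain ⟨h17, h18, h19, -, ⟨-, -, hN, -, hS⟩, ⟨h14, h15, -⟩⟩ := h
  have hd := eval_isDataE hN 21
  rw [h21] at hd
  rcases Nat.lt_or_ge i p with hip | hip
  · rw [← h24 i hip]
    have : den dataProg m 24 i = m 24 i := by
      simp only [dataProg, den]
      split_ifs <;> simp [Mem.set_apply, Expr.eval, h17, hip.ne]
    rw [this]
  · obtain rfl : i = p := by omega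
    by_cases h1 : P.H ≤ i % P.R
    · by_cases h2 : P.idx i < P.D
      · have hd' : ¬ (isDataE 21).eval m = 0 := by rw [hd]; simpa using h2
        refine iff_of_true ?_ ⟨h1, h2⟩
        simp [dataProg, den, Mem.set_apply, ite_apply, Expr.eval, h15, h18, h17, h1, hd', h2]
      · have hd' : (isDataE 21).eval m = 0 := by rw [hd]; exact h2
        refine iff_of_false ?_ fun h => h2 h.2
        simp [dataProg, den, Mem.set_apply, ite_apply, Expr.eval, h15, h18, h17, h1, hd', h2]
    · refine iff_of_false ?_ fun h => h1 h.1
      simp [dataProg, den, Mem.set_apply, ite_apply, tsub_eq_zero_iff_le, Expr.eval, h15, h18, h17,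
        h1]

lemma den_nextProg {P : Par} {p : ℕ} {m : Mem} (h : AlicePos P p m) (hR : 0 < P.R) :
    AlicePos P (p + 1) ((den nextProg m).set 17 0 (p + 1)) := by
  obtain ⟨h17, h18, h19, h20, ⟨hn, he, hN, hR', hS⟩, ⟨h14, h15, h16⟩⟩ := h
  have hs := divMod_succ (x := p) hR
  split_ifs at hs with h1
  · have h1' : ¬ P.R ≤ p % P.R + 1 := by omega
    refine ⟨?_, ?_, ?_, ?_, ⟨?_, ?_, ?_, ?_, fun i => ?_⟩, ⟨?_, ?_, ?_⟩⟩ <;>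
      simp [nextProg, den, Mem.set_apply, ite_apply, tsub_eq_zero_iff_le, Expr.eval, h18, h19, h20,
        hn, he, hN, hR', hS, h14, h15, h16, h1', hs]
  · have h1' : P.R ≤ p % P.R + 1 := by omega
    refine ⟨?_, ?_, ?_, ?_, ⟨?_, ?_, ?_, ?_, fun i => ?_⟩, ⟨?_, ?_, ?_⟩⟩ <;>
      simp [nextProg, den, Mem.set_apply, ite_apply, tsub_eq_zero_iff_le, Expr.eval, h18, h19, h20,
        hn, he, hN, hR', hS, h14, h15, h16, h1', hs, Nat.add_mul]

lemma AlicePos.congr {P : Par} {p : ℕ} {m m' : Mem} (h : AlicePos P p m)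
    (hm : ∀ a, a < 21 → m' a = m a) : AlicePos P p m' := by
  obtain ⟨h17, h18, h19, h20, ⟨hn, he, hN, hR', hS⟩, ⟨h14, h15, h16⟩⟩ := h
  refine ⟨?_, ?_, ?_, ?_, ⟨?_, ?_, ?_, ?_, fun i => ?_⟩, ⟨?_, ?_, ?_⟩⟩ <;>
    rw [hm _ (by norm_num)] <;> first | assumption | apply hS

/-- The loop of Alice's intermediary before position `p`. -/
structure AliceInv (P : Par) (ω X : ℕ → Bool) (p : ℕ) (m : Mem) : Prop where
  pos : AlicePos P p m
  sent : ∀ i < p, m 23 i = (P.bit ω X i).toNat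
  data : ∀ i < p, m 24 i ≠ 0 ↔ P.IsData i

lemma den_aliceStep {P : Par} {p : ℕ} {m : Mem} {ω X : ℕ → Bool} (h : AliceInv P ω X p m)
    (hh : 0 < P.h) (hR : 0 < P.R) (hX : ∀ i, m 9 i = (X i).toNat)
    (hω : ∀ i, m 2 i = (ω i).toNat) :
    AliceInv P ω X (p + 1) ((den aliceStep m).set 17 0 (p + 1)) := by
  obtain ⟨hp, h23, h24⟩ := h
  have e21 : (Expr.add (.var 20) (.sub (.var 18) (.var 15))).eval m = P.idx p := by
    simp [Expr.eval, hp.base, hp.off, hp.lengths.H, Par.idx]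
  set m1 := m.set 21 0 (P.idx p) with hm1
  have f1 : ∀ a, a ≠ 21 → m1 a = m a := fun a ha => Mem.set_ne _ _ _ ha
  have f2 : ∀ a, a ≠ 22 → a ≠ 23 → den bitProg m1 a = m1 a := fun a h1 h2 =>
    den_of_notMem _ (by simp [bitProg, plainProg, writes, h1, h2]) m1
  have f3 : ∀ a, a ≠ 24 → den dataProg (den bitProg m1) a = den bitProg m1 a := fun a h1 =>
    den_of_notMem _ (by simp [dataProg, writes, h1]) _
  have f4 : ∀ m' : Mem, ∀ a, a ≠ 18 → a ≠ 19 → a ≠ 20 → den nextProg m' a = m' a :=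
    fun m' a h1 h2 h3 => den_of_notMem _ (by simp [nextProg, writes, h1, h2, h3]) _
  have hden : den aliceStep m = den nextProg (den dataProg (den bitProg m1)) := by
    simp only [aliceStep, den, e21, hm1]
    rfl
  have p1 : AlicePos P p m1 := hp.congr fun a ha => f1 a (by omega)
  have h21 : m1 21 0 = P.idx p := by simp [hm1, Mem.set_apply]
  have b := den_bitProg p1 hh h21 (X := X) (fun i => by rw [f1 9 (by norm_num)]; exact hX i)
    (ω := ω) (fun i => by rw [f1 2 (by norm_num)]; exact hω i)
    (fun i hi => by rw [f1 23 (by norm_num)]; exact h23 i hi)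
  have p2 : AlicePos P p (den bitProg m1) := p1.congr fun a ha => f2 a (by omega) (by omega)
  have d := den_dataProg p2 (by rw [f2 21 (by norm_num) (by norm_num), h21])
    (fun i hi => by
      rw [f2 24 (by norm_num) (by norm_num), f1 24 (by norm_num)]; exact h24 i hi)
  have p3 : AlicePos P p (den dataProg (den bitProg m1)) := p2.congr fun a ha => f3 a (by omega)
  rw [hden]
  refine ⟨den_nextProg p3 hR, fun i hi => ?_, fun i hi => ?_⟩
  · rw [Mem.set_ne _ _ _ (by norm_num), f4 _ _ (by norm_num) (by norm_num) (by norm_num),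
      f3 _ (by norm_num), b i (by omega)]
  · rw [Mem.set_ne _ _ _ (by norm_num), f4 _ _ (by norm_num) (by norm_num) (by norm_num)]
    exact d i (by omega)

lemma den_aliceOut {P : Par} {ev : List Event} {ω X : ℕ → Bool} {m : Mem} (hr : HasRead ev m)
    (h23 : ∀ i ≤ (channelBits ev).length, m 23 i = (P.bit ω X i).toNat)
    (h24 : ∀ i ≤ (channelBits ev).length, m 24 i ≠ 0 ↔ P.IsData i)
    (hX : X = fun i => (userBits ev).getD i false) :
    den aliceOut m 4 0 = (P.actA ω ev).code := by
  obtain ⟨h6, -, -, -, h10⟩ := hr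
  have hs := h23 _ le_rfl
  have hd := h24 ((channelBits ev).length - 1) (by omega)
  unfold Par.actA
  rw [← hX]
  unfold lastCode at h10
  rcases hl : ev.getLast? with _ | (b | _ | b)
  · simp [hl] at h10
    simp [aliceOut, den, Mem.set_apply, ite_apply, Expr.eval, h10, h6, hs, Action.code]
  · simp [hl, Event.code] at h10
    cases b <;> simp at h10 <;>
      simp [aliceOut, den, Mem.set_apply, ite_apply, Expr.eval, h10, h6, hs, Action.code]
  · simp [hl, Event.code] at h10
    simp [aliceOut, den, Mem.set_apply, ite_apply, Expr.eval, h10, h6, hs, Action.code]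
  · simp [hl, Event.code] at h10
    by_cases hc : P.IsData ((channelBits ev).length - 1)
    · have hd' : ¬ m 24 ((channelBits ev).length - 1) = 0 := hd.mpr hc
      dsimp only
      rw [if_pos hc]
      cases b <;> simp at h10 <;>
        simp [aliceOut, den, Mem.set_apply, ite_apply, Expr.eval, h10, h6, hs, Action.code, hd']
    · have hd' : m 24 ((channelBits ev).length - 1) = 0 := by
        by_contra h; exact hc (hd.mp h)
      dsimp only
      rw [if_neg hc]
      cases b <;> simp at h10 <;>
        simp [aliceOut, den, Mem.set_apply, ite_apply, Expr.eval, h10, h6, hs, Action.code, hd']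

lemma HasRead.congr {ev : List Event} {m m' : Mem} (h : HasRead ev m)
    (hm : ∀ a, 6 ≤ a → a ≤ 10 → m' a = m a) : HasRead ev m' := by
  obtain ⟨h1, h2, h3, h4, h5⟩ := h
  refine ⟨?_, fun i => ?_, ?_, fun i => ?_, ?_⟩ <;> rw [hm _ (by norm_num) (by norm_num)] <;>
    first | assumption | apply h2 | apply h4

lemma HasPar.congr {P : Par} {m m' : Mem} (h : HasPar P m) (hm : ∀ a < 2, m' a = m a) :
    HasPar P m' := by
  obtain ⟨h1, h2, h3, h4, h5⟩ := h
  refine ⟨?_, ?_, ?_, ?_, fun i => ?_⟩ <;> rw [hm _ (by norm_num)] <;>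
    first | assumption | apply h5

lemma channelBits_length_le (ev : List Event) : (channelBits ev).length ≤ ev.length := by
  induction ev with
  | nil => simp [channelBits]
  | cons a ev ih =>
    cases a <;> simp [channelBits] at ih ⊢ <;> omega

/-- The memory at the start. -/
structure IsInput (P : Par) (ω : ℕ → Bool) (ev : List Event) (m : Mem) : Prop where
  par : HasPar P m
  coins : ∀ i, m 2 i = (ω i).toNat
  events : ∀ i, m 3 i = (ev.map Event.code).getD i 0
  length : m 0 4 = ev.length
  free : ∀ a, 4 ≤ a → ∀ i, m a i = 0

lemma IsInput.hasRead {P : Par} {ω : ℕ → Bool} {ev : List Event} {m : Mem}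
    (h : IsInput P ω ev m) : HasRead ev (den readEvents m) :=
  hasRead_readEvents h.events h.length h.free

lemma readEvents_frame {m : Mem} {a : ℕ} (h : a < 5 ∨ 10 < a ∧ a < 40) :
    den readEvents m a = m a :=
  den_of_notMem _ (by simp [readEvents, readEvent, writes, skip]; omega) m

lemma lengthsProg_frame {q : ℕ} {m : Mem} {a : ℕ} (h : a < 11 ∨ 16 < a ∧ a < 40) :
    den (lengthsProg q) m a = m a :=
  den_of_notMem _ (by simp [lengthsProg, sizeProg, doubleStep, writes, skip]; omega) m

lemma den_aliceProg {q n e N r : ℕ} {S : ℕ → ℕ} {ω : ℕ → Bool} {ev : List Event} {m : Mem}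
    (h : IsInput (scheme q n e N r S) ω ev m) (hr : e ≠ 0 → 0 < r ∧ r ≤ n) :
    den (aliceProg q) m 4 0 =
      (if e = 0 then passOn N ev else (scheme q n e N r S).actA ω ev).code := by
  set P := scheme q n e N r S with hP
  have hread := h.hasRead
  set m1 := den readEvents m with hm1
  have f1 : ∀ a, a < 5 ∨ 10 < a ∧ a < 40 → m1 a = m a := fun a ha => readEvents_frame ha
  have par1 : HasPar P m1 := h.par.congr fun a ha => f1 a (by omega)
  have he : m1 0 1 = e := par1.e
  simp only [aliceProg, den]
  rw [← hm1]
  simp only [Expr.eval, he]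
  by_cases he0 : e = 0
  · rw [if_neg (by simpa using he0), if_pos he0, den_passOnProg hread]
    have : m1 0 2 = N := par1.N
    rw [this]
  · rw [if_pos he0, if_neg he0]
    obtain ⟨hr0, hrn⟩ := hr he0
    have len2 : HasLengths P (den (lengthsProg q) m1) := hasLengths_lengthsProg par1 hrn
    set m2 := den (lengthsProg q) m1 with hm2
    have f2 : ∀ a, a < 11 ∨ 16 < a ∧ a < 40 → m2 a = m1 a := fun a ha => lengthsProg_frame ha
    have par2 : HasPar P m2 := par1.congr fun a ha => f2 a (by omega)
    have read2 : HasRead ev m2 := hread.congr fun a h1 h2 => f2 a (by omega)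
    have free2 : ∀ a, 16 < a → a < 40 → ∀ i, m2 a i = 0 := fun a h1 h2 i => by
      rw [f2 a (by omega), f1 a (by omega), h.free a (by omega)]
    have hh : 0 < P.h := by
      have : 0 < r.size := Nat.size_pos.mpr hr0
      change 0 < 8 * r.size; omega
    have hloop := rep_induct (a := 17) (j := 4) (c := 1) (P := aliceStep) m2
      (AliceInv P ω fun i => (userBits ev).getD i false)
      ⟨⟨by simp [Mem.set_apply], by simp [Mem.set_apply, free2], by simp [Mem.set_apply, free2],
        by simp [Mem.set_apply, free2], par2.congr fun a ha => Mem.set_ne _ _ _ (by omega),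
        ⟨by simp [Mem.set_apply, len2.h], by simp [Mem.set_apply, len2.H],
          by simp [Mem.set_apply, len2.dl]⟩⟩, fun i hi => by omega, fun i hi => by omega⟩
      (fun x _ m' hf _ hinv => den_aliceStep hinv hh hr0
        (fun i => by
          rw [hf 9 (by simp [writes, aliceStep, bitProg, plainProg, dataProg, nextProg])]
          exact read2.user i)
        (fun i => by
          rw [hf 2 (by simp [writes, aliceStep, bitProg, plainProg, dataProg, nextProg]),
            f2 2 (by omega), f1 2 (by omega)]
          exact h.coins i))
    set m3 := den (rep 17 4 1 aliceStep) m2 with hm3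
    have hk : m2 0 4 = ev.length := by
      rw [f2 0 (by omega), f1 0 (by omega), h.length]
    rw [hk] at hloop
    have read3 : HasRead ev m3 := read2.congr fun a h1 h2 => den_of_notMem _ (by
      simp [writes, aliceStep, bitProg, plainProg, dataProg, nextProg]; omega) m2
    have hlen := channelBits_length_le ev
    exact den_aliceOut read3 (fun i hi => hloop.sent i (by omega))
      (fun i hi => hloop.data i (by omega)) rfl

end IndelSim

namespace IndelSim

set_option linter.unusedSimpArgs false

namespace FProg

/-! ### Bob's intermediary

Arrays `18` to `22` hold what has been found out by scanning the received bits. Array `25` holds a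
row of the table of edit distances, array `32` receives the guess and array `35` the number of data
symbols in the blocks before. Arrays `37` to `39` receive the number of the decoded data symbol,
whether there is one, and its value. -/

/-- The symbol of the synchronization string after the marker that ends at the number in array
`23`. -/
def symE : ℕ → Expr
  | 0 => .lit 0
  | q + 1 => .add (symE q) (xorE (.load 7 (.add (.add (.var 23) (.var 14)) (.lit q)))
      (.load 7 (.add (.var 23) (.lit q))))

def zerosProg : FProg :=
  ite (.load 7 (.var 17)) (set 18 (.lit 1)) (ite (.var 18) (set 18 (.add (.var 18) (.lit 1))) skip)

def markerProg (q : ℕ) : FProg :=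
  seq (set 23 (.add (.var 17) (.lit 1)))
    (seq (ite (.sub (.var 20) (.var 23)) skip
      (seq (put 22 (.var 21) (symE q)) (seq (set 20 (.add (.var 23) (.load 0 (.lit 3))))
        (set 21 (.add (.var 21) (.lit 1))))))
      (set 19 (.var 23)))

/-- The loop is limited by the number of all events; the outer test makes the passes beyond the
number of channel symbols idle. -/
def scanProg (q : ℕ) : FProg :=
  ite (.sub (.var 6) (.var 17)) (seq zerosProg (ite (xorE (.var 18) (.var 14)) skip (markerProg q)))
    skip

end FProg

open FProg

/-- The memory contains what has been found out by scanning. -/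
structure HasScan (s : Par.Scan) (m : Mem) : Prop where
  zc : m 18 0 = s.zc
  tau : m 19 0 = s.tau
  na : m 20 0 = s.na
  cnt : m 21 0 = s.cnt
  y : ∀ i, m 22 i = s.y i

lemma eval_symE {m : Mem} {β : ℕ → Bool} {a h : ℕ} (h7 : ∀ i, m 7 i = (β i).toNat)
    (h14 : m 14 0 = h) (h23 : m 23 0 = a) (q : ℕ) : (symE q).eval m =
      ∑ c ∈ Finset.range q, (xor (β (a + h + c)) (β (a + c))).toNat := by
  induction q with
  | zero => rfl
  | succ q ih =>
    rw [Finset.sum_range_succ, ← ih]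
    simp only [symE, Expr.eval]
    congr 1
    exact eval_xorE _ _ _ (by simp [Expr.eval, h7, h14, h23]) (by simp [Expr.eval, h7, h23])

lemma eval_xorE_eq_zero {m : Mem} {x y : Expr} : (xorE x y).eval m = 0 ↔ x.eval m = y.eval m := by
  simp only [xorE, Expr.eval]; omega

lemma den_scanProg {P : Par} {β : ℕ → Bool} {t : ℕ} {s : Par.Scan} {m : Mem} (hs : HasScan s m)
    (h7 : ∀ i, m 7 i = (β i).toNat) (h14 : m 14 0 = P.h) (hR : m 0 3 = P.R) (h17 : m 17 0 = t)
    (ht : t < m 6 0) : HasScan (P.scanStep β t s) (den (scanProg P.q) m) := by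
  have f1 : ∀ a, a ≠ 18 → a ≠ 40 → den zerosProg m a = m a := fun a ha hb =>
    den_of_notMem _ (by simp [zerosProg, writes, skip, ha, hb]) m
  have hz : den zerosProg m 18 0 = if β t then 1 else if s.zc = 0 then 0 else s.zc + 1 := by
    by_cases hb : β t
    · simp [zerosProg, den, Mem.set_apply, ite_apply, Expr.eval, h7, h17, hb]
    · by_cases hc : s.zc = 0 <;>
        simp [zerosProg, den, Mem.set_apply, ite_apply, Expr.eval, h7, h17, hb, hs.zc, hc, skip]
  have ht' : (Expr.sub (.var 6) (.var 17)).eval m ≠ 0 := by simp only [Expr.eval, h17]; omega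
  set m1 := den zerosProg m with hm1
  have hden : den (scanProg P.q) m = den (ite (xorE (.var 18) (.var 14)) skip
    (markerProg P.q)) m1 := by
    rw [scanProg, den, if_pos ht', den]
  have hs1 : m1 19 0 = s.tau ∧ m1 20 0 = s.na ∧ m1 21 0 = s.cnt ∧ (∀ i, m1 22 i = s.y i) ∧
      m1 14 0 = P.h ∧ m1 17 0 = t ∧ m1 0 3 = P.R ∧ ∀ i, m1 7 i = (β i).toNat := by
    refine ⟨?_, ?_, ?_, fun i => ?_, ?_, ?_, ?_, fun i => ?_⟩ <;>
      rw [f1 _ (by norm_num) (by norm_num)]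
    exacts [hs.tau, hs.na, hs.cnt, hs.y i, h14, h17, hR, h7 i]
  obtain ⟨e19, e20, e21, e22, e14, e17, e03, e7⟩ := hs1
  have hx : (xorE (.var 18) (.var 14)).eval m1 = 0 ↔
      (if β t then 1 else if s.zc = 0 then 0 else s.zc + 1) = P.h := by
    rw [eval_xorE_eq_zero]
    simp only [Expr.eval]
    rw [hz, e14]
  rw [hden, Par.scanStep, den]
  generalize hzd : (if β t then 1 else if s.zc = 0 then 0 else s.zc + 1) = z at hz hx ⊢
  by_cases hm : z = P.h
  · rw [if_pos hm, if_neg (show ¬ (xorE (.var 18) (.var 14)).eval m1 ≠ 0 from not_not.mpr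
      (hx.mpr hm))]
    set m2 := m1.set 23 0 (t + 1) with hm2
    have hc : (Expr.sub (.var 20) (.var 23)).eval m2 = 0 ↔ s.na ≤ t + 1 := by
      simp [Expr.eval, hm2, Mem.set_apply, e20]; omega
    have hden2 : den (markerProg P.q) m1 = (if (Expr.sub (.var 20) (.var 23)).eval m2 ≠ 0
        then den skip m2 else den (seq (put 22 (.var 21) (symE P.q))
          (seq (set 20 (.add (.var 23) (.load 0 (.lit 3)))) (set 21 (.add (.var 21) (.lit 1)))))
          m2).set 19 0 (t + 1) := by
      have h23 : (Expr.add (.var 17) (.lit 1)).eval m1 = t + 1 := by simp [Expr.eval, e17]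
      have h := den_of_notMem (ite (.sub (.var 20) (.var 23)) skip
        (seq (put 22 (.var 21) (symE P.q)) (seq (set 20 (.add (.var 23) (.load 0 (.lit 3))))
        (set 21 (.add (.var 21) (.lit 1)))))) (a := 23) (by simp [writes, skip]) m2
      have h' : m2 23 0 = t + 1 := by simp [hm2, Mem.set_apply]
      rw [← h', ← h, hm2, ← h23]
      rfl
    rw [hden2]
    by_cases ha : s.na ≤ t + 1
    · rw [if_pos ha, if_neg (not_not.mpr (hc.mpr ha))]
      have hsym := eval_symE (m := m2) (β := β) (a := t + 1) (h := P.h)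
        (fun i => by simp [hm2, Mem.set_apply, e7]) (by simp [hm2, Mem.set_apply, e14])
        (by simp [hm2, Mem.set_apply]) P.q
      constructor <;>
        simp [den, Mem.set_apply, Expr.eval, hsym, hm2, hz, e20, e21, e22, e03, Par.sym,
          Function.update_apply]
      simpa [hm2] using fun i => by rw [hsym]
    · rw [if_neg ha, if_pos (fun h => ha (hc.mp h))]
      constructor <;> simp [den, Mem.set_apply, Expr.eval, hm2, hz, e19, e20, e21, e22, skip]
  · rw [if_neg hm, if_pos (fun h => hm (hx.mp h))]
    constructor <;> simp [den, Mem.set_apply, Expr.eval, skip, e19, e20, e21, e22, hz]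

namespace FProg

/-- The minimum of two numbers. -/
def minE (x y : Expr) : Expr := .sub x (.sub x y)

lemma eval_minE (m : Mem) (x y : Expr) : (minE x y).eval m = min (x.eval m) (y.eval m) := by
  simp only [minE, Expr.eval]; omega

def stepsE : Expr :=
  minE (.add (.load 25 (.add (.var 28) (.lit 1))) (.lit 1)) (.add (.load 25 (.var 28)) (.lit 1))

/-- Only one row of the table is stored, and it is overwritten from left to right. Array `27` saves
the entry of the old row that is needed diagonally for the next cell. -/
def cellProg : FProg :=
  seq (ite (xorE (.load 1 (.var 28)) (.load 22 (.var 26))) (set 30 stepsE)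
      (set 30 (minE stepsE (.var 27))))
    (seq (set 27 (.load 25 (.add (.var 28) (.lit 1))))
      (put 25 (.add (.var 28) (.lit 1)) (.var 30)))

def rowProg : FProg :=
  ite (.sub (.var 21) (.var 26))
    (seq (seq (set 27 (.load 25 (.lit 0))) (put 25 (.lit 0) (.add (.var 26) (.lit 1))))
      (rep 28 0 0 cellProg)) skip

def tableProg : FProg := seq (rep 24 0 1 (put 25 (.var 24) (.var 24))) (rep 26 4 0 rowProg)

end FProg

/-- The row of the table of edit distances is computed up to column `x`. -/
structure HasCells (S y : ℕ → ℕ) (n w x : ℕ) (m : Mem) : Prop where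
  new : ∀ i ≤ x, m 25 i = Par.cost S y (w + 1) i
  old : ∀ i, x < i → i ≤ n → m 25 i = Par.cost S y w i
  diag : m 27 0 = Par.cost S y w x

lemma den_cellProg {S y : ℕ → ℕ} {n w x : ℕ} {m : Mem} (h : HasCells S y n w x m) (hx : x < n)
    (h1 : ∀ i, m 1 i = S i) (h22 : ∀ i, m 22 i = y i) (h26 : m 26 0 = w) (h28 : m 28 0 = x) :
    HasCells S y n w (x + 1) ((den cellProg m).set 28 0 (x + 1)) := by
  have ho := h.old (x + 1) (by omega) (by omega)
  have hn := h.new x le_rfl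
  have hd := h.diag
  have key : den cellProg m 25 (x + 1) = Par.cost S y (w + 1) (x + 1) ∧
      (∀ i, i ≠ x + 1 → den cellProg m 25 i = m 25 i) ∧
      den cellProg m 27 0 = Par.cost S y w (x + 1) := by
    have hx0 : (xorE (.load 1 (.var 28)) (.load 22 (.var 26))).eval m = 0 ↔ S x = y w := by
      rw [eval_xorE_eq_zero]; simp [Expr.eval, h1, h22, h26, h28]
    have hden : den cellProg m = den (seq (set 27 (.load 25 (.add (.var 28) (.lit 1))))
        (put 25 (.add (.var 28) (.lit 1)) (.var 30)))
        (if (xorE (.load 1 (.var 28)) (.load 22 (.var 26))).eval m ≠ 0 then den (set 30 stepsE) m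
          else den (set 30 (minE stepsE (.var 27))) m) := rfl
    rw [Par.cost, hden]
    by_cases hSy : S x = y w
    · rw [if_pos hSy, if_neg (not_not.mpr (hx0.mpr hSy))]
      refine ⟨?_, fun i hi => ?_, ?_⟩ <;>
        simp [den, Mem.set_apply, Expr.eval, eval_minE, stepsE, h28, ho, hn, hd]
      intro h; exact absurd h hi
    · rw [if_neg hSy, if_pos (fun h => hSy (hx0.mp h))]
      refine ⟨?_, fun i hi => ?_, ?_⟩ <;>
        simp [den, Mem.set_apply, Expr.eval, eval_minE, stepsE, h28, ho, hn, hd]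
      intro h; exact absurd h hi
  obtain ⟨k1, k2, k3⟩ := key
  refine ⟨fun i hi => ?_, fun i hi hin => ?_, ?_⟩
  · rw [Mem.set_ne _ _ _ (by norm_num)]
    rcases Nat.lt_or_ge x i with h' | h'
    · obtain rfl : i = x + 1 := by omega
      exact k1
    · rw [k2 i (by omega)]; exact h.new i h'
  · rw [Mem.set_ne _ _ _ (by norm_num), k2 i (by omega)]; exact h.old i (by omega) hin
  · rw [Mem.set_ne _ _ _ (by norm_num), k3]

lemma den_rowProg {S y : ℕ → ℕ} {n w : ℕ} {m : Mem} (h0 : m 0 0 = n) (h1 : ∀ i, m 1 i = S i)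
    (h22 : ∀ i, m 22 i = y i) (h26 : m 26 0 = w) (h21 : w < m 21 0)
    (h25 : ∀ i ≤ n, m 25 i = Par.cost S y w i) (i : ℕ) (hi : i ≤ n) :
    den rowProg m 25 i = Par.cost S y (w + 1) i := by
  have hc : (Expr.sub (.var 21) (.var 26)).eval m ≠ 0 := by simp only [Expr.eval, h26]; omega
  rw [rowProg, den, if_pos hc, den]
  set m1 := den (seq (set 27 (.load 25 (.lit 0))) (put 25 (.lit 0) (.add (.var 26) (.lit 1)))) m
    with hm1
  have f1 : ∀ a, a ≠ 25 → a ≠ 27 → m1 a = m a := fun a ha hb =>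
    den_of_notMem _ (by simp [writes, ha, hb]) m
  have e25 : ∀ i, m1 25 i = if i = 0 then w + 1 else m 25 i := by
    intro i; simp [hm1, den, Mem.set_apply, Expr.eval, h26]
  have e27 : m1 27 0 = m 25 0 := by simp [hm1, den, Mem.set_apply, Expr.eval]
  have hloop := rep_induct (a := 28) (j := 0) (c := 0) (P := cellProg) m1 (HasCells S y n w)
    ⟨fun i hi => by
        obtain rfl : i = 0 := by omega
        rw [Mem.set_ne _ _ _ (by norm_num), e25]; simp [Par.cost],
      fun i hi hin => by
        rw [Mem.set_ne _ _ _ (by norm_num), e25, if_neg (by omega)]; exact h25 i hin,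
      by rw [Mem.set_ne _ _ _ (by norm_num), e27]; exact h25 0 (by omega)⟩
    (fun x hx m' hf h28 hinv => by
      rw [f1 0 (by norm_num) (by norm_num), h0] at hx
      have g : ∀ a, a ≠ 28 → a ≠ 29 → a ≠ 30 → a ≠ 25 → a ≠ 27 → a ≠ 40 → m' a = m a :=
        fun a a1 a2 a3 a4 a5 a6 => by
          rw [hf a (by simp [cellProg, writes, skip, a1, a2, a3, a4, a5, a6]), f1 a a4 a5]
      exact den_cellProg hinv (by omega)
        (fun i => by
          rw [g 1 (by norm_num) (by norm_num) (by norm_num) (by norm_num) (by norm_num)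
            (by norm_num), h1])
        (fun i => by
          rw [g 22 (by norm_num) (by norm_num) (by norm_num) (by norm_num) (by norm_num)
            (by norm_num), h22])
        (by
          rw [g 26 (by norm_num) (by norm_num) (by norm_num) (by norm_num) (by norm_num)
            (by norm_num), h26]) h28)
  rw [f1 0 (by norm_num) (by norm_num), h0] at hloop
  exact hloop.new i (by omega)

lemma den_tableProg {S y : ℕ → ℕ} {n w k : ℕ} {m : Mem} (h0 : m 0 0 = n) (h4 : m 0 4 = k)
    (h1 : ∀ i, m 1 i = S i) (h22 : ∀ i, m 22 i = y i) (h21 : m 21 0 = w) (hwk : w ≤ k) (i : ℕ)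
    (hi : i ≤ n) : den tableProg m 25 i = Par.cost S y w i := by
  rw [tableProg, den]
  have hinit := rep_induct (a := 24) (j := 0) (c := 1) (P := put 25 (.var 24) (.var 24)) m
    (fun x m' => ∀ i < x, m' 25 i = i) (fun i hi => by omega)
    (fun x _ m' _ h24 hinv i hi => by
      simp only [den, Mem.set_apply, Expr.eval, h24]
      rw [if_neg (by norm_num), if_true]
      split_ifs with hix
      · exact hix.symm
      · exact hinv i (by omega))
  set m1 := den (rep 24 0 1 (put 25 (.var 24) (.var 24))) m with hm1
  have f1 : ∀ a, a ≠ 24 → a ≠ 25 → m1 a = m a := fun a ha hb =>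
    den_of_notMem _ (by simp [writes, ha, hb]) m
  rw [h0] at hinit
  have hloop := rep_induct (a := 26) (j := 4) (c := 0) (P := rowProg) m1
    -- The minimum expresses that row `w` is complete after `w` passes and the remaining ones are
    -- idle.
    (fun x m' => ∀ i ≤ n, m' 25 i = Par.cost S y (min x w) i)
    (fun i hi => by
      rw [Mem.set_ne _ _ _ (by norm_num), hinit i (by omega), Nat.zero_min, Par.cost_zero_left])
    (fun x hx m' hf h26 hinv i hi => by
      have g : ∀ a, a < 25 → a ≠ 24 → m' a = m a := fun a a1 a2 => by
        rw [hf a (by simp [rowProg, cellProg, writes, skip]; omega), f1 a a2 (by omega)]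
      rw [Mem.set_ne _ _ _ (by norm_num)]
      rcases Nat.lt_or_ge x w with h | h
      · rw [min_eq_left (by omega)] at hinv ⊢
        exact den_rowProg (by rw [g 0 (by omega) (by omega), h0])
          (fun i => by rw [g 1 (by omega) (by omega), h1])
          (fun i => by rw [g 22 (by omega) (by omega), h22]) h26
          (by rw [g 21 (by omega) (by omega), h21]; exact h) hinv i hi
      · rw [min_eq_right (by omega)] at hinv ⊢
        have hc : (Expr.sub (.var 21) (.var 26)).eval m' = 0 := by
          simp only [Expr.eval, h26]
          rw [g 21 (by omega) (by omega), h21]; omega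
        rw [rowProg, den, if_neg (by rw [hc]; simp)]
        simp only [skip, den]
        rw [Mem.set_ne _ _ _ (by norm_num)]
        exact hinv i hi)
  rw [f1 0 (by norm_num) (by norm_num), h4, Nat.add_zero, min_eq_right hwk] at hloop
  exact hloop i hi

end IndelSim

namespace IndelSim

set_option linter.unusedSimpArgs false

namespace FProg

def argminStep : FProg :=
  ite (.sub (.var 33) (.load 25 (.add (.var 31) (.lit 1))))
    (seq (set 32 (.add (.var 31) (.lit 1))) (set 33 (.load 25 (.add (.var 31) (.lit 1))))) skip

def argminProg : FProg :=
  seq (seq (set 32 (.lit 0)) (set 33 (.load 25 (.lit 0)))) (rep 31 0 0 argminStep)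

/-- The product of `dl` and the guess minus one, by repeated addition. -/
def baseStep : FProg :=
  ite (.sub (.var 32) (.add (.var 34) (.lit 1))) (set 35 (.add (.var 35) (.var 16))) skip

def baseProg : FProg := seq (set 35 (.lit 0)) (rep 34 0 0 baseStep)

end FProg

open FProg

lemma den_argminProg {f : ℕ → ℕ} {n : ℕ} {m : Mem} (h0 : m 0 0 = n)
    (h25 : ∀ i ≤ n, m 25 i = f i) : den argminProg m 32 0 = Par.argmin f n := by
  rw [argminProg, den]
  set m1 := den (seq (set 32 (.lit 0)) (set 33 (.load 25 (.lit 0)))) m with hm1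
  have f1 : ∀ a, a ≠ 32 → a ≠ 33 → m1 a = m a := fun a ha hb =>
    den_of_notMem _ (by simp [writes, ha, hb]) m
  have h32 : m1 32 0 = 0 := by simp [hm1, den, Mem.set_apply, Expr.eval]
  have h33 : m1 33 0 = m 25 0 := by simp [hm1, den, Mem.set_apply, Expr.eval]
  have hloop := rep_induct (a := 31) (j := 0) (c := 0) (P := argminStep) m1
    (fun x m' => m' 32 0 = Par.argmin f x ∧ m' 33 0 = f (Par.argmin f x))
    ⟨by rw [Mem.set_ne _ _ _ (by norm_num), h32]; rfl,
      by rw [Mem.set_ne _ _ _ (by norm_num), h33]; exact h25 0 (by omega)⟩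
    (fun x hx m' hf h31 ⟨i1, i2⟩ => by
      rw [f1 0 (by norm_num) (by norm_num), h0] at hx
      have e25 : m' 25 (x + 1) = f (x + 1) := by
        rw [hf 25 (by simp [argminStep, writes, skip]), f1 25 (by norm_num) (by norm_num)]
        exact h25 _ (by omega)
      have hc : (Expr.sub (.var 33) (.load 25 (.add (.var 31) (.lit 1)))).eval m' ≠ 0 ↔
          f (x + 1) < f (Par.argmin f x) := by
        simp only [Expr.eval, h31, i2, e25]; omega
      rw [Par.argmin, argminStep, den]
      by_cases h : f (x + 1) < f (Par.argmin f x)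
      · rw [if_pos h, if_pos (hc.mpr h)]
        simp [den, Mem.set_apply, Expr.eval, h31, e25]
      · rw [if_neg h, if_neg (fun h' => h (hc.mp h'))]
        simp [den, Mem.set_apply, Expr.eval, skip, i1, i2])
  rw [f1 0 (by norm_num) (by norm_num), h0] at hloop
  exact hloop.1

lemma den_baseProg {n g d : ℕ} {m : Mem} (h0 : m 0 0 = n) (h32 : m 32 0 = g) (hg : g ≤ n)
    (h16 : m 16 0 = d) : den baseProg m 35 0 = (g - 1) * d := by
  rw [baseProg, den]
  set m1 := den (set 35 (.lit 0)) m with hm1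
  have f1 : ∀ a, a ≠ 35 → m1 a = m a := fun a ha => den_of_notMem _ (by simp [writes, ha]) m
  have hloop := rep_induct (a := 34) (j := 0) (c := 0) (P := baseStep) m1
    (fun x m' => m' 35 0 = min x (g - 1) * d) (by simp [hm1, den, Mem.set_apply, Expr.eval])
    (fun x hx m' hf h34 hinv => by
      have e : ∀ a, a ≠ 34 → a ≠ 35 → a ≠ 40 → m' a = m a := fun a a1 a2 a3 => by
        rw [hf a (by simp [baseStep, writes, skip, a1, a2, a3]), f1 a a2]
      have hc : (Expr.sub (.var 32) (.add (.var 34) (.lit 1))).eval m' ≠ 0 ↔ x < g - 1 := by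
        simp only [Expr.eval, h34]
        rw [e 32 (by norm_num) (by norm_num) (by norm_num), h32]; omega
      have e16 : m' 16 0 = d := by rw [e 16 (by norm_num) (by norm_num) (by norm_num), h16]
      rw [baseStep, den, Mem.set_ne _ _ _ (by norm_num)]
      by_cases h : x < g - 1
      · rw [if_pos (hc.mpr h), min_eq_left (by omega)]
        rw [min_eq_left (by omega)] at hinv
        simp [den, Mem.set_apply, Expr.eval, hinv, e16, Nat.add_mul]
      · rw [if_neg (fun h' => h (hc.mp h')), min_eq_right (by omega)]
        rw [min_eq_right (by omega)] at hinv
        simp [den, Mem.set_apply, Expr.eval, hinv, skip])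
  rw [f1 0 (by norm_num), h0, Nat.add_zero, min_eq_right (by omega)] at hloop
  exact hloop

/-- At most one marker per bit: so a loop over the events reaches the last row of the table. -/
lemma Par.scan_cnt_le_self (P : Par) (β : ℕ → Bool) (t : ℕ) : (P.scan β t).cnt ≤ t := by
  induction t with
  | zero => exact le_rfl
  | succ t ih =>
    rw [Par.scan, Par.scanStep]
    generalize (if β t = true then 1 else if (P.scan β t).zc = 0 then 0 else
      (P.scan β t).zc + 1) = z
    split_ifs <;> dsimp only <;> omega

lemma HasScan.congr {s : Par.Scan} {m m' : Mem} (h : HasScan s m)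
    (hm : ∀ a, 18 ≤ a → a ≤ 22 → m' a = m a) : HasScan s m' := by
  obtain ⟨h1, h2, h3, h4, h5⟩ := h
  refine ⟨?_, ?_, ?_, ?_, fun i => ?_⟩ <;> rw [hm _ (by norm_num) (by norm_num)] <;>
    first | assumption | apply h5

lemma hasScan_rep {P : Par} {w : List Bool} {m : Mem} (h6 : m 6 0 = w.length)
    (h7 : ∀ i, m 7 i = bitArray w i) (h14 : m 14 0 = P.h) (h03 : m 0 3 = P.R)
    (h04 : w.length ≤ m 0 4) (hfree : ∀ a, 17 < a → a < 40 → ∀ i, m a i = 0) :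
    HasScan (P.scan (fun i => w.getD i false) w.length) (den (rep 17 4 0 (scanProg P.q)) m) := by
  have hloop := rep_induct (a := 17) (j := 4) (c := 0) (P := scanProg P.q) m
    (fun x m' => HasScan (P.scan (fun i => w.getD i false) (min x w.length)) m')
    (by
      rw [Nat.zero_min]
      refine ⟨?_, ?_, ?_, ?_, fun i => ?_⟩ <;>
        rw [Mem.set_ne _ _ _ (by norm_num), hfree _ (by norm_num) (by norm_num)] <;> rfl)
    (fun x hx m' hf h17 hinv => by
      have e : ∀ a, a < 17 → m' a = m a := fun a a1 =>
        hf a (by simp [scanProg, zerosProg, markerProg, writes, skip]; omega)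
      refine HasScan.congr (m := den (scanProg P.q) m') ?_ fun a h1 h2 =>
        Mem.set_ne _ _ _ (by omega)
      rcases Nat.lt_or_ge x w.length with h | h
      · rw [min_eq_left (by omega)] at hinv ⊢
        exact den_scanProg hinv (fun i => by rw [e 7 (by norm_num), h7]; rfl)
          (by rw [e 14 (by norm_num), h14]) (by rw [e 0 (by norm_num), h03]) h17
          (by rw [e 6 (by norm_num), h6]; exact h)
      · rw [min_eq_right (by omega)] at hinv ⊢
        have hc : (Expr.sub (.var 6) (.var 17)).eval m' = 0 := by
          simp only [Expr.eval, h17]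
          rw [e 6 (by norm_num), h6]; omega
        rw [scanProg, den, if_neg (by rw [hc]; simp)]
        exact hinv.congr fun a h1 h2 => Mem.set_ne _ _ _ (by omega))
  rwa [Nat.add_zero, min_eq_right h04] at hloop

namespace FProg

def okProg (q : ℕ) : FProg :=
  ite (xorE (.var 20) (.add (.var 19) (.load 0 (.lit 3)))) skip
    (ite (.var 32)
      (ite (.sub (.add (.var 14) (.lit (q + 1))) (.var 36)) skip
        (ite (.sub (.add (.var 36) (.var 14)) (.load 0 (.lit 3))) skip
          (ite (isDataE 37) (set 38 (.lit 1)) skip))) skip)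

def decProg (q : ℕ) : FProg :=
  seq (seq (set 36 (.sub (.var 6) (.var 19)))
    (seq (set 37 (.add (.var 35) (.sub (.var 36) (.add (.var 14) (.lit (q + 1))))))
    (seq (set 38 (.lit 0))
    (set 39 (xorE (.load 7 (.sub (.var 6) (.lit 1)))
      (.load 7 (.sub (.sub (.var 6) (.lit 1)) (.var 14))))))))
    (okProg q)

def revealProg : FProg :=
  ite (.var 38) (ite (xorE (.var 37) (.var 8)) (set 4 (.lit 0)) (set 4 (.var 39))) (set 4 (.lit 0))

def sendProg : FProg :=
  ite (.sub (.lit 2) (.var 10))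
    (ite (.var 38) (ite (xorE (.var 8) (.add (.var 37) (.lit 1))) (set 4 (.lit 2))
      (set 4 (.add (.lit 2) (.var 10)))) (set 4 (.lit 2))) (set 4 (.lit 2))

/-- The first test is `n / 2 ≤ c + e` without division: it is equivalent to `n ≤ 2 c + 2 e + 1`. -/
def bobOut : FProg :=
  ite (.sub (.load 0 (.lit 0)) (.add (.add (.add (.var 6) (.var 6))
      (.add (.load 0 (.lit 1)) (.load 0 (.lit 1)))) (.lit 1)))
    (ite (.var 38) (ite (.sub (.add (.var 37) (.lit 1)) (.var 8)) revealProg sendProg) sendProg)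
    (ite (isDataE 8) revealProg sendProg)

def bobProg (q : ℕ) : FProg :=
  seq readEvents (ite (.load 0 (.lit 1))
    (seq (lengthsProg q) (seq (rep 17 4 0 (scanProg q)) (seq tableProg (seq argminProg
      (seq baseProg (seq (decProg q) bobOut)))))) passOnProg)

end FProg

/-- The decoded data symbol is in the memory. -/
structure HasDec (d : Option (ℕ × Bool)) (m : Mem) : Prop where
  none : d = none → m 38 0 = 0
  some : ∀ i b, d = some (i, b) → m 38 0 = 1 ∧ m 37 0 = i ∧ m 39 0 = b.toNat

lemma hasDec_decProg {P : Par} {w : List Bool} {m : Mem} (h6 : m 6 0 = w.length)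
    (h7 : ∀ i, m 7 i = bitArray w i) (h14 : m 14 0 = P.h) (par : HasPar P m)
    (hs : HasScan (P.scan (fun i => w.getD i false) w.length) m)
    (h32 : m 32 0 = P.guess (P.scan (fun i => w.getD i false) w.length))
    (h35 : m 35 0 = (P.guess (P.scan (fun i => w.getD i false) w.length) - 1) * P.dl) :
    HasDec (P.dec w) (den (decProg P.q) m) := by
  unfold Par.dec
  dsimp only
  generalize P.scan (fun i => w.getD i false) w.length = s at *
  rw [decProg, den]
  generalize hm1 : den (seq (set 36 (.sub (.var 6) (.var 19)))
    (seq (set 37 (.add (.var 35) (.sub (.var 36) (.add (.var 14) (.lit (P.q + 1))))))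
    (seq (set 38 (.lit 0))
    (set 39 (xorE (.load 7 (.sub (.var 6) (.lit 1)))
      (.load 7 (.sub (.sub (.var 6) (.lit 1)) (.var 14)))))))) m = m1
  have f1 : ∀ a, a < 36 → m1 a = m a := fun a ha => by
    rw [← hm1]; exact den_of_notMem _ (by simp [writes]; omega) m
  have h19 := hs.tau
  have e36 : m1 36 0 = w.length - s.tau := by
    rw [← hm1]; simp [den, Mem.set_apply, Expr.eval, h6, h19]
  have e37 : m1 37 0 = (P.guess s - 1) * P.dl + (w.length - s.tau - (P.h + P.q + 1)) := by
    rw [← hm1]; simp [den, Mem.set_apply, Expr.eval, h6, h19, h14, h35, Nat.add_assoc]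
  have e38 : m1 38 0 = 0 := by rw [← hm1]; simp [den, Mem.set_apply, Expr.eval]
  have e39 : m1 39 0 = (xor (w.getD (w.length - 1) false)
      (w.getD (w.length - 1 - P.h) false)).toNat := by
    have : m1 39 0 = (xorE (.load 7 (.sub (.var 6) (.lit 1)))
      (.load 7 (.sub (.sub (.var 6) (.lit 1)) (.var 14)))).eval m := by
      rw [← hm1]; simp [den, Mem.set_apply, Expr.eval, xorE]
    rw [this]
    exact eval_xorE _ _ _ (by simp only [Expr.eval, h6, h7]; rfl)
      (by simp only [Expr.eval, h6, h7, h14]; rfl)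
  generalize (P.guess s - 1) * P.dl + (w.length - s.tau - (P.h + P.q + 1)) = i at *
  generalize xor (w.getD (w.length - 1) false) (w.getD (w.length - 1 - P.h) false) = b at *
  have c1 : (xorE (.var 20) (.add (.var 19) (.load 0 (.lit 3)))).eval m1 = 0 ↔
      s.na = s.tau + P.R := by
    rw [eval_xorE_eq_zero]
    simp only [Expr.eval]
    rw [f1 20 (by norm_num), f1 19 (by norm_num), f1 0 (by norm_num), hs.na, hs.tau, par.R]
  have c2 : (Expr.var 32).eval m1 = P.guess s := by
    simp only [Expr.eval]; rw [f1 32 (by norm_num), h32]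
  have c3 : (Expr.sub (.add (.var 14) (.lit (P.q + 1))) (.var 36)).eval m1 = 0 ↔
      P.h + P.q + 1 ≤ w.length - s.tau := by
    simp only [Expr.eval]; rw [f1 14 (by norm_num), h14, e36]; omega
  have c4 : (Expr.sub (.add (.var 36) (.var 14)) (.load 0 (.lit 3))).eval m1 = 0 ↔
      w.length - s.tau + P.h ≤ P.R := by
    simp only [Expr.eval]
    rw [f1 14 (by norm_num), f1 0 (by norm_num), h14, e36, par.R]; omega
  have c5 : (isDataE 37).eval m1 = 0 ↔ ¬ i < P.D := by
    rw [eval_isDataE (P := P) (by rw [f1 0 (by norm_num), par.N]), e37]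
  have hskip : ∀ a, a ≠ 40 → den skip m1 a = m1 a := fun a ha => Mem.set_ne _ _ _ ha
  have hno : HasDec none (den skip m1) :=
    ⟨fun _ => by rw [hskip 38 (by norm_num), e38], nofun⟩
  have d0 : ∀ x A B, den (ite x A B) m1 = if x.eval m1 ≠ 0 then den A m1 else den B m1 :=
    fun _ _ _ => rfl
  rw [okProg, d0]
  by_cases k1 : s.na = s.tau + P.R
  swap
  · rw [if_pos (fun h => k1 (c1.mp h)), if_neg (fun h => k1 h.1)]; exact hno
  rw [if_neg (not_not.mpr (c1.mpr k1)), d0, c2]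
  by_cases k2 : 0 < P.guess s
  swap
  · rw [if_neg (show ¬ P.guess s ≠ 0 by omega), if_neg (fun h => k2 h.2.1)]; exact hno
  rw [if_pos (show P.guess s ≠ 0 by omega), d0]
  by_cases k3 : P.h + P.q + 1 ≤ w.length - s.tau
  swap
  · rw [if_pos (fun h => k3 (c3.mp h)), if_neg (fun h => k3 h.2.2.1)]; exact hno
  rw [if_neg (not_not.mpr (c3.mpr k3)), d0]
  by_cases k4 : w.length - s.tau + P.h ≤ P.R
  swap
  · rw [if_pos (fun h => k4 (c4.mp h)), if_neg (fun h => k4 h.2.2.2.1)]; exact hno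
  rw [if_neg (not_not.mpr (c4.mpr k4)), d0]
  by_cases k5 : i < P.D
  swap
  · rw [if_neg (not_not.mpr (c5.mpr k5)), if_neg (fun h => k5 h.2.2.2.2)]; exact hno
  rw [if_pos (fun h => c5.mp h k5), if_pos ⟨k1, k2, k3, k4, k5⟩]
  refine ⟨nofun, fun j c h => ?_⟩
  cases h
  simp [den, Mem.set_apply, Expr.eval, e37, e39]

lemma den_revealProg {d : Option (ℕ × Bool)} {j : ℕ} {m : Mem} (h : HasDec d m)
    (h8 : m 8 0 = j) :
    den revealProg m 4 0 = (Action.reveal (decide (d = some (j, true)))).code := by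
  rcases d with _ | ⟨i, b⟩
  · have := h.none rfl
    simp [revealProg, den, Expr.eval, this, Mem.set_apply, Action.code]
  · obtain ⟨h1, h2, h3⟩ := h.some i b rfl
    have hc : (xorE (.var 37) (.var 8)).eval m = 0 ↔ i = j := by
      rw [eval_xorE_eq_zero]; simp [Expr.eval, h2, h8]
    have d0 : den revealProg m = if (xorE (.var 37) (.var 8)).eval m ≠ 0 then
        den (set 4 (.lit 0)) m else den (set 4 (.var 39)) m := by
      simp [revealProg, den, Expr.eval, h1]
    rw [d0]
    by_cases hij : i = j
    · rw [if_neg (not_not.mpr (hc.mpr hij))]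
      cases b <;> simp [den, Expr.eval, Mem.set_apply, Action.code, h3, hij]
    · rw [if_pos (fun h => hij (hc.mp h))]
      simp [den, Expr.eval, Mem.set_apply, Action.code, hij]

/-- The symbol that Bob's intermediary sends. -/
def reply (d : Option (ℕ × Bool)) (ev : List Event) : Bool :=
  match ev.getLast? with
  | some (.user y) =>
    match d with
    | some (i, _) => if (userBits ev).length = i + 1 then y else false
    | none => false
  | _ => false

lemma den_sendProg {d : Option (ℕ × Bool)} {ev : List Event} {m : Mem} (h : HasDec d m)
    (h8 : m 8 0 = (userBits ev).length) (h10 : m 10 0 = lastCode ev) :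
    den sendProg m 4 0 = (Action.send (reply d ev)).code := by
  have hno : lastCode ev = 2 ∨ 3 ≤ lastCode ev → den sendProg m 4 0 = 2 := by
    intro hl
    have : (Expr.sub (.lit 2) (.var 10)).eval m = 0 := by simp only [Expr.eval, h10]; omega
    rw [sendProg, den, if_neg (not_not.mpr this)]
    simp [den, Expr.eval, Mem.set_apply]
  unfold lastCode at h10 hno
  unfold reply
  rcases hl : ev.getLast? with _ | (y | _ | y)
  · rw [hno (Or.inl (by simp [hl]))]; rfl
  · rw [hl] at h10
    have hy : m 10 0 = y.toNat := h10
    have hlt := y.toNat_le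
    have hc1 : (Expr.sub (.lit 2) (.var 10)).eval m ≠ 0 := by simp only [Expr.eval, hy]; omega
    rw [sendProg, den, if_pos hc1]
    rcases d with _ | ⟨i, b⟩
    · have := h.none rfl
      simp [den, Expr.eval, this, Mem.set_apply, Action.code]
    · obtain ⟨h1, h2, h3⟩ := h.some i b rfl
      have hc : (xorE (.var 8) (.add (.var 37) (.lit 1))).eval m = 0 ↔
          (userBits ev).length = i + 1 := by
        rw [eval_xorE_eq_zero]; simp [Expr.eval, h2, h8]
      rw [den, if_pos (by simp [Expr.eval, h1]), den]
      by_cases hij : (userBits ev).length = i + 1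
      · rw [if_neg (not_not.mpr (hc.mpr hij))]
        simp [den, Expr.eval, Mem.set_apply, Action.code, hij, hy]
      · rw [if_pos (fun h => hij (hc.mp h))]
        simp [den, Expr.eval, Mem.set_apply, Action.code, hij]
  · rw [hno (Or.inl (by simp [hl, Event.code]))]; rfl
  · rw [hno (Or.inr (by simp [hl, Event.code]))]; rfl

lemma den_bobOut {P : Par} {ev : List Event} {m : Mem} (hr : HasRead ev m) (par : HasPar P m)
    (h : HasDec (P.dec (channelBits ev)) m) :
    den bobOut m 4 0 = (P.actB ev).code := by
  have hrev := den_revealProg h hr.user_length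
  have hsend := den_sendProg h hr.user_length hr.last
  have d0 : ∀ x A B, den (ite x A B) m = if x.eval m ≠ 0 then den A m else den B m :=
    fun _ _ _ => rfl
  have hc : (Expr.sub (.load 0 (.lit 0)) (.add (.add (.add (.var 6) (.var 6))
      (.add (.load 0 (.lit 1)) (.load 0 (.lit 1)))) (.lit 1))).eval m = 0 ↔
      P.n / 2 ≤ (channelBits ev).length + P.e := by
    simp only [Expr.eval, hr.channel_length, par.n, par.e]; omega
  have hD := eval_isDataE par.N 8
  rw [hr.user_length] at hD
  unfold Par.actB
  dsimp only
  unfold Par.goal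
  rw [bobOut, d0]
  by_cases k1 : P.n / 2 ≤ (channelBits ev).length + P.e
  · rw [if_neg (not_not.mpr (hc.mpr k1)), if_pos k1, d0]
    by_cases k2 : (userBits ev).length < P.D
    · rw [if_pos (fun h => hD.mp h k2), if_pos k2, hrev]
    · rw [if_neg (not_not.mpr (hD.mpr k2)), if_neg k2, hsend]; rfl
  · rw [if_pos (fun h => k1 (hc.mp h)), if_neg k1, d0]
    generalize P.dec (channelBits ev) = d at *
    rcases d with _ | ⟨i, b⟩
    · have := h.none rfl
      rw [if_neg (by simp [Expr.eval, this]), if_neg (by simp), hsend]; rfl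
    · obtain ⟨h1, h2, h3⟩ := h.some i b rfl
      rw [if_pos (by simp [Expr.eval, h1]), d0]
      have hc2 : (Expr.sub (.add (.var 37) (.lit 1)) (.var 8)).eval m = 0 ↔
          ¬ (userBits ev).length < i + 1 := by
        simp only [Expr.eval, h2, hr.user_length]; omega
      dsimp only
      by_cases k2 : (userBits ev).length < i + 1
      · rw [if_pos (fun h => hc2.mp h k2), if_pos k2, hrev]
      · rw [if_neg (not_not.mpr (hc2.mpr k2)), if_neg k2, hsend]; rfl

/-- Apart from array `40`, the phases write to later and later arrays. So whatever one phase has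
established survives the following ones by the frame rule. -/
lemma den_bobProg {q n e N r : ℕ} {S : ℕ → ℕ} {ω : ℕ → Bool} {ev : List Event} {m : Mem}
    (h : IsInput (scheme q n e N r S) ω ev m) (hr : e ≠ 0 → r ≤ n) :
    den (bobProg q) m 4 0 =
      (if e = 0 then passOn N ev else (scheme q n e N r S).actB ev).code := by
  set P := scheme q n e N r S with hP
  have hread := h.hasRead
  rw [bobProg, den]
  set m1 := den readEvents m with hm1
  have f1 : ∀ a, a < 5 ∨ 10 < a ∧ a < 40 → m1 a = m a := fun a ha => readEvents_frame ha
  have par1 : HasPar P m1 := h.par.congr fun a ha => f1 a (by omega)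
  have he : (Expr.load 0 (.lit 1)).eval m1 = e := par1.e
  rw [den, he]
  by_cases he0 : e = 0
  · rw [if_neg (by simpa using he0), if_pos he0, den_passOnProg hread]
    have : m1 0 2 = N := par1.N
    rw [this]
  · rw [if_pos he0, if_neg he0, den]
    have len2 : HasLengths P (den (lengthsProg q) m1) := hasLengths_lengthsProg par1 (hr he0)
    set m2 := den (lengthsProg q) m1 with hm2
    have f2 : ∀ a, a < 11 ∨ 16 < a ∧ a < 40 → m2 a = m1 a := fun a ha => lengthsProg_frame ha
    have read2 : HasRead ev m2 := hread.congr fun a h1 h2 => f2 a (by omega)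
    have par2 : HasPar P m2 := par1.congr fun a ha => f2 a (by omega)
    have h04 : (channelBits ev).length ≤ m2 0 4 := by
      rw [f2 0 (by norm_num), f1 0 (by norm_num), h.length]; exact channelBits_length_le ev
    have hscan := hasScan_rep (P := P) read2.channel_length read2.channel len2.h par2.R h04
      (fun a h1 h2 i => by rw [f2 a (by omega), f1 a (by omega), h.free a (by omega)])
    set s := P.scan (fun i => (channelBits ev).getD i false) (channelBits ev).length with hs
    rw [den]
    set m3 := den (rep 17 4 0 (scanProg q)) m2 with hm3
    have f3 : ∀ a, a < 17 → m3 a = m2 a := fun a ha =>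
      den_of_notMem _ (by simp [scanProg, zerosProg, markerProg, writes, skip]; omega) _
    have par3 : HasPar P m3 := par2.congr fun a ha => f3 a (by omega)
    have htab := den_tableProg par3.n rfl par3.S hscan.y hscan.cnt
      (by
        rw [f3 0 (by norm_num)]
        exact (P.scan_cnt_le_self _ _).trans h04)
    rw [den]
    set m4 := den tableProg m3 with hm4
    have f4 : ∀ a, a < 24 → m4 a = m3 a := fun a ha =>
      den_of_notMem _ (by simp [tableProg, rowProg, cellProg, writes, skip]; omega) _
    have par4 : HasPar P m4 := par3.congr fun a ha => f4 a (by omega)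
    have hguess := den_argminProg (m := m4) par4.n htab
    rw [den]
    set m5 := den argminProg m4 with hm5
    have f5 : ∀ a, a < 24 → m5 a = m4 a := fun a ha =>
      den_of_notMem _ (by simp [argminProg, argminStep, writes, skip]; omega) _
    have par5 : HasPar P m5 := par4.congr fun a ha => f5 a (by omega)
    have h16 : m5 16 0 = P.dl := by
      rw [f5 16 (by norm_num), f4 16 (by norm_num), f3 16 (by norm_num), len2.dl]
    have hbase := den_baseProg par5.n hguess (Par.argmin_le _ _).1 h16
    rw [den]
    set m6 := den baseProg m5 with hm6
    have f6 : ∀ a, a < 33 → m6 a = m5 a := fun a ha =>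
      den_of_notMem _ (by simp [baseProg, baseStep, writes, skip]; omega) _
    have f63 : ∀ a, a < 24 → m6 a = m3 a := fun a ha => by
      rw [f6 a (by omega), f5 a ha, f4 a ha]
    have par6 : HasPar P m6 := par5.congr fun a ha => f6 a (by omega)
    have read6 : HasRead ev m6 := read2.congr fun a h1 h2 => by
      rw [f63 a (by omega), f3 a (by omega)]
    have hdec := hasDec_decProg (P := P) (m := m6) read6.channel_length read6.channel
      (by rw [f63 14 (by norm_num), f3 14 (by norm_num), len2.h]) par6
      (hscan.congr fun a h1 h2 => f63 a (by omega))
      (by rw [f6 32 (by norm_num)]; exact hguess) hbase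
    rw [den]
    have f7 : ∀ a, a < 36 → den (decProg q) m6 a = m6 a := fun a ha =>
      den_of_notMem _ (by simp [decProg, okProg, writes, skip]; omega) _
    exact den_bobOut (read6.congr fun a h1 h2 => f7 a (by omega))
      (par6.congr fun a ha => f7 a (by omega)) hdec

lemma wf_bobProg (q : ℕ) : Wf (bobProg q) := by
  have h1 := wf_readEvents
  simp [bobProg, Wf, h1, lengthsProg, sizeProg, doubleStep, scanProg, zerosProg, markerProg,
    tableProg, rowProg, cellProg, argminProg, argminStep, baseProg, baseStep, decProg, okProg,
    bobOut, revealProg, sendProg, passOnProg, skip, writes]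

end IndelSim

/-! ### Assembly of the simulation theorem. -/

namespace IndelSim

open FProg

lemma isInput_inputMem {q n e N r : ℕ} (S : List (Fin q)) (ω : Fin n → Bool) (h : List Event) :
    IsInput (scheme q n e N r fun i => (S.map Fin.val).getD i 0) (coins ω) h
      (inputMem [n, e, N, r] S ω h) where
  par := ⟨rfl, rfl, rfl, rfl, fun _ => rfl⟩
  coins i := by
    change (if hi : i < n then (ω ⟨i, hi⟩).toNat else 0) = _
    unfold coins
    split_ifs <;> rfl
  events _ := rfl
  length := rfl
  free a ha i := by
    obtain ⟨b, rfl⟩ := Nat.exists_eq_add_of_le' ha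
    rfl

/-- The bound `n + k + 1` covers both possible limits of loops, `n` and the number `k` of events. -/
lemma computedBy_compile {q n e N r K d : ℕ} {S : List (Fin q)} {P : FProg} (hP : Wf P)
    (hb : ∀ B, 1 ≤ B → bound B P ≤ K * B ^ d) {A : Intermediary n}
    (hA : ∀ ω h, den P (inputMem [n, e, N, r] S ω h) 4 0 = (A ω h).code) :
    ComputedBy [n, e, N, r] S (fun k => K * (n + k + 1) ^ d) (compile P) A := by
  intro ω h
  have hI := isInput_inputMem (e := e) (N := N) (r := r) S ω h
  have h0 : inputMem [n, e, N, r] S ω h 0 0 = n := hI.par.n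
  obtain ⟨t, ht, ex⟩ := exec_compile hP (B := n + h.length + 1)
    (inputMem [n, e, N, r] S ω h) (by rw [h0]; omega)
    (by rw [hI.length]; omega)
  exact ⟨t, _, ex, ht.trans (hb _ (by omega)), hA ω h⟩

/-- A possible edit means `n δ ≥ 1`, and `δ * blockLength δ = loss δ ≤ 1`. The upper bound lets
`sizeProg` finish within `n` passes, the lower bound makes the marker nonempty. -/
lemma floor_blockLength_le {q n : ℕ} {δ l : ℝ} (hr : Regime q δ l) (h : ⌊(n : ℝ) * δ⌋₊ ≠ 0) :
    0 < ⌊blockLength δ⌋₊ ∧ ⌊blockLength δ⌋₊ ≤ n := by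
  have h1 : 1 ≤ (n : ℝ) * δ := (Nat.floor_pos).mp (Nat.pos_of_ne_zero h)
  refine ⟨Nat.floor_pos.mpr (by linarith [hr.two_le_block]), ?_⟩
  have h2 := hr.mul_block
  have h3 := hr.loss_le
  have h4 := hr.loss_pos
  have h5 := lossConst_ge q
  have h6 : δ * blockLength δ ≤ δ * n := by
    rw [h2, mul_comm δ]
    nlinarith
  exact Nat.floor_le_of_le (le_of_mul_le_mul_left h6 hr.pos)

theorem exists_simulation (ε : ℝ) (q : ℕ) (hε0 : 0 < ε) (hε : ε < 1) :
    ∃ (PA PB : Prog) (K d : ℕ) (C C' c δ₀ : ℝ),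
      0 < C ∧ 0 < C' ∧ 0 < c ∧ 0 < δ₀ ∧ δ₀ < 1 ∧
      ∀ (δ : ℝ) (n : ℕ), 0 < δ → δ ≤ δ₀ → Even n →
        ∀ S : List (Fin q), S.length = n → IsSyncString ε S →
          ∃ (L : ℕ) (A B : Intermediary L), L ≤ K * (n + 1) ^ d ∧
            ComputedBy [n, ⌊(n : ℝ) * δ⌋₊, simRounds C δ n, ⌊blockLength δ⌋₊]
              S (fun k => K * (n + k + 1) ^ d) PA A ∧
            ComputedBy [n, ⌊(n : ℝ) * δ⌋₊, simRounds C δ n, ⌊blockLength δ⌋₊]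
              S (fun k => K * (n + k + 1) ^ d) PB B ∧
            Simulates n ⌊(n : ℝ) * δ⌋₊ (simRounds C δ n) (C' * loss δ) (blockLength δ)
              (Real.exp (-(c * (n * δ * Real.log (1 / δ))))) A B := by
  obtain ⟨K₁, d₁, h₁⟩ := bound_le (aliceProg q)
  obtain ⟨K₂, d₂, h₂⟩ := bound_le (bobProg q)
  have hle : ∀ K d K' d' B : ℕ, K ≤ K' → d ≤ d' → 1 ≤ B → K * B ^ d ≤ K' * B ^ d' :=
    fun K d K' d' B hK hd hB => Nat.mul_le_mul hK (Nat.pow_le_pow_right hB hd)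
  have hrate : 0 < rateConst ε := div_pos (by norm_num) (by linarith)
  refine ⟨compile (aliceProg q), compile (bobProg q), K₁ + K₂ + 1, d₁ + d₂ + 1, lossConst q,
    rateConst ε, 1, maxRate q, by linarith [lossConst_ge q], hrate, one_pos, maxRate_pos q,
    (maxRate_le q).trans_lt (by norm_num), fun δ n h0 h1 hev S hlen hS => ?_⟩
  have hreg := regime (q := q) h0 h1
  have hfl := floor_blockLength_le (n := n) hreg
  set e := ⌊(n : ℝ) * δ⌋₊ with he
  set N := simRounds (lossConst q) δ n with hN
  set r := ⌊blockLength δ⌋₊ with hr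
  set P := scheme q n e N r fun i => (S.map Fin.val).getD i 0 with hP
  -- One coin for each position is enough, and there are at most `n` positions in the blocks used.
  -- Bob's intermediary ignores its coins.
  refine ⟨n, fun ω ev => if e = 0 then passOn N ev else P.actA (coins ω) ev,
    fun _ ev => if e = 0 then passOn N ev else P.actB ev, ?_,
    computedBy_compile (wf_aliceProg q)
      (fun B hB => (h₁ B hB).trans (hle _ _ _ _ _ (by omega) (by omega) hB))
      fun ω h => den_aliceProg (isInput_inputMem S ω h) hfl,
    computedBy_compile (wf_bobProg q)
      (fun B hB => (h₂ B hB).trans (hle _ _ _ _ _ (by omega) (by omega) hB))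
      fun ω h => den_bobProg (isInput_inputMem S ω h) fun h => (hfl h).2, ?_⟩
  · calc n ≤ 1 * (n + 1) ^ 1 := by rw [pow_one, one_mul]; omega
      _ ≤ _ := hle _ _ _ _ _ (by omega) (by omega) (by omega)
  · by_cases he0 : e = 0
    · simp only [he0, if_true]
      refine passOn_simulates hev (even_two_mul _) ?_ (mul_nonneg hrate.le hreg.loss_pos.le)
        (Real.sqrt_nonneg _)
        (Real.exp_pos _).le n
      have h2 := Regime.simRounds_le (δ := δ) (n := n) (lossConst q) (by linarith [hreg.loss_le])
      have h3 : 0 < lossConst q * loss δ := mul_pos (by linarith [lossConst_ge q]) hreg.loss_pos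
      have h4 : ((N / 2 : ℕ) : ℝ) ≤ n / 2 := by
        refine h2.trans ?_
        have : (0 : ℝ) ≤ n := Nat.cast_nonneg n
        nlinarith
      have h5 : N = 2 * (N / 2) := (Nat.two_mul_div_two_of_even (even_two_mul _)).symm
      have h6 : ((N / 2 : ℕ) : ℝ) * 2 ≤ n := by linarith
      have h7 : N / 2 * 2 ≤ n := by exact_mod_cast h6
      exact h5.le.trans (by rw [mul_comm]; exact h7)
    · simp only [he0, if_false]
      exact scheme_simulates hε0 hε h0 h1 hev
        (Nat.floor_pos.mp (Nat.pos_of_ne_zero he0)) hlen hS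

end IndelSim

theorem mainTheorem2 :
    -- the simulation
    (∃ C C' c δ₀ : ℝ, 0 < C ∧ 0 < C' ∧ 0 < c ∧ 0 < δ₀ ∧ δ₀ < 1 ∧
      ∀ (δ : ℝ) (n : ℕ), 0 < δ → δ ≤ δ₀ → Even n →
        ∃ (L : ℕ) (A B : IndelSim.Intermediary L),
          IndelSim.Simulates n ⌊(n : ℝ) * δ⌋₊ (IndelSim.simRounds C δ n)
            (C' * IndelSim.loss δ) (IndelSim.blockLength δ)
            (Real.exp (-(c * (n * δ * Real.log (1 / δ))))) A B) ∧
    -- its efficiency, given a synchronization string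
    (∀ (ε : ℝ) (q : ℕ), 0 < ε → ε < 1 →
      ∃ (PA PB : IndelSim.Prog) (K d : ℕ) (C C' c δ₀ : ℝ),
        0 < C ∧ 0 < C' ∧ 0 < c ∧ 0 < δ₀ ∧ δ₀ < 1 ∧
        ∀ (δ : ℝ) (n : ℕ), 0 < δ → δ ≤ δ₀ → Even n →
          ∀ S : List (Fin q), S.length = n → IndelSim.IsSyncString ε S →
            ∃ (L : ℕ) (A B : IndelSim.Intermediary L),
              L ≤ K * (n + 1) ^ d ∧
              IndelSim.ComputedBy
                [n, ⌊(n : ℝ) * δ⌋₊, IndelSim.simRounds C δ n, ⌊IndelSim.blockLength δ⌋₊]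
                S (fun k => K * (n + k + 1) ^ d) PA A ∧
              IndelSim.ComputedBy
                [n, ⌊(n : ℝ) * δ⌋₊, IndelSim.simRounds C δ n, ⌊IndelSim.blockLength δ⌋₊]
                S (fun k => K * (n + k + 1) ^ d) PB B ∧
              IndelSim.Simulates n ⌊(n : ℝ) * δ⌋₊ (IndelSim.simRounds C δ n)
                (C' * IndelSim.loss δ) (IndelSim.blockLength δ)
                (Real.exp (-(c * (n * δ * Real.log (1 / δ))))) A B) := by
  refine ⟨?_, IndelSim.exists_simulation⟩
  -- For mere existence one fixed alphabet and `ε = 1 / 2` are enough, those of `exists_syncString`.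
  obtain ⟨_, _, _, _, C, C', c, δ₀, hC, hC', hc, h0, h1, h⟩ :=
    IndelSim.exists_simulation (1 / 2) (2 ^ 20) (by norm_num) (by norm_num)
  refine ⟨C, C', c, δ₀, hC, hC', hc, h0, h1, fun δ n hδ hδ' hn => ?_⟩
  obtain ⟨S, hlen, hS⟩ := IndelSim.exists_syncString n
  obtain ⟨L, A, B, -, -, -, hsim⟩ := h δ n hδ hδ' hn S hlen hS
  exact ⟨L, A, B, hsim⟩
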